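/- Let $\mathbb K=\mathbb R$ or $\mathbb C$, let $M$ be a closed (that is, compact, Hausdorff, without boundary) smooth manifold of dimension $n$, and let $L\subset M$ be a closed subset that is a regular submanifold of codimension $n'$, $0\le n'\le n$. Let $C^{-\infty}(M)=C^\infty(M;\Omega)'$ be the space of ($\mathbb K$-valued) distributions on $M$, the dual of the Fréchet space of smooth densities. Let $\mathfrak X(M,L)$ be the space of smooth vector fields on $M$ tangent to $L$, and let $\operatorname{Diff}(M,L)$ be the $C^\infty(M)$-module spanned by all finite compositions (including the empty one, the identity) of elements of $\mathfrak X(M,L)$, acting on $C^{-\infty}(M)$. For $s\in\mathbb R$, let $H^s(M)$ be the Sobolev space of order $s$, defined with an atlas of $M$ and a subordinate smooth partition of unity. Put $$I^{(s)}(M,L)=\{\,u\in C^{-\infty}(M)\mid Pu\in H^s(M)\ \text{for all}\ P\in\operatorname{Diff}(M,L)\,\},$$ with the projective topology given by the maps $P:I^{(s)}(M,L)\to H^s(M)$, $P\in\operatorname{Diff}(M,L)$, and $$I(M,L)=\bigcup_{s\in\mathbb R}I^{(s)}(M,L),$$ with the locally convex inductive limit topology. Then every $I^{(s)}(M,L)$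 is a Fréchet space, so that $I(M,L)$ is an inductive limit of Fréchet spaces (an LF-space), $I(M,L)$ is Hausdorff, and $I(M,L)$ is barreled, ultrabornological and webbed. Here a *disk* is a non-empty absolutely convex set, and a *Banach disk* is a bounded disk whose linear span is complete with the gauge of the disk. A locally convex space is *ultrabornological* if every disk that absorbs all Banach disks is a neighborhood of zero. A locally convex space $E$ is *webbed* if there are disks $W_{k_0,\dots,k_m}\subset E$ ($m,k_0,\dots,k_m\in\mathbb N$) with $\bigcup_{k}W_{k}=E$ and $\bigcup_kW_{k_0,\dots,k_m,k}=W_{k_0,\dots,k_m}$, such that, for every sequence $(k_m)$, there are numbers $r_m>0$ so that $\sum_mc_mx_m$ converges in $E$ whenever $x_m\in W_{k_0,\dots,k_m}$ and $c_m\in\mathbb K$ with $|c_m|\le r_m$. -/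

import Mathlib

open scoped Manifold ContDiff Topology SchwartzMap
namespace ConormalDist
noncomputable section

set_option linter.unusedSectionVars false

/-- `ℝⁿ` with its Euclidean norm. -/
abbrev Eucl (n : ℕ) : Type := EuclideanSpace ℝ (Fin n)

/-- For a vector field `Y` and a function `a` on `ℝⁿ`, the divergence `∑ i, ∂ᵢ (Yⁱ a)`. -/
def divg {𝕜 : Type*} [RCLike 𝕜] {n : ℕ} (Y : Eucl n → Eucl n) (a : Eucl n → 𝕜) (x : Eucl n) : 𝕜 :=
  ∑ i, fderiv ℝ (fun z ↦ Y z i • a z) x (EuclideanSpace.single i 1)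

section Calculus

variable {𝕜 : Type*} [RCLike 𝕜] {n : ℕ}

lemma det_eq (A : Eucl n →L[ℝ] Eucl n) :
    A.det = Matrix.det (Matrix.of fun i j ↦ (A (EuclideanSpace.single j 1)) i) := by
  rw [ContinuousLinearMap.det, ← LinearMap.det_toMatrix (EuclideanSpace.basisFun (Fin n) ℝ).toBasis]
  congr 1

lemma trace_eq (A : Eucl n →ₗ[ℝ] Eucl n) :
    LinearMap.trace ℝ (Eucl n) A = ∑ i, (A (EuclideanSpace.single i 1)) i := by
  rw [LinearMap.trace_eq_matrix_trace ℝ (EuclideanSpace.basisFun (Fin n) ℝ).toBasis,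
    Matrix.trace]
  simp [LinearMap.toMatrix_apply]

lemma contDiff_det : ContDiff ℝ ∞ (fun A : Eucl n →L[ℝ] Eucl n ↦ A.det) := by
  simp only [det_eq, Matrix.det_apply, Matrix.of_apply]
  refine ContDiff.sum fun σ _ ↦ ContDiff.const_smul _ (contDiff_prod fun i _ ↦ ?_)
  exact ((EuclideanSpace.proj (𝕜 := ℝ) (σ i)).comp
    (ContinuousLinearMap.apply ℝ (Eucl n) (EuclideanSpace.single i (1 : ℝ)))).contDiff

lemma fderiv_det_id (B : Eucl n →L[ℝ] Eucl n) :
    fderiv ℝ (fun A : Eucl n →L[ℝ] Eucl n ↦ A.det) (ContinuousLinearMap.id ℝ _) B =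
      LinearMap.trace ℝ (Eucl n) B := by
  have h1 : HasDerivAt (fun t : ℝ ↦ ContinuousLinearMap.id ℝ (Eucl n) + t • B) B 0 := by
    simpa using ((hasDerivAt_id (0 : ℝ)).smul_const B).const_add (ContinuousLinearMap.id ℝ (Eucl n))
  have h2 : HasFDerivAt (fun A : Eucl n →L[ℝ] Eucl n ↦ A.det)
      (fderiv ℝ (fun A : Eucl n →L[ℝ] Eucl n ↦ A.det) (ContinuousLinearMap.id ℝ _))
      (ContinuousLinearMap.id ℝ (Eucl n) + (0 : ℝ) • B) := by
    have h0 : ContinuousLinearMap.id ℝ (Eucl n) + (0 : ℝ) • B = ContinuousLinearMap.id ℝ _ := by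
      ext v : 1
      simp
    rw [h0]
    exact (contDiff_det.differentiable (by simp)).differentiableAt.hasFDerivAt
  have h3 := h2.comp_hasDerivAt (0 : ℝ) h1
  set N : Matrix (Fin n) (Fin n) ℝ := Matrix.of fun i j ↦ (B (EuclideanSpace.single j 1)) i
  set p : Polynomial ℝ := Matrix.det (1 + (Polynomial.X : Polynomial ℝ) • N.map Polynomial.C)
  have h4 : ((fun A : Eucl n →L[ℝ] Eucl n ↦ A.det) ∘
      fun t : ℝ ↦ ContinuousLinearMap.id ℝ (Eucl n) + t • B) = fun t ↦ p.eval t := by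
    funext t
    simp only [Function.comp, det_eq, p]
    rw [← Polynomial.coe_evalRingHom, RingHom.map_det]
    congr 1
    ext i j
    simp only [N, Matrix.of_apply, add_apply, smul_apply, ContinuousLinearMap.id_apply]
    by_cases h : i = j
    · subst h; simp
      exact mul_comm _ _
    · simp [h]
      exact mul_comm _ _
  rw [h4] at h3
  have h5 := h3.unique (p.hasDerivAt 0)
  rw [h5, Matrix.derivative_det_one_add_X_smul, trace_eq]
  simp [Matrix.trace, N]

lemma divg_eq {Y : Eucl n → Eucl n} {a : Eucl n → 𝕜} {x : Eucl n}
    (hY : DifferentiableAt ℝ Y x) (ha : DifferentiableAt ℝ a x) :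
    divg Y a x = fderiv ℝ a x (Y x) +
      (LinearMap.trace ℝ (Eucl n) (fderiv ℝ Y x)) • a x := by
  have h (i : Fin n) : HasFDerivAt (fun z ↦ Y z i)
      ((EuclideanSpace.proj (𝕜 := ℝ) i).comp (fderiv ℝ Y x)) x :=
    (EuclideanSpace.proj (𝕜 := ℝ) i).hasFDerivAt.comp x hY.hasFDerivAt
  have h2 (i : Fin n) := ((h i).smul ha.hasFDerivAt).fderiv
  have h4 : divg Y a x = ∑ i, (fderiv ℝ ((fun z ↦ Y z i) • a) x) (EuclideanSpace.single i 1) := rfl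
  rw [h4]
  simp only [h2]
  have h3 : Y x = ∑ i, Y x i • EuclideanSpace.single i (1 : ℝ) := by
    ext j; simp [Finset.sum_apply, Pi.single_apply]
  conv_rhs => rw [h3, map_sum, trace_eq, Finset.sum_smul, ← Finset.sum_add_distrib]
  simp

/-- The divergence of a density times a vector field does not depend on the coordinates. -/
lemma divg_comp {τ Y Z : Eucl n → Eucl n} {a b : Eucl n → 𝕜} {x : Eucl n}
    (hτ : ContDiffAt ℝ ∞ τ x) (hdet : (fderiv ℝ τ x).det ≠ 0)
    (hY : DifferentiableAt ℝ Y x) (hZ : DifferentiableAt ℝ Z (τ x))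
    (hb : DifferentiableAt ℝ b (τ x))
    (hab : ∀ᶠ y in 𝓝 x, a y = |(fderiv ℝ τ y).det| • b (τ y))
    (hYZ : ∀ᶠ y in 𝓝 x, Z (τ y) = fderiv ℝ τ y (Y y)) :
    divg Y a x = |(fderiv ℝ τ x).det| • divg Z b (τ x) := by
  set A : Eucl n ≃L[ℝ] Eucl n :=
    (fderiv ℝ τ x).toContinuousLinearEquivOfDetNeZero hdet with hA
  have hAc : (A : Eucl n →L[ℝ] Eucl n) = fderiv ℝ τ x := by
    ext v : 1; simp [hA]
  have hτ1 : HasFDerivAt τ (A : Eucl n →L[ℝ] Eucl n) x := by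
    rw [hAc]; exact (hτ.differentiableAt (by simp)).hasFDerivAt
  have hτ2 : HasFDerivAt (fderiv ℝ τ) (fderiv ℝ (fderiv ℝ τ) x) x :=
    ((hτ.fderiv_right (m := ∞) (by simp)).differentiableAt (by simp)).hasFDerivAt
  have hsymm : ∀ v w, fderiv ℝ (fderiv ℝ τ) x v w = fderiv ℝ (fderiv ℝ τ) x w v :=
    fun v w ↦ (hτ.isSymmSndFDerivAt (by
      simp only [minSmoothness_of_isRCLikeNormedField]
      exact ENat.LEInfty.out)) v w
  set D2 := fderiv ℝ (fderiv ℝ τ) x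
  set S : Eucl n →L[ℝ] Eucl n := (A.symm : Eucl n →L[ℝ] Eucl n)
  -- the derivative of the Jacobian
  have hQ : HasFDerivAt (fun y ↦ S.comp (fderiv ℝ τ y))
      ((ContinuousLinearMap.compL ℝ (Eucl n) (Eucl n) (Eucl n) S).comp D2) x :=
    ((ContinuousLinearMap.compL ℝ (Eucl n) (Eucl n) (Eucl n) S).hasFDerivAt).comp x hτ2
  have hQx : S.comp (fderiv ℝ τ x) = ContinuousLinearMap.id ℝ _ := by
    rw [← hAc]; ext v : 1; simp [S]
  have hdQ : HasFDerivAt (fun y ↦ (S.comp (fderiv ℝ τ y)).det)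
      ((fderiv ℝ (fun B : Eucl n →L[ℝ] Eucl n ↦ B.det) (ContinuousLinearMap.id ℝ _)).comp
        ((ContinuousLinearMap.compL ℝ (Eucl n) (Eucl n) (Eucl n) S).comp D2)) x := by
    have := (contDiff_det (n := n)).differentiable (by simp) (S.comp (fderiv ℝ τ x))
    have h := this.hasFDerivAt.comp x hQ
    rwa [hQx] at h
  have hJ : ∀ᶠ y in 𝓝 x, |(fderiv ℝ τ y).det| =
      |(fderiv ℝ τ x).det| * (S.comp (fderiv ℝ τ y)).det := by
    have hpos : 0 < (S.comp (fderiv ℝ τ x)).det := by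
      rw [hQx]; simp [ContinuousLinearMap.det]
    filter_upwards [hdQ.continuousAt.eventually (lt_mem_nhds hpos)] with y hy
    have h1 : fderiv ℝ τ y = (fderiv ℝ τ x).comp (S.comp (fderiv ℝ τ y)) := by
      rw [← hAc]; ext v : 1; simp [S]
    have h2 : (fderiv ℝ τ y).det = (fderiv ℝ τ x).det * (S.comp (fderiv ℝ τ y)).det := by
      conv_lhs => rw [h1]
      exact LinearMap.det_comp _ _
    rw [h2, abs_mul, abs_of_pos hy]
  have hbτ : HasFDerivAt (fun y ↦ b (τ y))
      ((fderiv ℝ b (τ x)).comp (A : Eucl n →L[ℝ] Eucl n)) x := hb.hasFDerivAt.comp x hτ1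
  have ha' : HasFDerivAt a _ x :=
    ((hdQ.const_mul |(fderiv ℝ τ x).det|).smul hbτ).congr_of_eventuallyEq (by
      filter_upwards [hab, hJ] with y h1 h2
      rw [h1, h2]; rfl)
  have hZτ : HasFDerivAt (fun y ↦ Z (τ y))
      ((fderiv ℝ Z (τ x)).comp (A : Eucl n →L[ℝ] Eucl n)) x := hZ.hasFDerivAt.comp x hτ1
  have hYd := (hτ2.clm_apply hY.hasFDerivAt).congr_of_eventuallyEq hYZ
  have hder := hZτ.unique hYd
  have htr : LinearMap.trace ℝ (Eucl n) (fderiv ℝ Y x) =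
      LinearMap.trace ℝ (Eucl n) (fderiv ℝ Z (τ x)) -
        LinearMap.trace ℝ (Eucl n) (S.comp (D2 (Y x))) := by
    have h1 : fderiv ℝ Y x = S.comp ((fderiv ℝ Z (τ x)).comp (A : Eucl n →L[ℝ] Eucl n)) -
        S.comp (D2 (Y x)) := by
      rw [hder]
      ext v : 1
      have h2 : S (fderiv ℝ τ x (fderiv ℝ Y x v)) = fderiv ℝ Y x v := by
        rw [← hAc]; simp [S]
      simp [h2, hsymm (Y x) v]
    have h3 : LinearMap.trace ℝ (Eucl n)
        (S.comp ((fderiv ℝ Z (τ x)).comp (A : Eucl n →L[ℝ] Eucl n))) =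
        LinearMap.trace ℝ (Eucl n) (fderiv ℝ Z (τ x)) := by
      refine (LinearMap.trace_comp_comm'
        ((fderiv ℝ Z (τ x)).comp (A : Eucl n →L[ℝ] Eucl n) : Eucl n →ₗ[ℝ] Eucl n)
        (S : Eucl n →ₗ[ℝ] Eucl n)).trans ?_
      congr 1
      ext v : 1
      simp [S]
    rw [h1, ContinuousLinearMap.toLinearMap_sub, map_sub, h3]
  have hYx := hYZ.self_of_nhds
  rw [divg_eq hY ha'.differentiableAt, divg_eq hZ hb, ha'.fderiv, htr, hab.self_of_nhds, hYx]
  have hdetid : (S.comp (fderiv ℝ τ x)).det = 1 := by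
    rw [hQx]; simp [ContinuousLinearMap.det]
  have hAY : A (Y x) = fderiv ℝ τ x (Y x) := by rw [← hAc]; rfl
  simp only [add_apply, smul_apply, ContinuousLinearMap.smulRight_apply,
    ContinuousLinearMap.comp_apply, fderiv_det_id, hdetid, mul_one,
    ContinuousLinearMap.compL_apply, ContinuousLinearEquiv.coe_coe, hAY, smul_add, smul_smul,
    smul_eq_mul]
  rw [add_assoc, ← add_smul]
  congr 2
  ring


lemma iteratedFDeriv_smul_bound {R : Type*} [NormedField R] [NormedAlgebra ℝ R] [NormedSpace R 𝕜]
    [IsScalarTower ℝ R 𝕜] {U K : Set (Eucl n)} (hU : IsOpen U)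
    (hK : IsCompact K) (hKU : K ⊆ U) {m : Eucl n → R} (hm : ContDiffOn ℝ ∞ m U) (j : ℕ) :
    ∃ C : ℝ, 0 ≤ C ∧ ∀ a : Eucl n → 𝕜, ContDiffOn ℝ ∞ a U → ∀ y ∈ K,
      ‖iteratedFDeriv ℝ j (fun z ↦ m z • a z) y‖ ≤
        C * ∑ i ∈ Finset.range (j + 1), ‖iteratedFDeriv ℝ i a y‖ := by
  have hb (i : ℕ) : ∃ C : ℝ, 0 ≤ C ∧ ∀ y ∈ K, ‖iteratedFDeriv ℝ i m y‖ ≤ C := by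
    have hc : ContinuousOn (iteratedFDeriv ℝ i m) K := by
      refine ContinuousOn.mono (ContinuousOn.congr (hm.continuousOn_iteratedFDerivWithin
        (m := i) (by exact_mod_cast le_top) hU.uniqueDiffOn) ?_) hKU
      exact fun y hy ↦ (iteratedFDerivWithin_of_isOpen i hU hy).symm
    obtain ⟨C, hC⟩ := hK.exists_bound_of_continuousOn hc
    exact ⟨max C 0, le_max_right _ _, fun y hy ↦ (hC y hy).trans (le_max_left _ _)⟩
  choose C hC0 hC using hb
  have hS (i : ℕ) : 0 ≤ (j.choose i : ℝ) * C i := mul_nonneg (Nat.cast_nonneg _) (hC0 i)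
  refine ⟨∑ i ∈ Finset.range (j + 1), (j.choose i : ℝ) * C i, Finset.sum_nonneg fun i _ ↦ hS i,
    fun a ha y hy ↦ ?_⟩
  have h := norm_iteratedFDerivWithin_smul_le hm ha hU.uniqueDiffOn (hKU hy) (n := j)
    (by exact_mod_cast le_top)
  simp only [iteratedFDerivWithin_of_isOpen _ hU (hKU hy)] at h
  refine h.trans ?_
  rw [Finset.sum_mul]
  refine Finset.sum_le_sum fun i hi ↦ ?_
  refine mul_le_mul (mul_le_mul_of_nonneg_left (hC i y hy) (Nat.cast_nonneg _)) ?_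
    (norm_nonneg _) (hS i)
  refine Finset.single_le_sum (f := fun i ↦ ‖iteratedFDeriv ℝ i a y‖) (fun _ _ ↦ norm_nonneg _) ?_
  exact Finset.mem_range.2 (by have := Finset.mem_range.1 hi; omega)

lemma contDiffOn_divg {U : Set (Eucl n)} (hU : IsOpen U) {Y : Eucl n → Eucl n} {a : Eucl n → 𝕜}
    (hY : ContDiffOn ℝ ∞ Y U) (ha : ContDiffOn ℝ ∞ a U) : ContDiffOn ℝ ∞ (divg Y a) U := by
  refine ContDiffOn.sum fun i _ ↦ ?_
  have h1 : ContDiffOn ℝ ∞ (fun z ↦ Y z i • a z) U :=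
    ((EuclideanSpace.proj (𝕜 := ℝ) i).contDiff.comp_contDiffOn hY).smul ha
  exact (h1.fderiv_of_isOpen hU (by simp)).clm_apply contDiffOn_const

lemma iteratedFDeriv_divg_bound {U K : Set (Eucl n)} (hU : IsOpen U)
    (hK : IsCompact K) (hKU : K ⊆ U) {Y : Eucl n → Eucl n} (hY : ContDiffOn ℝ ∞ Y U) (j : ℕ) :
    ∃ C : ℝ, 0 ≤ C ∧ ∀ a : Eucl n → 𝕜, ContDiffOn ℝ ∞ a U → ∀ y ∈ K,
      ‖iteratedFDeriv ℝ j (divg Y a) y‖ ≤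
        C * ∑ i ∈ Finset.range (j + 2), ‖iteratedFDeriv ℝ i a y‖ := by
  have hYi (i : Fin n) : ContDiffOn ℝ ∞ (fun z ↦ Y z i) U :=
    (EuclideanSpace.proj (𝕜 := ℝ) i).contDiff.comp_contDiffOn hY
  choose C hC0 hC using fun i ↦ iteratedFDeriv_smul_bound (𝕜 := 𝕜) hU hK hKU (hYi i) (j + 1)
  refine ⟨∑ i, C i, Finset.sum_nonneg fun i _ ↦ hC0 i, fun a ha y hy ↦ ?_⟩
  have hUy : U ∈ 𝓝 y := hU.mem_nhds (hKU hy)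
  have hs (i : Fin n) : ContDiffAt ℝ ∞ (fun z ↦ Y z i • a z) y :=
    ((hYi i).smul ha).contDiffAt hUy
  have hd (i : Fin n) : ContDiffAt ℝ ∞ (fderiv ℝ fun z ↦ Y z i • a z) y :=
    (hs i).fderiv_right (by simp)
  have h1 : iteratedFDeriv ℝ j (divg Y a) y = ∑ i, iteratedFDeriv ℝ j
      (fun x ↦ fderiv ℝ (fun z ↦ Y z i • a z) x (EuclideanSpace.single i 1)) y := by
    have h0 : divg Y a = ∑ i, fun x ↦
        fderiv ℝ (fun z ↦ Y z i • a z) x (EuclideanSpace.single i 1) := by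
      funext x; simp [divg]
    rw [h0]
    exact iteratedFDeriv_sum_apply fun i _ ↦
      (((hd i).clm_apply contDiffAt_const).of_le (by exact_mod_cast le_top))
  rw [h1, Finset.sum_mul]
  refine (norm_sum_le _ _).trans (Finset.sum_le_sum fun i _ ↦ ?_)
  refine le_trans ?_ (hC i a ha y hy)
  have h2 := (ContinuousLinearMap.apply ℝ 𝕜 (EuclideanSpace.single i (1 : ℝ) : Eucl n)).norm_iteratedFDeriv_comp_left
    (hd i) (n := j) (by exact_mod_cast le_top)
  refine h2.trans ?_
  rw [norm_iteratedFDeriv_fderiv]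
  refine mul_le_of_le_one_left (norm_nonneg _) ?_
  refine ContinuousLinearMap.opNorm_le_bound _ zero_le_one fun L ↦ ?_
  simpa using L.le_opNorm (EuclideanSpace.single i (1 : ℝ) : Eucl n)

end Calculus

section Manifold

variable {𝕜 : Type*} [RCLike 𝕜] {n : ℕ} {M : Type*} [TopologicalSpace M]
  [ChartedSpace (Eucl n) M]

variable (n M) in
/-- The charts of `M`, that is, the elements of its maximal smooth atlas. -/
abbrev Charts : Set (OpenPartialHomeomorph M (Eucl n)) := IsManifold.maximalAtlas (𝓡 n) ∞ M

/-- The derivative of a chart `φ` at `p`. The tangent space of `M` at `p` is a copy of `ℝⁿ`,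
through the preferred chart at `p`. -/
def dChart (φ : OpenPartialHomeomorph M (Eucl n)) (p : M) : Eucl n →L[ℝ] Eucl n :=
  mfderiv (𝓡 n) (𝓡 n) φ p

/-- The derivative of the inverse of a chart `φ` at `y`. -/
def dSymm (φ : OpenPartialHomeomorph M (Eucl n)) (y : Eucl n) : Eucl n →L[ℝ] Eucl n :=
  mfderiv (𝓡 n) (𝓡 n) φ.symm y

/-- The absolute value of the Jacobian determinant of a chart `φ` at `p`. -/
def jac (φ : OpenPartialHomeomorph M (Eucl n)) (p : M) : ℝ :=
  |(dChart φ p).det|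

/-- The absolute value of the Jacobian determinant of the inverse of a chart `φ` at `y`. -/
def jacSymm (φ : OpenPartialHomeomorph M (Eucl n)) (y : Eucl n) : ℝ :=
  |(dSymm φ y).det|

/-- A density on the tangent space at `p`, a copy of `ℝⁿ`, is a multiple of the standard density
of `ℝⁿ`, so a density on `M` is a function `μ` on `M`. This is its coefficient in the chart `φ`. -/
def coeff (φ : OpenPartialHomeomorph M (Eucl n)) (μ : M → 𝕜) (y : Eucl n) : 𝕜 :=
  jacSymm φ y • μ (φ.symm y)

variable {φ ψ : OpenPartialHomeomorph M (Eucl n)}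

lemma mdiff (hφ : φ ∈ Charts n M) : φ.MDifferentiable (𝓡 n) (𝓡 n) :=
  ⟨(contMDiffOn_of_mem_maximalAtlas hφ).mdifferentiableOn (by simp),
    (contMDiffOn_symm_of_mem_maximalAtlas hφ).mdifferentiableOn (by simp)⟩

lemma hasFDerivAt_transition (hφ : φ ∈ Charts n M) (hψ : ψ ∈ Charts n M) {y : Eucl n}
    (hy : y ∈ φ.target) (hp : φ.symm y ∈ ψ.source) :
    HasFDerivAt (ψ ∘ φ.symm) ((dChart ψ (φ.symm y)).comp (dSymm φ y)) y :=
  hasMFDerivAt_iff_hasFDerivAt.1 (((mdiff hψ).mdifferentiableAt hp).hasMFDerivAt.comp y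
    ((mdiff hφ).mdifferentiableAt_symm hy).hasMFDerivAt)

lemma dSymm_dChart (hφ : φ ∈ Charts n M) {y : Eucl n} (hy : y ∈ φ.target) (v : Eucl n) :
    dSymm φ y (dChart φ (φ.symm y) v) = v := by
  have h := (mdiff hφ).symm_comp_deriv (φ.map_target hy)
  rw [φ.right_inv hy] at h
  exact DFunLike.congr_fun h v

lemma dChart_dSymm (hφ : φ ∈ Charts n M) {y : Eucl n} (hy : y ∈ φ.target) (v : Eucl n) :
    dChart φ (φ.symm y) (dSymm φ y v) = v :=
  DFunLike.congr_fun ((mdiff hφ).comp_symm_deriv hy) v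

lemma abs_det_transition (hφ : φ ∈ Charts n M) (hψ : ψ ∈ Charts n M) {y : Eucl n}
    (hy : y ∈ φ.target) (hp : φ.symm y ∈ ψ.source) :
    |(fderiv ℝ (ψ ∘ φ.symm) y).det| = jac ψ (φ.symm y) * jacSymm φ y := by
  rw [(hasFDerivAt_transition hφ hψ hy hp).fderiv, jac, jacSymm, ← abs_mul]
  exact congrArg abs (LinearMap.det_comp _ _)

lemma jac_mul_jacSymm (hφ : φ ∈ Charts n M) {y : Eucl n} (hy : y ∈ φ.target) :
    jac φ (φ.symm y) * jacSymm φ y = 1 := by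
  rw [← abs_det_transition hφ hφ hy (φ.map_target hy)]
  have h : (φ ∘ φ.symm) =ᶠ[𝓝 y] id := by
    filter_upwards [φ.open_target.mem_nhds hy] with z hz using φ.right_inv hz
  rw [h.fderiv_eq, fderiv_id]
  simp [ContinuousLinearMap.det]

lemma contDiffAt_transition (hφ : φ ∈ Charts n M) (hψ : ψ ∈ Charts n M) {y : Eucl n}
    (hy : y ∈ φ.target) (hp : φ.symm y ∈ ψ.source) : ContDiffAt ℝ ∞ (ψ ∘ φ.symm) y := by
  rw [← contMDiffAt_iff_contDiffAt]
  exact (contMDiffAt_of_mem_maximalAtlas hψ hp).comp y (contMDiffAt_symm_of_mem_maximalAtlas hφ hy)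

lemma det_transition_ne_zero (hφ : φ ∈ Charts n M) (hψ : ψ ∈ Charts n M) {y : Eucl n}
    (hy : y ∈ φ.target) (hp : φ.symm y ∈ ψ.source) : (fderiv ℝ (ψ ∘ φ.symm) y).det ≠ 0 := by
  rw [← abs_ne_zero, abs_det_transition hφ hψ hy hp]
  have h1 := jac_mul_jacSymm hφ hy
  have h2 := jac_mul_jacSymm hψ (ψ.map_source hp)
  rw [ψ.left_inv hp] at h2
  exact mul_ne_zero (left_ne_zero_of_mul_eq_one h2) (right_ne_zero_of_mul_eq_one h1)

/-- The transformation law of the coefficients of a density. -/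
lemma coeff_transition (hφ : φ ∈ Charts n M) (hψ : ψ ∈ Charts n M) {y : Eucl n}
    (hy : y ∈ φ.target) (hp : φ.symm y ∈ ψ.source) (μ : M → 𝕜) :
    coeff φ μ y = |(fderiv ℝ (ψ ∘ φ.symm) y).det| • coeff ψ μ ((ψ ∘ φ.symm) y) := by
  have h2 := jac_mul_jacSymm hψ (ψ.map_source hp)
  rw [ψ.left_inv hp] at h2
  rw [abs_det_transition hφ hψ hy hp, coeff, coeff, Function.comp, ψ.left_inv hp, smul_smul,
    mul_right_comm, h2, one_mul]

lemma eventually_transition {y : Eucl n} (hy : y ∈ φ.target) (hp : φ.symm y ∈ ψ.source) :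
    ∀ᶠ z in 𝓝 y, z ∈ φ.target ∧ φ.symm z ∈ ψ.source :=
  (Filter.Eventually.and (φ.open_target.mem_nhds hy)
    ((φ.continuousAt_symm hy).eventually (ψ.open_source.mem_nhds hp)))

variable [IsManifold (𝓡 n) ∞ M]

variable (n M) in
/-- The smooth vector fields on `M`. -/
abbrev VField : Type _ := Cₛ^∞⟮𝓡 n; Eucl n, fun p : M ↦ TangentSpace (𝓡 n) p⟯

/-- The vector field `X` in the chart `φ`, as a function on the target of `φ`. -/
def vfCoord (φ : OpenPartialHomeomorph M (Eucl n)) (X : VField n M) (y : Eucl n) : Eucl n :=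
  dChart φ (φ.symm y) (X (φ.symm y))

lemma contDiffOn_vfCoord (hφ : φ ∈ Charts n M) (X : VField n M) :
    ContDiffOn ℝ ∞ (vfCoord φ X) φ.target := by
  intro y hy
  have h3 : ∀ z ∈ φ.target, ∃ A : Eucl n ≃L[ℝ] Eucl n,
      (A : Eucl n →L[ℝ] Eucl n) = dSymm φ z ∧
      (A.symm : Eucl n →L[ℝ] Eucl n) = dChart φ (φ.symm z) := fun z hz ↦
    ⟨ContinuousLinearEquiv.equivOfInverse _ _ (fun v ↦ dChart_dSymm hφ hz v)
      (fun v ↦ dSymm_dChart hφ hz v), rfl, rfl⟩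
  have h4 : ContMDiffAt (𝓡 n) (𝓡 n).tangent ∞ (fun z ↦ (⟨z,
      VectorField.mpullback (𝓡 n) (𝓡 n) φ.symm X z⟩ : TangentBundle (𝓡 n) (Eucl n))) y := by
    refine ContMDiffAt.mpullback_vectorField_preimage (n := ∞) (X.contMDiff _)
      (contMDiffAt_symm_of_mem_maximalAtlas hφ hy) ?_ (by simp)
    obtain ⟨A, hA, -⟩ := h3 y hy
    exact ⟨A, hA⟩
  rw [contMDiffAt_vectorSpace_iff_contDiffAt] at h4
  refine (h4.congr_of_eventuallyEq ?_).contDiffWithinAt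
  filter_upwards [φ.open_target.mem_nhds hy] with z hz
  obtain ⟨A, hA, hA'⟩ := h3 z hz
  have h5 : (dSymm φ z).inverse = dChart φ (φ.symm z) := by
    rw [← hA, ContinuousLinearMap.inverse_equiv, hA']
  exact (DFunLike.congr_fun h5 (X (φ.symm z))).symm

lemma vfCoord_transition (hφ : φ ∈ Charts n M) (hψ : ψ ∈ Charts n M) {y : Eucl n}
    (hy : y ∈ φ.target) (hp : φ.symm y ∈ ψ.source) (X : VField n M) :
    vfCoord ψ X ((ψ ∘ φ.symm) y) = fderiv ℝ (ψ ∘ φ.symm) y (vfCoord φ X y) := by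
  rw [(hasFDerivAt_transition hφ hψ hy hp).fderiv, vfCoord, vfCoord, Function.comp,
    ψ.left_inv hp]
  exact congrArg (dChart ψ (φ.symm y)) (dSymm_dChart hφ hy (X (φ.symm y))).symm

variable (𝕜 n M) in
/-- The smooth densities on `M`, those whose coefficients in all charts are smooth. -/
def smoothDensity : Submodule 𝕜 (M → 𝕜) where
  carrier := {μ | ∀ φ ∈ Charts n M, ContDiffOn ℝ ∞ (coeff φ μ) φ.target}
  add_mem' {μ ν} hμ hν φ hφ := by
    have h : coeff φ (μ + ν) = coeff φ μ + coeff φ ν := by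
      funext y; simp [coeff, smul_add]
    rw [h]; exact (hμ φ hφ).add (hν φ hφ)
  zero_mem' φ hφ := by
    have h : coeff φ (0 : M → 𝕜) = fun _ ↦ 0 := by
      funext y; simp [coeff]
    rw [h]; exact contDiffOn_const
  smul_mem' c μ hμ φ hφ := by
    have h : coeff φ (c • μ) = fun y ↦ c • coeff φ μ y := by
      funext y; simp [coeff]
    rw [h]; exact (hμ φ hφ).const_smul c

variable (𝕜 n M) in
/-- The space `C^∞(M; Ω)` of smooth densities on `M`. -/
def Density : Type _ := ↥(smoothDensity 𝕜 n M)

instance : AddCommGroup (Density 𝕜 n M) := inferInstanceAs (AddCommGroup ↥(smoothDensity 𝕜 n M))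
instance : Module 𝕜 (Density 𝕜 n M) := inferInstanceAs (Module 𝕜 ↥(smoothDensity 𝕜 n M))

lemma Density.contDiffAt (μ : Density 𝕜 n M) (hφ : φ ∈ Charts n M) {y : Eucl n}
    (hy : y ∈ φ.target) : ContDiffAt ℝ ∞ (coeff φ μ.1) y :=
  (μ.2 φ hφ).contDiffAt (φ.open_target.mem_nhds hy)

lemma coeff_add (φ : OpenPartialHomeomorph M (Eucl n)) (μ ν : Density 𝕜 n M) :
    coeff φ (μ + ν).1 = coeff φ μ.1 + coeff φ ν.1 := by
  funext y; exact smul_add _ _ _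

lemma coeff_smul (φ : OpenPartialHomeomorph M (Eucl n)) (c : 𝕜) (μ : Density 𝕜 n M) :
    coeff φ (c • μ).1 = c • coeff φ μ.1 := by
  funext y; exact smul_comm (jacSymm φ y) c (μ.1 (φ.symm y))

variable (n M) in
/-- The indices of the semi-norms of `C^∞(M; Ω)`: a chart, a compact subset of its target and
an order of differentiation. -/
structure SeminormIndex where
  φ : OpenPartialHomeomorph M (Eucl n)
  mem : φ ∈ Charts n M
  K : Set (Eucl n)
  isCompact : IsCompact K
  subset : K ⊆ φ.target
  order : ℕ

lemma Density.bddAbove (q : SeminormIndex n M) (μ : Density 𝕜 n M) :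
    BddAbove (Set.range fun y : q.K ↦ ‖iteratedFDeriv ℝ q.order (coeff q.φ μ.1) y‖) := by
  have hc : ContinuousOn (iteratedFDeriv ℝ q.order (coeff q.φ μ.1)) q.K := by
    refine ContinuousOn.mono (ContinuousOn.congr ((μ.2 q.φ q.mem).continuousOn_iteratedFDerivWithin
      (m := q.order) (by exact_mod_cast le_top) q.φ.open_target.uniqueDiffOn) ?_) q.subset
    exact fun y hy ↦ (iteratedFDerivWithin_of_isOpen _ q.φ.open_target hy).symm
  obtain ⟨C, hC⟩ := q.isCompact.exists_bound_of_continuousOn hc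
  exact ⟨C, by rintro _ ⟨y, rfl⟩; exact hC y y.2⟩

/-- The semi-norm `μ ↦ sup_{y ∈ K} ‖D^k μ_φ (y)‖` on `C^∞(M; Ω)`. -/
def densSeminorm : SeminormFamily 𝕜 (Density 𝕜 n M) (SeminormIndex n M) := fun q ↦
  Seminorm.of (fun μ ↦ ⨆ y : q.K, ‖iteratedFDeriv ℝ q.order (coeff q.φ μ.1) y‖)
    (fun μ ν ↦ by
      refine Real.iSup_le (fun y ↦ ?_) (add_nonneg (Real.iSup_nonneg fun _ ↦ norm_nonneg _)
        (Real.iSup_nonneg fun _ ↦ norm_nonneg _))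
      rw [coeff_add, iteratedFDeriv_add_apply
        ((μ.contDiffAt q.mem (q.subset y.2)).of_le (by exact_mod_cast le_top))
        ((ν.contDiffAt q.mem (q.subset y.2)).of_le (by exact_mod_cast le_top))]
      exact (norm_add_le _ _).trans (add_le_add (le_ciSup (μ.bddAbove q) y)
        (le_ciSup (ν.bddAbove q) y)))
    (fun c μ ↦ by
      rw [Real.mul_iSup_of_nonneg (norm_nonneg _)]
      refine iSup_congr fun y ↦ ?_
      rw [coeff_smul, iteratedFDeriv_const_smul_apply
        ((μ.contDiffAt q.mem (q.subset y.2)).of_le (by exact_mod_cast le_top)), norm_smul])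

instance : TopologicalSpace (Density 𝕜 n M) :=
  (densSeminorm : SeminormFamily 𝕜 (Density 𝕜 n M) (SeminormIndex n M)).moduleFilterBasis.topology

lemma withSeminorms_density :
    WithSeminorms (densSeminorm : SeminormFamily 𝕜 (Density 𝕜 n M) (SeminormIndex n M)) := ⟨rfl⟩

instance : IsTopologicalAddGroup (Density 𝕜 n M) := withSeminorms_density.topologicalAddGroup
instance : ContinuousSMul 𝕜 (Density 𝕜 n M) := withSeminorms_density.continuousSMul

/-- A criterion of continuity for endomorphisms of `C^∞(M; Ω)` -/
lemma continuous_of_bound (A : Density 𝕜 n M →ₗ[𝕜] Density 𝕜 n M) (r : ℕ → ℕ)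
    (h : ∀ q : SeminormIndex n M, ∃ C : ℝ, 0 ≤ C ∧ ∀ μ : Density 𝕜 n M, ∀ y ∈ q.K,
      ‖iteratedFDeriv ℝ q.order (coeff q.φ (A μ).1) y‖ ≤
        C * ∑ i ∈ Finset.range (r q.order), ‖iteratedFDeriv ℝ i (coeff q.φ μ.1) y‖) :
    Continuous A := by
  refine withSeminorms_density.continuous_of_continuous_comp A fun q ↦ ?_
  obtain ⟨C, hC0, hC⟩ := h q
  let Q (i : ℕ) : SeminormIndex n M := { q with order := i }
  refine Seminorm.continuous_of_le
    (q := C.toNNReal • ∑ i ∈ Finset.range (r q.order), densSeminorm (𝕜 := 𝕜) (Q i)) ?_ ?_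
  · have h1 : Continuous (fun μ ↦ C.toNNReal *
        ∑ i ∈ Finset.range (r q.order), densSeminorm (𝕜 := 𝕜) (Q i) μ) :=
      continuous_const.mul
        (continuous_finsetSum _ fun i _ ↦ withSeminorms_density.continuous_seminorm (Q i))
    refine h1.congr fun μ ↦ ?_
    simp [NNReal.smul_def]
  · intro μ
    have h0 : (C.toNNReal • ∑ i ∈ Finset.range (r q.order), densSeminorm (𝕜 := 𝕜) (Q i)) μ =
        C * ∑ i ∈ Finset.range (r q.order), densSeminorm (𝕜 := 𝕜) (Q i) μ := by
      simp [NNReal.smul_def, Real.coe_toNNReal _ hC0]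
    rw [h0]
    refine Real.iSup_le (fun y ↦ (hC μ y y.2).trans ?_) ?_
    · refine mul_le_mul_of_nonneg_left (Finset.sum_le_sum fun i _ ↦ ?_) hC0
      exact le_ciSup (μ.bddAbove (Q i)) y
    · exact mul_nonneg hC0 (Finset.sum_nonneg fun _ _ ↦ apply_nonneg _ _)

/-! ### Multiplication by functions and Lie derivatives -/

variable (𝕜 n M) in
/-- The algebra `C^∞(M)` of smooth `𝕜`-valued functions. -/
abbrev SmoothFun : Type _ := C^∞⟮𝓡 n, M; 𝓘(ℝ, 𝕜), 𝕜⟯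

lemma contDiffOn_comp_symm (hφ : φ ∈ Charts n M) (f : SmoothFun 𝕜 n M) :
    ContDiffOn ℝ ∞ (f ∘ φ.symm) φ.target := by
  rw [← contMDiffOn_iff_contDiffOn]
  exact f.contMDiff.comp_contMDiffOn (contMDiffOn_symm_of_mem_maximalAtlas hφ)

lemma coeff_mul (φ : OpenPartialHomeomorph M (Eucl n)) (f : SmoothFun 𝕜 n M) (μ : M → 𝕜) :
    coeff φ (fun p ↦ f p * μ p) = fun y ↦ (f ∘ φ.symm) y • coeff φ μ y := by
  funext y; exact (mul_smul_comm _ _ _).symm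

/-- Multiplication of smooth densities by a smooth function. -/
def mulDensLin (f : SmoothFun 𝕜 n M) : Density 𝕜 n M →ₗ[𝕜] Density 𝕜 n M where
  toFun μ := ⟨fun p ↦ f p * μ.1 p, fun φ hφ ↦ by
    rw [coeff_mul]; exact (contDiffOn_comp_symm hφ f).smul (μ.2 φ hφ)⟩
  map_add' μ ν := Subtype.ext (funext fun p ↦ mul_add _ _ _)
  map_smul' c μ := Subtype.ext (funext fun p ↦ mul_left_comm _ _ _)

/-- Multiplication of smooth densities by a smooth function, as a continuous map. -/
def mulDens (f : SmoothFun 𝕜 n M) : Density 𝕜 n M →L[𝕜] Density 𝕜 n M where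
  toLinearMap := mulDensLin f
  cont := by
    refine continuous_of_bound (mulDensLin f) (fun j ↦ j + 1) fun q ↦ ?_
    obtain ⟨C, hC0, hC⟩ := iteratedFDeriv_smul_bound (𝕜 := 𝕜) q.φ.open_target q.isCompact q.subset
      (contDiffOn_comp_symm q.mem f) q.order
    refine ⟨C, hC0, fun μ y hy ↦ ?_⟩
    have := hC _ (μ.2 q.φ q.mem) y hy
    rw [← coeff_mul] at this
    exact this

/-- The Lie derivative of a density along a vector field: in coordinates, with
`X = ∑ i, Xⁱ ∂ᵢ` and `μ = a |dx|`, it is `∑ i, ∂ᵢ (Xⁱ a) |dx|`. Its value at every `p` is computed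
here with the preferred chart at `p`; see `coeff_lieFun` for other charts. -/
def lieFun (X : VField n M) (μ : M → 𝕜) (p : M) : 𝕜 :=
  jac (chartAt (Eucl n) p) p •
    divg (vfCoord (chartAt (Eucl n) p) X) (coeff (chartAt (Eucl n) p) μ) (chartAt (Eucl n) p p)

lemma coeff_lieFun (hφ : φ ∈ Charts n M) (X : VField n M) (μ : Density 𝕜 n M) {y : Eucl n}
    (hy : y ∈ φ.target) :
    coeff φ (lieFun X μ.1) y = divg (vfCoord φ X) (coeff φ μ.1) y := by
  set p := φ.symm y with hpdef
  have hψ : chartAt (Eucl n) p ∈ Charts n M := IsManifold.chart_mem_maximalAtlas p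
  set ψ := chartAt (Eucl n) p with hψdef
  have hp : φ.symm y ∈ ψ.source := mem_chart_source (Eucl n) p
  have hτy : (ψ ∘ φ.symm) y ∈ ψ.target := ψ.map_source hp
  have h := divg_comp (contDiffAt_transition hφ hψ hy hp) (det_transition_ne_zero hφ hψ hy hp)
    (((contDiffOn_vfCoord hφ X).contDiffAt (φ.open_target.mem_nhds hy)).differentiableAt (by simp))
    (((contDiffOn_vfCoord hψ X).contDiffAt (ψ.open_target.mem_nhds hτy)).differentiableAt
      (by simp))
    ((μ.contDiffAt hψ hτy).differentiableAt (by simp))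
    ((eventually_transition hy hp).mono fun z hz ↦ coeff_transition hφ hψ hz.1 hz.2 μ.1)
    ((eventually_transition hy hp).mono fun z hz ↦ vfCoord_transition hφ hψ hz.1 hz.2 X)
  rw [h, abs_det_transition hφ hψ hy hp, mul_comm, mul_smul]
  rfl

/-- The Lie derivative of smooth densities along a smooth vector field. -/
def lieDensLin (X : VField n M) : Density 𝕜 n M →ₗ[𝕜] Density 𝕜 n M where
  toFun μ := ⟨lieFun X μ.1, fun φ hφ ↦
    (contDiffOn_divg φ.open_target (contDiffOn_vfCoord hφ X) (μ.2 φ hφ)).congr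
      fun _ hy ↦ coeff_lieFun hφ X μ hy⟩
  map_add' μ ν := Subtype.ext (funext fun p ↦ by
    have hψ : chartAt (Eucl n) p ∈ Charts n M := IsManifold.chart_mem_maximalAtlas p
    have hy := mem_chart_target (Eucl n) p
    have hX := ((contDiffOn_vfCoord hψ X).contDiffAt
      ((chartAt (Eucl n) p).open_target.mem_nhds hy)).differentiableAt (by simp)
    have hμ := (μ.contDiffAt hψ hy).differentiableAt (by simp)
    have hν := (ν.contDiffAt hψ hy).differentiableAt (by simp)
    change lieFun X (μ + ν).1 p = lieFun X μ.1 p + lieFun X ν.1 p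
    simp only [lieFun, ← smul_add]
    rw [coeff_add, divg_eq hX hμ, divg_eq hX hν, divg_eq hX (hμ.add hν), fderiv_add hμ hν]
    simp only [Pi.add_apply, add_apply, smul_add]
    exact add_add_add_comm _ _ _ _)
  map_smul' c μ := Subtype.ext (funext fun p ↦ by
    have hψ : chartAt (Eucl n) p ∈ Charts n M := IsManifold.chart_mem_maximalAtlas p
    have hy := mem_chart_target (Eucl n) p
    have hX := ((contDiffOn_vfCoord hψ X).contDiffAt
      ((chartAt (Eucl n) p).open_target.mem_nhds hy)).differentiableAt (by simp)
    have hμ := (μ.contDiffAt hψ hy).differentiableAt (by simp)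
    change lieFun X (c • μ).1 p = c • lieFun X μ.1 p
    simp only [lieFun]
    rw [coeff_smul, divg_eq hX hμ, divg_eq hX (hμ.const_smul c), fderiv_const_smul hμ]
    simp only [Pi.smul_apply, smul_apply, smul_comm _ c, ← smul_add])

/-- The Lie derivative of smooth densities, as a continuous map. -/
def lieDens (X : VField n M) : Density 𝕜 n M →L[𝕜] Density 𝕜 n M where
  toLinearMap := lieDensLin X
  cont := by
    refine continuous_of_bound (lieDensLin X) (fun j ↦ j + 2) fun q ↦ ?_
    obtain ⟨C, hC0, hC⟩ := iteratedFDeriv_divg_bound (𝕜 := 𝕜) q.φ.open_target q.isCompact q.subset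
      (contDiffOn_vfCoord q.mem X) q.order
    refine ⟨C, hC0, fun μ y hy ↦ ?_⟩
    have h : coeff q.φ (lieFun X μ.1) =ᶠ[𝓝 y] divg (vfCoord q.φ X) (coeff q.φ μ.1) := by
      filter_upwards [q.φ.open_target.mem_nhds (q.subset hy)] with z hz
      exact coeff_lieFun q.mem X μ hz
    change ‖iteratedFDeriv ℝ q.order (coeff q.φ (lieFun X μ.1)) y‖ ≤ _
    rw [(h.iteratedFDeriv ℝ q.order).self_of_nhds]
    exact hC _ (μ.2 q.φ q.mem) y hy

lemma smooth_jac_mul (hφ : φ ∈ Charts n M) {ρ : M → ℝ} (hρ : ContMDiff (𝓡 n) 𝓘(ℝ) ∞ ρ)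
    (hs : tsupport ρ ⊆ φ.source) {g : Eucl n → ℝ} (hg : ContDiff ℝ ∞ g) :
    (fun p ↦ ((jac φ p * (ρ p * g (φ p)) : ℝ) : 𝕜)) ∈ smoothDensity 𝕜 n M := by
  intro ψ hψ y hy
  refine ContDiffAt.contDiffWithinAt ?_
  by_cases hp : ψ.symm y ∈ φ.source
  · have h1 : ContDiffAt ℝ ∞ (fun z ↦ ((|(fderiv ℝ (φ ∘ ψ.symm) z).det| *
        ((ρ ∘ ψ.symm) z * g ((φ ∘ ψ.symm) z)) : ℝ) : 𝕜)) y := by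
      have hτ := contDiffAt_transition hψ hφ hy hp
      have h2 : ContDiffAt ℝ ∞ (fun z ↦ |(fderiv ℝ (φ ∘ ψ.symm) z).det|) y :=
        (contDiff_det.contDiffAt.comp y (hτ.fderiv_right (m := ∞) (by simp))).abs
          (det_transition_ne_zero hψ hφ hy hp)
      have h3 : ContDiffAt ℝ ∞ (ρ ∘ ψ.symm) y := by
        rw [← contMDiffAt_iff_contDiffAt]
        exact (hρ (ψ.symm y)).comp y (contMDiffAt_symm_of_mem_maximalAtlas hψ hy)
      exact (RCLike.ofRealCLM (K := 𝕜)).contDiff.contDiffAt.comp y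
        (h2.mul (h3.mul (hg.contDiffAt.comp y hτ)))
    refine h1.congr_of_eventuallyEq ?_
    filter_upwards [eventually_transition hy hp] with z hz
    rw [abs_det_transition hψ hφ hz.1 hz.2, coeff, RCLike.real_smul_eq_coe_mul,
      ← RCLike.ofReal_mul]
    congr 1
    simp only [Function.comp]
    ring
  · have h1 : ∀ᶠ z in 𝓝 y, ψ.symm z ∉ tsupport ρ :=
      (ψ.continuousAt_symm hy).eventually
        ((isClosed_tsupport ρ).isOpen_compl.mem_nhds fun h ↦ hp (hs h))
    refine (contDiffAt_const (c := (0 : 𝕜))).congr_of_eventuallyEq ?_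
    filter_upwards [h1] with z hz
    simp [coeff, image_eq_zero_of_notMem_tsupport hz]

/-! ### Distributions and differential operators -/

variable (𝕜 n M) in
/-- The space `C^{-∞}(M) = C^∞(M; Ω)'` of distributions on a compact manifold `M`, with the strong
topology. -/
abbrev Distr : Type _ := Density 𝕜 n M →L[𝕜] 𝕜

/-- Multiplication of distributions by a smooth function, `⟨f u, μ⟩ = ⟨u, f μ⟩`. -/
def mulDistr (f : SmoothFun 𝕜 n M) : Module.End 𝕜 (Distr 𝕜 n M) where
  toFun u := u.comp (mulDens f)
  map_add' _ _ := rfl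
  map_smul' _ _ := rfl

/-- Action of vector fields on distributions, `⟨X u, μ⟩ = - ⟨u, 𝓛_X μ⟩`. -/
def vfDistr (X : VField n M) : Module.End 𝕜 (Distr 𝕜 n M) where
  toFun u := -u.comp (lieDens X)
  map_add' u v := by ext μ; simp; abel
  map_smul' c u := by ext μ; simp

/-- The chart `φ` is adapted to the subset `L`, of codimension `n'`: the points of `L` are those
where the first `n'` coordinates `x'` vanish. -/
def IsAdapted (n' : ℕ) (L : Set M) (φ : OpenPartialHomeomorph M (Eucl n)) : Prop :=
  φ ∈ Charts n M ∧ ∀ p ∈ φ.source, p ∈ L ↔ ∀ i : Fin n, (i : ℕ) < n' → φ p i = 0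

variable (n) in
/-- `L` is a regular submanifold of codimension `n'` of the `n`-dimensional manifold `M`. -/
def IsRegularSubmanifold (n' : ℕ) (L : Set M) : Prop :=
  n' ≤ n ∧ ∀ p ∈ L, ∃ φ : OpenPartialHomeomorph M (Eucl n), IsAdapted n' L φ ∧ p ∈ φ.source

/-- The vector field `X` is tangent to `L`. -/
def IsTangentTo (n' : ℕ) (L : Set M) (X : VField n M) : Prop :=
  ∀ φ : OpenPartialHomeomorph M (Eucl n), IsAdapted n' L φ → ∀ p ∈ φ.source, p ∈ L →
    ∀ i : Fin n, (i : ℕ) < n' → dChart φ p (X p) i = 0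

variable (𝕜) in
/-- The algebra `Diff(M, L)`, acting on `C^{-∞}(M)`: the `C^∞(M)`-module spanned by all
compositions of vector fields tangent to `L`. -/
def Diff (n' : ℕ) (L : Set M) : Submodule 𝕜 (Module.End 𝕜 (Distr 𝕜 n M)) :=
  Submodule.span 𝕜 {P | ∃ (f : SmoothFun 𝕜 n M) (l : List (VField n M)),
    (∀ X ∈ l, IsTangentTo n' L X) ∧ P = mulDistr f * (l.map vfDistr).prod}

/-! ### Sobolev spaces -/

variable (n) in
/-- The distributions in the Sobolev space `H^s(ℝⁿ)`. -/
def euclSobolevSubmodule (s : ℝ) : Submodule ℂ 𝓢'(Eucl n, ℂ) where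
  carrier := {T | TemperedDistribution.MemSobolev s 2 T}
  add_mem' := TemperedDistribution.MemSobolev.add
  zero_mem' := TemperedDistribution.memSobolev_fun_zero _ _ s 2
  smul_mem' c _ := TemperedDistribution.MemSobolev.smul c

variable (n) in
/-- The Sobolev space `H^s(ℝⁿ)`. -/
def EuclSobolev (s : ℝ) : Type := ↥(euclSobolevSubmodule n s)

/-- The map `(1 + |D|²)^{s/2} : H^s(ℝⁿ) → L²(ℝⁿ)`, the isometry that defines the norm of
`H^s(ℝⁿ)`. -/
def EuclSobolev.toL2 {s : ℝ} (T : EuclSobolev n s) :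
    MeasureTheory.Lp ℂ 2 (MeasureTheory.volume : MeasureTheory.Measure (Eucl n)) :=
  T.2.choose

instance (s : ℝ) : TopologicalSpace (EuclSobolev n s) :=
  TopologicalSpace.induced EuclSobolev.toL2 inferInstance

variable (n M) in
/-- An atlas of `M` with a subordinate smooth partition of unity. -/
structure PartitionedAtlas (ι : Type*) where
  chart : ι → OpenPartialHomeomorph M (Eucl n)
  chart_mem : ∀ i, chart i ∈ Charts n M
  ρ : SmoothPartitionOfUnity ι (𝓡 n) M
  subordinate : ∀ i, tsupport (ρ i) ⊆ (chart i).source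

variable {ι : Type*}

variable (𝕜) in
/-- For a smooth function `g` on `ℝⁿ`, the density `ρᵢ · xᵢ^* (g |dx|)` on `M`, where `xᵢ` is the
`i`-th chart and `ρᵢ` the `i`-th function of the partition of unity. -/
def PartitionedAtlas.testDensity (𝒜 : PartitionedAtlas n M ι) (i : ι) (g : Eucl n → ℝ)
    (hg : ContDiff ℝ ∞ g) : Density 𝕜 n M :=
  ⟨fun p ↦ ((jac (𝒜.chart i) p * (𝒜.ρ i p * g (𝒜.chart i p)) : ℝ) : 𝕜),
    smooth_jac_mul (𝒜.chart_mem i) (𝒜.ρ i).contMDiff (𝒜.subordinate i) hg⟩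

/-- The tempered distribution `T` on `ℝⁿ` is (the complexification, if `𝕜 = ℝ`, of) the push-forward
of `ρᵢ u` by the `i`-th chart, extended by zero: `⟨T, g⟩ = ⟨u, ρᵢ · xᵢ^* (g |dx|)⟩` for all Schwartz
functions `g`. -/
def PartitionedAtlas.IsLocalPart (𝒜 : PartitionedAtlas n M ι) (i : ι) (u : Distr 𝕜 n M)
    (T : 𝓢'(Eucl n, ℂ)) : Prop :=
  ∀ g : 𝓢(Eucl n, ℂ), T g =
    RCLike.map 𝕜 ℂ (u (𝒜.testDensity 𝕜 i (fun x ↦ (g x).re)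
      (Complex.reCLM.contDiff.comp (g.smooth (⊤ : ℕ∞))))) +
    Complex.I * RCLike.map 𝕜 ℂ (u (𝒜.testDensity 𝕜 i (fun x ↦ (g x).im)
      (Complex.imCLM.contDiff.comp (g.smooth (⊤ : ℕ∞)))))

lemma map_mul_complex (c z : 𝕜) : RCLike.map 𝕜 ℂ (c * z) = RCLike.map 𝕜 ℂ c * RCLike.map 𝕜 ℂ z := by
  apply Complex.ext <;> simp [RCLike.map]

variable (𝕜) in
/-- The distributions in the Sobolev space `H^s(M)`. -/
def sobolevSubmodule (𝒜 : PartitionedAtlas n M ι) (s : ℝ) : Submodule 𝕜 (Distr 𝕜 n M) where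
  carrier := {u | ∀ i, ∃ T : EuclSobolev n s, 𝒜.IsLocalPart i u T.1}
  add_mem' {u v} hu hv i := by
    obtain ⟨T, hT⟩ := hu i
    obtain ⟨S, hS⟩ := hv i
    refine ⟨⟨T.1 + S.1, Submodule.add_mem _ T.2 S.2⟩, fun g ↦ ?_⟩
    change T.1 g + S.1 g = _
    rw [hT g, hS g]
    simp only [add_apply, map_add]
    ring
  zero_mem' i := ⟨⟨0, Submodule.zero_mem _⟩, fun g ↦ by
    change (0 : ℂ) = _
    simp⟩
  smul_mem' c u hu i := by
    obtain ⟨T, hT⟩ := hu i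
    refine ⟨⟨RCLike.map 𝕜 ℂ c • T.1, Submodule.smul_mem _ _ T.2⟩, fun g ↦ ?_⟩
    change RCLike.map 𝕜 ℂ c * T.1 g = _
    rw [hT g]
    simp only [smul_apply, smul_eq_mul, map_mul_complex]
    ring

variable (𝕜) in
/-- The Sobolev space `H^s(M)` of the compact manifold `M`. -/
def Sobolev (𝒜 : PartitionedAtlas n M ι) (s : ℝ) : Type _ := ↥(sobolevSubmodule 𝕜 𝒜 s)

/-- The map `H^s(M) → H^s(ℝⁿ)` assigning to `u` its `i`-th local part. -/
def Sobolev.localPart {𝒜 : PartitionedAtlas n M ι} {s : ℝ} (i : ι) (u : Sobolev 𝕜 𝒜 s) :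
    EuclSobolev n s :=
  (u.2 i).choose

instance (𝒜 : PartitionedAtlas n M ι) (s : ℝ) : TopologicalSpace (Sobolev 𝕜 𝒜 s) :=
  ⨅ i, TopologicalSpace.induced (Sobolev.localPart i) inferInstance

lemma sobolevSubmodule_mono (𝒜 : PartitionedAtlas n M ι) {s s' : ℝ} (h : s' ≤ s) :
    sobolevSubmodule 𝕜 𝒜 s ≤ sobolevSubmodule 𝕜 𝒜 s' := fun _ hu i ↦ by
  obtain ⟨T, hT⟩ := hu i
  exact ⟨⟨T.1, TemperedDistribution.MemSobolev.mono h T.2⟩, hT⟩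

/-! ### Conormal distributions -/

variable (𝕜) in
/-- The conormal distributions of Sobolev order at most `s`. -/
def conormalOrderSubmodule (𝒜 : PartitionedAtlas n M ι) (n' : ℕ) (L : Set M) (s : ℝ) :
    Submodule 𝕜 (Distr 𝕜 n M) where
  carrier := {u | ∀ P ∈ Diff 𝕜 n' L, P u ∈ sobolevSubmodule 𝕜 𝒜 s}
  add_mem' hu hv P hP := by rw [map_add]; exact Submodule.add_mem _ (hu P hP) (hv P hP)
  zero_mem' P _ := by rw [map_zero]; exact Submodule.zero_mem _
  smul_mem' c u hu P hP := by rw [map_smul]; exact Submodule.smul_mem _ c (hu P hP)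

variable (𝕜) in
/-- The space `I^{(s)}(M, L)` of conormal distributions of Sobolev order at most `s`. -/
def ConormalOrder (𝒜 : PartitionedAtlas n M ι) (n' : ℕ) (L : Set M) (s : ℝ) : Type _ :=
  ↥(conormalOrderSubmodule 𝕜 𝒜 n' L s)

variable {𝒜 : PartitionedAtlas n M ι} {n' : ℕ} {L : Set M}

instance {s : ℝ} : AddCommGroup (ConormalOrder 𝕜 𝒜 n' L s) :=
  inferInstanceAs (AddCommGroup ↥(conormalOrderSubmodule 𝕜 𝒜 n' L s))
instance {s : ℝ} : Module 𝕜 (ConormalOrder 𝕜 𝒜 n' L s) :=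
  inferInstanceAs (Module 𝕜 ↥(conormalOrderSubmodule 𝕜 𝒜 n' L s))

/-- The map `P : I^{(s)}(M, L) → H^s(M)`, for `P ∈ Diff(M, L)`. -/
def ConormalOrder.applyDiff {s : ℝ} (P : ↥(Diff (n := n) 𝕜 n' L)) (u : ConormalOrder 𝕜 𝒜 n' L s) :
    Sobolev 𝕜 𝒜 s :=
  ⟨P.1 u.1, u.2 P.1 P.2⟩

/-- The projective topology of `I^{(s)}(M, L)`. -/
instance {s : ℝ} : TopologicalSpace (ConormalOrder 𝕜 𝒜 n' L s) :=
  ⨅ P, TopologicalSpace.induced (ConormalOrder.applyDiff P) inferInstance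

lemma conormalOrderSubmodule_mono {s s' : ℝ} (h : s' ≤ s) :
    conormalOrderSubmodule 𝕜 𝒜 n' L s ≤ conormalOrderSubmodule 𝕜 𝒜 n' L s' :=
  fun _ hu P hP ↦ sobolevSubmodule_mono 𝒜 h (hu P hP)

variable (𝕜 𝒜 n' L) in
/-- The conormal distributions of `M` at `L`: the union over `s` of the spaces `I^{(s)}(M, L)`. -/
def conormalSubmodule : Submodule 𝕜 (Distr 𝕜 n M) where
  carrier := {u | ∃ s : ℝ, u ∈ conormalOrderSubmodule 𝕜 𝒜 n' L s}
  add_mem' := by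
    rintro u v ⟨s, hu⟩ ⟨t, hv⟩
    exact ⟨min s t, Submodule.add_mem _ (conormalOrderSubmodule_mono (min_le_left s t) hu)
      (conormalOrderSubmodule_mono (min_le_right s t) hv)⟩
  zero_mem' := ⟨0, Submodule.zero_mem _⟩
  smul_mem' := by
    rintro c u ⟨s, hu⟩
    exact ⟨s, Submodule.smul_mem _ c hu⟩

variable (𝕜 𝒜 n' L) in
/-- The space `I(M, L)` of conormal distributions of `M` at `L`. -/
def Conormal : Type _ := ↥(conormalSubmodule 𝕜 𝒜 n' L)

instance : AddCommGroup (Conormal 𝕜 𝒜 n' L) :=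
  inferInstanceAs (AddCommGroup ↥(conormalSubmodule 𝕜 𝒜 n' L))
instance : Module 𝕜 (Conormal 𝕜 𝒜 n' L) :=
  inferInstanceAs (Module 𝕜 ↥(conormalSubmodule 𝕜 𝒜 n' L))

/-- The inclusion of `I^{(s)}(M, L)` in `I(M, L)`. -/
def ConormalOrder.incl {s : ℝ} (u : ConormalOrder 𝕜 𝒜 n' L s) : Conormal 𝕜 𝒜 n' L :=
  ⟨u.1, s, u.2⟩

/-- The locally convex inductive limit topology of `I(M, L)`: the finest locally convex vector
topology such that all inclusions `I^{(s)}(M, L) → I(M, L)` are continuous. -/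
instance : TopologicalSpace (Conormal 𝕜 𝒜 n' L) :=
  sInf {t | (∀ s : ℝ, TopologicalSpace.coinduced
      (ConormalOrder.incl : ConormalOrder 𝕜 𝒜 n' L s → Conormal 𝕜 𝒜 n' L) inferInstance ≤ t) ∧
    @IsTopologicalAddGroup _ t _ ∧ @ContinuousSMul 𝕜 _ _ _ t ∧ PolynormableSpace 𝕜 _ (topology := t)}

instance : IsTopologicalAddGroup (Conormal 𝕜 𝒜 n' L) :=
  topologicalAddGroup_sInf fun _ h ↦ h.2.1
instance : ContinuousSMul 𝕜 (Conormal 𝕜 𝒜 n' L) :=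
  continuousSMul_sInf fun _ h ↦ h.2.2.1
instance : PolynormableSpace 𝕜 (Conormal 𝕜 𝒜 n' L) :=
  .sInf fun _ h ↦ h.2.2.2

lemma ConormalOrder.continuous_incl {s : ℝ} :
    Continuous (ConormalOrder.incl : ConormalOrder 𝕜 𝒜 n' L s → Conormal 𝕜 𝒜 n' L) :=
  continuous_iff_coinduced_le.2 (le_sInf fun _ h ↦ h.1 s)

end Manifold

/-! ### Classes of locally convex spaces -/

section TVS

variable (𝕜 : Type*) [RCLike 𝕜] {E : Type*} [AddCommGroup E] [Module 𝕜 E]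

/-- Disks: non-empty absolutely convex sets. -/
def IsDisk (B : Set E) : Prop :=
  B.Nonempty ∧ ∀ x ∈ B, ∀ y ∈ B, ∀ a b : 𝕜, ‖a‖ + ‖b‖ ≤ 1 → a • x + b • y ∈ B

variable [TopologicalSpace E]

/-- Banach disks: bounded disks `B` whose linear span is complete with the gauge of `B`. -/
def IsBanachDisk (B : Set E) : Prop :=
  IsDisk 𝕜 B ∧ Bornology.IsVonNBounded 𝕜 B ∧
    ∀ x : ℕ → E, (∀ k, x k ∈ Submodule.span 𝕜 B) →
      (∀ ε : ℝ, 0 < ε → ∃ N, ∀ k ≥ N, ∀ l ≥ N, ∃ b ∈ B, x k - x l = (ε : 𝕜) • b) →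
      ∃ y ∈ Submodule.span 𝕜 B, ∀ ε : ℝ, 0 < ε → ∃ N, ∀ k ≥ N, ∃ b ∈ B, x k - y = (ε : 𝕜) • b

variable (E)

/-- A locally convex space is ultrabornological when every disk absorbing all Banach disks is a
neighborhood of zero. -/
def IsUltrabornological : Prop :=
  ∀ D : Set E, IsDisk 𝕜 D → (∀ B : Set E, IsBanachDisk 𝕜 B → Absorbs 𝕜 D B) → D ∈ 𝓝 (0 : E)

/-- A locally convex space is webbed when it has a completing web of disks `W [k₀, …, kₘ]`. -/
def IsWebbed : Prop :=
  ∃ W : List ℕ → Set E, (∀ l, IsDisk 𝕜 (W l)) ∧ W [] = Set.univ ∧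
    (∀ l, W l = ⋃ k, W (l ++ [k])) ∧
    ∀ σ : ℕ → ℕ, ∃ r : ℕ → ℝ, (∀ m, 0 < r m) ∧ ∀ (x : ℕ → E) (c : ℕ → 𝕜),
      (∀ m, x m ∈ W ((List.range (m + 1)).map σ)) → (∀ m, ‖c m‖ ≤ r m) →
      ∃ y, Filter.Tendsto (fun N ↦ ∑ m ∈ Finset.range N, c m • x m) Filter.atTop (𝓝 y)

/-- Fréchet spaces: complete metrizable locally convex spaces. -/
structure IsFrechetSpace : Prop extends IsTopologicalAddGroup E, ContinuousSMul 𝕜 E,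
    PolynormableSpace 𝕜 E, TopologicalSpace.MetrizableSpace E where
  complete : @CompleteSpace E (IsTopologicalAddGroup.rightUniformSpace E)

end TVS

end
end ConormalDist

namespace ConormalDist

noncomputable section

set_option linter.unusedSectionVars false

/-! ### Fréchet spaces, Banach disks and countable inductive limits. -/

section FunctionalAnalysis

open Filter Set
open scoped Pointwise

variable {𝕜 : Type*} [RCLike 𝕜] {E : Type*} [AddCommGroup E] [Module 𝕜 E]

/-! Everything rests on one fact (`exists_isCompleteFamily`): the topology of each I^(s)(M, L),
although defined by all operators of Diff(M, L), is given by a sequence of separating semi-norms for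
which Cauchy sequences converge.

Countability. In a chart where L is {x' = 0}, Hadamard's lemma (`exists_eq_sum_mul_coord`) shows
that tangent fields are combinations of ∂ⱼ for the remaining coordinates and of xᵢ ∂ⱼ for the
coordinates in x'. A partition of unity and compactness then give a finite family Y generating all
tangent fields over C^∞(M) (`exists_finite_generators`). By the relation X f = f X + X(f), every
operator of Diff(M, L) is a sum of terms f w with w a word in Y (`diff_le_wordSpan`). Multiplication
by f is continuous on H^s(M) (`exists_mul_bound`): in the frequency variable it is a convolution,
controlled by the inequalities of Peetre and Young. So the countably many words define the topology.

Completeness. H^s(M) inherits completeness from L², because a distribution is recovered from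
finitely many local parts (`exists_sobolevSeminorm_tendsto`). If (uₖ) is Cauchy in I^(s), then w uₖ
converges in H^s for every word w, and its limit is w applied to the limit of (uₖ), since w is a
transpose and hence weakly continuous.

The limit. Each I^(s) is barrelled by Baire's theorem, and ultrabornological because null sequences
lie in Banach disks. A semi-norm on I(M, L) that is continuous on every I^(s) is continuous
(`continuous_seminorm_conormal`), which carries both properties to I(M, L). Pairing with a density
gives such a semi-norm, whence the Hausdorff property. In the web, the first index selects one of
the spaces I^(-k) and the later ones bound its semi-norms one after another. -/

/-- A separating family of semi-norms that defines the topology of a space and for which all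
Cauchy sequences converge. -/
structure IsCompleteFamily {κ : Type*} [TopologicalSpace E] (p : SeminormFamily 𝕜 E κ) : Prop where
  withSeminorms : WithSeminorms p
  separating : ∀ x, (∀ i, p i x = 0) → x = 0
  complete : ∀ u : ℕ → E, (∀ i, ∀ ε > 0, ∃ N, ∀ k ≥ N, ∀ l ≥ N, p i (u k - u l) < ε) →
    ∃ x, Tendsto u atTop (𝓝 x)

variable {κ : Type*}

/-- Countably many semi-norms make the uniformity countably generated, so completeness may be tested
on sequences. -/
lemma IsCompleteFamily.completeSpace [TopologicalSpace E] [Countable κ] [h1 : IsTopologicalAddGroup E]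
    {p : SeminormFamily 𝕜 E κ} (hp : IsCompleteFamily p) :
    @CompleteSpace E (IsTopologicalAddGroup.rightUniformSpace E) := by
  have := hp.withSeminorms.firstCountableTopology
  let := IsTopologicalAddGroup.rightUniformSpace E
  have : IsUniformAddGroup E := isUniformAddGroup_of_addCommGroup
  have : (uniformity E).IsCountablyGenerated := IsUniformAddGroup.uniformity_countably_generated
  refine UniformSpace.complete_of_cauchySeq_tendsto fun u hu ↦ hp.complete u fun i ε hε ↦ ?_
  have h2 : {q : E × E | p i (q.1 - q.2) < ε} ∈ uniformity E := by
    rw [uniformity_eq_comap_nhds_zero_swapped]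
    refine ⟨{x | p i x < ε}, ?_, fun q hq ↦ hq⟩
    have h3 := (hp.withSeminorms.continuous_seminorm i).continuousAt (x := 0)
    exact h3.eventually (gt_mem_nhds (by simpa using hε))
  rw [cauchySeq_iff] at hu
  obtain ⟨N, hN⟩ := hu _ h2
  exact ⟨N, fun k hk l hl ↦ hN k hk l hl⟩

lemma IsCompleteFamily.t2Space [TopologicalSpace E] {p : SeminormFamily 𝕜 E κ}
    (hp : IsCompleteFamily p) : T2Space E := by
  have := hp.withSeminorms.topologicalAddGroup
  have : T1Space E := hp.withSeminorms.T1_of_separating fun x hx ↦ by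
    by_contra! h
    exact hx (hp.separating x h)
  infer_instance

/-- A space with a countable complete family of semi-norms is a Fréchet space. -/
theorem IsCompleteFamily.isFrechetSpace [TopologicalSpace E] [Countable κ]
    {p : SeminormFamily 𝕜 E κ} (hp : IsCompleteFamily p) : IsFrechetSpace 𝕜 E := by
  have h1 := hp.withSeminorms.topologicalAddGroup
  have h2 := hp.withSeminorms.continuousSMul
  have h3 := hp.withSeminorms.firstCountableTopology
  have h4 := hp.t2Space
  have h5 := hp.withSeminorms.toPolynormableSpace
  have h6 : TopologicalSpace.MetrizableSpace E := by
    let := IsTopologicalAddGroup.rightUniformSpace E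
    have : IsUniformAddGroup E := isUniformAddGroup_of_addCommGroup
    have : (uniformity E).IsCountablyGenerated := IsUniformAddGroup.uniformity_countably_generated
    exact UniformSpace.metrizableSpace
  exact { toIsTopologicalAddGroup := h1, toContinuousSMul := h2, toPolynormableSpace := h5,
          toMetrizableSpace := h6, complete := hp.completeSpace }

/-- Baire category: the space is completely pseudo-metrizable, hence Baire, hence barrelled. -/
theorem IsCompleteFamily.barrelledSpace [TopologicalSpace E] [Countable κ]
    {p : SeminormFamily 𝕜 E κ} (hp : IsCompleteFamily p) : BarrelledSpace 𝕜 E := by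
  have h1 := hp.withSeminorms.topologicalAddGroup
  have h2 := hp.withSeminorms.continuousSMul
  have h3 := hp.withSeminorms.firstCountableTopology
  have h4 := hp.completeSpace
  let := IsTopologicalAddGroup.rightUniformSpace E
  have : IsUniformAddGroup E := isUniformAddGroup_of_addCommGroup
  have : (uniformity E).IsCountablyGenerated := IsUniformAddGroup.uniformity_countably_generated
  let := UniformSpace.pseudoMetricSpace E
  infer_instance

/-! ### Disks -/

lemma IsDisk.zero_mem {D : Set E} (hD : IsDisk 𝕜 D) : (0 : E) ∈ D := by
  obtain ⟨x, hx⟩ := hD.1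
  simpa using hD.2 x hx x hx 0 0 (by simp)

lemma IsDisk.smul_mem {D : Set E} (hD : IsDisk 𝕜 D) {x : E} (hx : x ∈ D) {a : 𝕜} (ha : ‖a‖ ≤ 1) :
    a • x ∈ D := by
  simpa using hD.2 x hx x hx a 0 (by simpa using ha)

lemma IsDisk.balanced {D : Set E} (hD : IsDisk 𝕜 D) : Balanced 𝕜 D := by
  rintro a ha _ ⟨x, hx, rfl⟩
  exact hD.smul_mem hx ha

/-- These disks serve twice: as Banach disks, with all semi-norms bounded, and as members of the
web, with only finitely many bounded. -/
lemma isDisk_setOf_seminorm_le {ι : Type*} (p : ι → Seminorm 𝕜 E) (c : ι → ℝ) (hc : ∀ i, 0 ≤ c i) :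
    IsDisk 𝕜 {x | ∀ i, p i x ≤ c i} := by
  refine ⟨⟨0, fun i ↦ by simpa using hc i⟩, fun x hx y hy a b hab i ↦ ?_⟩
  calc p i (a • x + b • y) ≤ ‖a‖ * p i x + ‖b‖ * p i y := by
        refine (map_add_le_add _ _ _).trans ?_
        rw [map_smul_eq_mul, map_smul_eq_mul]
    _ ≤ ‖a‖ * c i + ‖b‖ * c i := add_le_add (mul_le_mul_of_nonneg_left (hx i) (norm_nonneg _))
        (mul_le_mul_of_nonneg_left (hy i) (norm_nonneg _))
    _ = (‖a‖ + ‖b‖) * c i := by ring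
    _ ≤ c i := mul_le_of_le_one_left (hc i) hab

lemma IsDisk.preimage {F : Type*} [AddCommGroup F] [Module 𝕜 F] {D : Set F} (hD : IsDisk 𝕜 D)
    (j : E →ₗ[𝕜] F) : IsDisk 𝕜 (j ⁻¹' D) :=
  ⟨⟨0, by simpa using hD.zero_mem⟩, fun x hx y hy a b hab ↦ by
    simpa using hD.2 _ hx _ hy a b hab⟩

lemma IsDisk.image {F : Type*} [AddCommGroup F] [Module 𝕜 F] {D : Set E} (hD : IsDisk 𝕜 D)
    (j : E →ₗ[𝕜] F) : IsDisk 𝕜 (j '' D) := by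
  refine ⟨hD.1.image j, ?_⟩
  rintro _ ⟨x, hx, rfl⟩ _ ⟨y, hy, rfl⟩ a b hab
  exact ⟨_, hD.2 x hx y hy a b hab, by simp⟩

/-- The gauge of an absorbent disk. -/
lemma IsDisk.exists_seminorm {D : Set E} (hD : IsDisk 𝕜 D) (habs : Absorbent 𝕜 D) :
    ∃ q : Seminorm 𝕜 E, (∀ x, q x < 1 → x ∈ D) ∧ ∀ x ∈ D, q x ≤ 1 := by
  -- The gauge is a notion of real vector spaces, so scalars are restricted to ℝ.
  let : Module ℝ E := Module.compHom E (algebraMap ℝ 𝕜)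
  have hs (a : ℝ) (x : E) : a • x = (a : 𝕜) • x := rfl
  have : IsScalarTower ℝ 𝕜 E := ⟨fun a b x ↦ by
    rw [hs, RCLike.real_smul_eq_coe_mul, mul_smul]⟩
  have hconv : Convex ℝ D := fun x hx y hy a b ha hb hab ↦ by
    rw [hs, hs]
    refine hD.2 x hx y hy _ _ ?_
    simp [abs_of_nonneg ha, abs_of_nonneg hb, hab]
  have habs' : Absorbent ℝ D := fun x ↦ by
    obtain ⟨r, hr⟩ := (habs x).exists_pos
    refine absorbs_iff_norm.2 ⟨r, fun a ha z hz ↦ ?_⟩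
    obtain ⟨y, hy, hye⟩ := hr.2 (a : 𝕜) (by simpa using ha) hz
    exact ⟨y, hy, hye⟩
  refine ⟨gaugeSeminorm hD.balanced hconv habs', fun x hx ↦ ?_, fun x hx ↦ ?_⟩
  · have h : gauge D x < 1 := hx
    have := setOfPred_gauge_lt_one_subset_self hconv hD.zero_mem habs'
    exact this h
  · exact gauge_le_one_of_mem hx

/-- In a space with a complete family of semi-norms, the sets defined by bounds of the semi-norms
are Banach disks. -/
lemma IsCompleteFamily.isBanachDisk [TopologicalSpace E] {p : SeminormFamily 𝕜 E κ}
    (hp : IsCompleteFamily p) {c : κ → ℝ} (hc : ∀ i, 0 ≤ c i) :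
    IsBanachDisk 𝕜 {x | ∀ i, p i x ≤ c i} := by
  have hD := isDisk_setOf_seminorm_le p c hc
  refine ⟨hD, ?_, fun x hx hxc ↦ ?_⟩
  · rw [hp.withSeminorms.isVonNBounded_iff_seminorm_bounded]
    exact fun i ↦ ⟨c i + 1, by linarith [hc i], fun x hx ↦ (hx i).trans_lt (lt_add_one _)⟩
  -- Membership in ε • B becomes a family of inequalities; this translates the gauge conditions into
  -- semi-norms.
  have hle {ε : ℝ} (hε : 0 < ε) {z : E} :
      (∃ b ∈ {x | ∀ i, p i x ≤ c i}, z = (ε : 𝕜) • b) ↔ ∀ i, p i z ≤ ε * c i := by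
    constructor
    · rintro ⟨b, hb, rfl⟩ i
      rw [map_smul_eq_mul]
      simpa [abs_of_pos hε] using mul_le_mul_of_nonneg_left (hb i) hε.le
    · intro h
      have hε' : (ε : 𝕜) ≠ 0 := by exact_mod_cast hε.ne'
      refine ⟨(ε : 𝕜)⁻¹ • z, fun i ↦ ?_, by rw [smul_inv_smul₀ hε']⟩
      rw [map_smul_eq_mul, norm_inv, RCLike.norm_ofReal, abs_of_pos hε, inv_mul_le_iff₀ hε]
      exact h i
  obtain ⟨y, hy⟩ := hp.complete x fun i ε hε ↦ by
    -- The denominator is c i + 1 because c i may vanish.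
    obtain ⟨N, hN⟩ := hxc (ε / (c i + 1)) (div_pos hε (by linarith [hc i]))
    refine ⟨N, fun k hk l hl ↦ ?_⟩
    have h1 := (hle (div_pos hε (by linarith [hc i]))).1 (hN k hk l hl) i
    refine h1.trans_lt ?_
    rw [div_mul_eq_mul_div, div_lt_iff₀ (by linarith [hc i])]
    nlinarith [hc i]
  have h1 := hp.withSeminorms.topologicalAddGroup
  have key : ∀ ε : ℝ, 0 < ε → ∃ N, ∀ k ≥ N, ∃ b ∈ {x | ∀ i, p i x ≤ c i}, x k - y = (ε : 𝕜) • b := by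
    intro ε hε
    obtain ⟨N, hN⟩ := hxc ε hε
    refine ⟨N, fun k hk ↦ (hle hε).2 fun i ↦ ?_⟩
    -- The disk is closed: letting l tend to infinity in the Cauchy estimate gives convergence in
    -- the gauge.
    have h2 : Tendsto (fun l ↦ p i (x k - x l)) atTop (𝓝 (p i (x k - y))) :=
      ((hp.withSeminorms.continuous_seminorm i).tendsto _).comp (tendsto_const_nhds.sub hy)
    refine le_of_tendsto h2 ?_
    filter_upwards [eventually_ge_atTop N] with l hl
    exact (hle hε).1 (hN k hk l hl) i
  refine ⟨y, ?_, key⟩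
  -- The limit differs from some x N by an element of the disk, so it lies in the span.
  obtain ⟨N, hN⟩ := key 1 one_pos
  obtain ⟨b, hb, hbe⟩ := hN N le_rfl
  have : y = x N - ((1 : ℝ) : 𝕜) • b := by rw [← hbe]; abel
  rw [this]
  exact Submodule.sub_mem _ (hx N) (Submodule.smul_mem _ _ (Submodule.subset_span hb))

/-- Spaces with a countable complete family of semi-norms are ultrabornological. -/
theorem IsCompleteFamily.isUltrabornological [TopologicalSpace E] [Countable κ]
    {p : SeminormFamily 𝕜 E κ} (hp : IsCompleteFamily p) : IsUltrabornological 𝕜 E := by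
  intro D _ hD
  have := hp.withSeminorms.firstCountableTopology
  have h1 := hp.withSeminorms.continuousSMul
  obtain ⟨U, hU⟩ := (𝓝 (0 : E)).exists_antitone_basis
  by_contra hcon
  -- If D is not a neighborhood of zero, it contains no (k + 1)⁻¹ • U k. This yields a null sequence
  -- x with x k outside (k + 1) • D. The sequence is bounded for each semi-norm, so it lies in a
  -- Banach disk, which D absorbs: a contradiction.
  have hex : ∀ k : ℕ, ∃ x ∈ U k, ((k : 𝕜) + 1)⁻¹ • x ∉ D := by
    intro k
    by_contra! h
    refine hcon ?_
    have hk : ((k : 𝕜) + 1) ≠ 0 := Nat.cast_add_one_ne_zero k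
    have h2 : ((k : 𝕜) + 1)⁻¹ • U k ∈ 𝓝 (0 : E) :=
      (set_smul_mem_nhds_zero_iff (inv_ne_zero hk)).2 (hU.1.mem_of_mem trivial)
    refine mem_of_superset h2 ?_
    rintro _ ⟨x, hx, rfl⟩
    exact h x hx
  choose x hxU hxD using hex
  have hx0 : Tendsto x atTop (𝓝 0) := hU.tendsto hxU
  have hb (i : κ) : ∃ c : ℝ, 0 ≤ c ∧ ∀ k, p i (x k) ≤ c := by
    have h2 : Tendsto (fun k ↦ p i (x k)) atTop (𝓝 (p i 0)) :=
      ((hp.withSeminorms.continuous_seminorm i).tendsto _).comp hx0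
    obtain ⟨c, hc⟩ := h2.bddAbove_range
    exact ⟨c, (apply_nonneg (p i) (x 0)).trans (hc ⟨0, rfl⟩), fun k ↦ hc ⟨k, rfl⟩⟩
  choose c hc0 hc using hb
  obtain ⟨r, hr⟩ := (hD _ (hp.isBanachDisk hc0)).exists_pos
  obtain ⟨k, hk⟩ := exists_nat_ge r
  have h3 := hr.2 ((k : 𝕜) + 1) (by
    have : ((k : 𝕜) + 1) = ((k + 1 : ℝ) : 𝕜) := by push_cast; ring
    rw [this, RCLike.norm_ofReal, abs_of_nonneg (by positivity)]
    linarith) (show x k ∈ _ from fun i ↦ hc i k)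
  refine hxD k ?_
  rwa [mem_smul_set_iff_inv_smul_mem₀ (Nat.cast_add_one_ne_zero k)] at h3

/-- An injective linear map identifies the span of B, with its gauge, with the span of the image.
The topologies enter only through boundedness, which continuous linear maps preserve. -/
lemma IsBanachDisk.image [TopologicalSpace E] {F : Type*} [AddCommGroup F] [Module 𝕜 F]
    [TopologicalSpace F] {B : Set E} (hB : IsBanachDisk 𝕜 B) {j : E →L[𝕜] F}
    (hj : Function.Injective j) : IsBanachDisk 𝕜 (j '' B) := by
  refine ⟨hB.1.image j.toLinearMap, hB.2.1.image j, fun x hx hxc ↦ ?_⟩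
  have hspan : Submodule.span 𝕜 (j '' B) = (Submodule.span 𝕜 B).map j.toLinearMap :=
    Submodule.span_image j.toLinearMap
  rw [hspan] at hx
  choose z hz hzx using hx
  obtain ⟨y, hy, hyc⟩ := hB.2.2 z hz fun ε hε ↦ by
    obtain ⟨N, hN⟩ := hxc ε hε
    refine ⟨N, fun k hk l hl ↦ ?_⟩
    obtain ⟨_, ⟨b, hb, rfl⟩, hbe⟩ := hN k hk l hl
    refine ⟨b, hb, hj ?_⟩
    rw [map_sub, map_smul, ← hbe, ← hzx, ← hzx]
    rfl
  refine ⟨j y, by rw [hspan]; exact ⟨y, hy, rfl⟩, fun ε hε ↦ ?_⟩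
  obtain ⟨N, hN⟩ := hyc ε hε
  refine ⟨N, fun k hk ↦ ?_⟩
  obtain ⟨b, hb, hbe⟩ := hN k hk
  exact ⟨j b, ⟨b, hb, rfl⟩, by rw [← map_smul, ← hbe, map_sub, ← hzx]; rfl⟩

/-! ### Inductive limits -/

variable {S : Type*} {G : S → Type*} [∀ s, AddCommGroup (G s)] [∀ s, Module 𝕜 (G s)]
  [∀ s, TopologicalSpace (G s)] {F : Type*} [AddCommGroup F] [Module 𝕜 F] [TopologicalSpace F]
  (j : ∀ s, G s →L[𝕜] F)

/-- A lower semicontinuous semi-norm pulls back to a lower semicontinuous one on each step, where it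
is continuous. The hypothesis `huniv` is all that is needed of the limit topology. -/
theorem barrelledSpace_of_inductiveLimit
    (huniv : ∀ q : Seminorm 𝕜 F, (∀ s, Continuous fun x ↦ q (j s x)) → Continuous q)
    (hG : ∀ s, BarrelledSpace 𝕜 (G s)) : BarrelledSpace 𝕜 F where
  continuous_of_lowerSemicontinuous q hq := huniv q fun s ↦
    (q.comp (j s).toLinearMap).continuous_of_lowerSemicontinuous
      (hq.comp (j s).continuous)

/-- Injections send Banach disks of the steps to Banach disks of F, so the preimages of D absorb
Banach disks and are neighborhoods of zero. Since the steps cover F, D is absorbent, and its gauge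
is a semi-norm that is continuous on each step. -/
theorem isUltrabornological_of_inductiveLimit (hinj : ∀ s, Function.Injective (j s))
    (hsurj : ∀ x : F, ∃ s y, j s y = x)
    (huniv : ∀ q : Seminorm 𝕜 F, (∀ s, Continuous fun x ↦ q (j s x)) → Continuous q)
    [∀ s, IsTopologicalAddGroup (G s)] [∀ s, ContinuousSMul 𝕜 (G s)]
    (hG : ∀ s, IsUltrabornological 𝕜 (G s)) : IsUltrabornological 𝕜 F := by
  intro D hD hDB
  have hn (s : S) : j s ⁻¹' D ∈ 𝓝 (0 : G s) := by
    refine hG s _ (hD.preimage (j s).toLinearMap) fun B hB ↦ ?_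
    have h1 := hDB _ (hB.image (hinj s))
    filter_upwards [h1, Bornology.eventually_ne_cobounded (0 : 𝕜)] with a ha ha0 x hx
    obtain ⟨y, hy, hye⟩ := ha ⟨x, hx, rfl⟩
    refine ⟨a⁻¹ • x, ?_, smul_inv_smul₀ ha0 x⟩
    have h2 : a • y = j s x := hye
    rw [mem_preimage, map_smul, ← h2, inv_smul_smul₀ ha0]
    exact hy
  have habs : Absorbent 𝕜 D := by
    intro x
    obtain ⟨s, y, rfl⟩ := hsurj x
    filter_upwards [absorbent_nhds_zero (hn s) y] with a ha
    rw [singleton_subset_iff] at ha ⊢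
    obtain ⟨z, hz, hze⟩ := ha
    exact ⟨j s z, hz, by rw [← hze]; exact (map_smul (j s) a z).symm⟩
  obtain ⟨q, hq1, hq2⟩ := hD.exists_seminorm habs
  have hq : Continuous q := huniv q fun s ↦ by
    have h1 : (q.comp (j s).toLinearMap).closedBall 0 1 ∈ 𝓝 (0 : G s) := by
      filter_upwards [hn s] with x hx
      rw [Seminorm.mem_closedBall_zero]
      exact hq2 _ hx
    exact Seminorm.continuous' h1
  have h2 : {x | q x < 1} ∈ 𝓝 (0 : F) :=
    hq.continuousAt.eventually (gt_mem_nhds (by simp))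
  exact mem_of_superset h2 hq1

/-- The first index of the web chooses a step of the limit; each further index is an integer bound
for the next semi-norm of that step. Countably many steps must therefore suffice to cover F. -/
theorem isWebbed_of_inductiveLimit (hG : ∀ s, ∃ p : SeminormFamily 𝕜 (G s) ℕ, IsCompleteFamily p)
    (s : ℕ → S) (hsurj : ∀ x : F, ∃ k y, j (s k) y = x) : IsWebbed 𝕜 F := by
  choose p hp using hG
  let A (k : ℕ) (l : List ℕ) : Set (G (s k)) := {x | ∀ i : Fin l.length, p (s k) i x ≤ l[i]}
  let W : List ℕ → Set F
    | [] => univ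
    | k :: l => j (s k) '' A k l
  refine ⟨W, ?_, rfl, ?_, fun σ ↦ ?_⟩
  · rintro (_ | ⟨k, l⟩)
    · exact ⟨⟨0, trivial⟩, fun _ _ _ _ _ _ _ ↦ trivial⟩
    · exact (isDisk_setOf_seminorm_le (fun i : Fin l.length ↦ p (s k) i) (fun i ↦ l[i])
        fun i ↦ Nat.cast_nonneg _).image (j (s k)).toLinearMap
  · rintro (_ | ⟨k, l⟩)
    · refine (eq_univ_of_forall fun x ↦ ?_).symm
      obtain ⟨k, y, rfl⟩ := hsurj x
      exact mem_iUnion.2 ⟨k, y, fun i ↦ i.elim0, rfl⟩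
    · have h (m : ℕ) : A k (l ++ [m]) = A k l ∩ {x | p (s k) l.length x ≤ m} := by
        ext x
        constructor
        · intro hx
          refine ⟨fun i ↦ ?_, ?_⟩
          · have := hx ⟨i, by simp⟩
            simpa [List.getElem_append_left i.2] using this
          · simpa using hx ⟨l.length, by simp⟩
        · rintro ⟨h1, h2⟩ ⟨i, hi⟩
          rw [List.length_append, List.length_singleton] at hi
          rcases Nat.lt_succ_iff_lt_or_eq.1 hi with h | rfl
          · simpa [List.getElem_append_left h] using h1 ⟨i, h⟩
          · simpa using h2
      change j (s k) '' A k l = ⋃ m, j (s k) '' A k (l ++ [m])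
      rw [← image_iUnion]
      congr 1
      simp only [h, ← inter_iUnion]
      refine (inter_eq_left.2 fun x _ ↦ ?_).symm
      obtain ⟨m, hm⟩ := exists_nat_ge (p (s k) l.length x)
      exact mem_iUnion.2 ⟨m, hm⟩
  -- With the weights 2⁻ᵐ, each semi-norm of the series is eventually dominated by a geometric
  -- series, so the series converges already in the chosen step.
  · refine ⟨fun m ↦ (1 / 2) ^ m, fun m ↦ by positivity, fun x c hx hc ↦ ?_⟩
    set k := σ 0
    -- The indices are shifted by one: σ 0 names the step, so the bound for the semi-norm i is σ (i
    -- + 1), and it constrains the term m only for i < m. The finitely many terms with m ≤ i are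
    -- unconstrained.
    have hx' (m : ℕ) : ∃ y : G (s k), j (s k) y = x m ∧ ∀ i < m, p (s k) i y ≤ σ (i + 1) := by
      have h := hx m
      rw [List.range_succ_eq_map, List.map_cons, List.map_map] at h
      obtain ⟨y, hy, hye⟩ := h
      refine ⟨y, hye, fun i hi ↦ ?_⟩
      simpa using hy ⟨i, by simpa using hi⟩
    choose y hyx hy using hx'
    have h1 := (hp (s k)).withSeminorms.topologicalAddGroup
    obtain ⟨z, hz⟩ := (hp (s k)).complete (fun N ↦ ∑ m ∈ Finset.range N, c m • y m) fun i ε hε ↦ by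
      have hs : Summable fun m ↦ p (s k) i (c m • y m) := by
        refine Summable.of_norm_bounded_eventually_nat
          (g := fun m ↦ (1 / 2 : ℝ) ^ m * σ (i + 1)) (summable_geometric_two.mul_right _) ?_
        filter_upwards [eventually_gt_atTop i] with m hm
        rw [Real.norm_of_nonneg (apply_nonneg _ _), map_smul_eq_mul]
        exact mul_le_mul (hc m) (hy m i hm) (apply_nonneg _ _) (by positivity)
      have hcs := hs.hasSum.tendsto_sum_nat.cauchySeq
      obtain ⟨N, hN⟩ := Metric.cauchySeq_iff.1 hcs ε hε
      have key : ∀ a b, a ≤ b → p (s k) i (∑ m ∈ Finset.range b, c m • y m -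
          ∑ m ∈ Finset.range a, c m • y m) ≤ dist (∑ m ∈ Finset.range b, p (s k) i (c m • y m))
            (∑ m ∈ Finset.range a, p (s k) i (c m • y m)) := by
        intro a b hab
        rw [Real.dist_eq, ← Finset.sum_Ico_eq_sub _ hab, ← Finset.sum_Ico_eq_sub _ hab]
        exact (Finset.le_sum_of_subadditive (p (s k) i) (map_zero _).le (map_add_le_add _) _ _).trans (le_abs_self _)
      refine ⟨N, fun a ha b hb ↦ ?_⟩
      rcases le_total a b with hab | hab
      · rw [map_sub_rev]
        exact (key a b hab).trans_lt (hN b hb a ha)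
      · exact (key b a hab).trans_lt (hN a ha b hb)
    refine ⟨j (s k) z, ?_⟩
    have h2 := ((j (s k)).continuous.tendsto z).comp hz
    refine h2.congr fun N ↦ ?_
    simp [map_sum, hyx]

end FunctionalAnalysis

/-! ### Multiplication by Schwartz functions on the Sobolev spaces of ℝⁿ. -/

section EuclideanSobolev

open MeasureTheory ENNReal FourierTransform Convolution

variable {E : Type*} [NormedAddCommGroup E] [InnerProductSpace ℝ E] [FiniteDimensional ℝ E]
  [MeasurableSpace E] [BorelSpace E]

/-- The weight `(1 + ‖x‖²)^{s/2}`. -/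
def weight (s : ℝ) (x : E) : ℝ := (1 + ‖x‖ ^ 2) ^ (s / 2)

lemma weight_nonneg (s : ℝ) (x : E) : 0 ≤ weight s x := by unfold weight; positivity

lemma weight_temperate' (s : ℝ) :
    Function.HasTemperateGrowth (fun x : E ↦ ((weight s x : ℝ) : ℂ)) := by
  unfold weight; fun_prop

lemma weight_mul_weight_neg (s : ℝ) (x : E) : weight s x * weight (-s) x = 1 := by
  unfold weight
  rw [← Real.rpow_add (by positivity)]
  ring_nf
  simp

/-- Peetre's inequality. -/
lemma weight_le_mul (s : ℝ) (x y : E) :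
    weight s x ≤ 2 ^ (|s| / 2) * weight |s| (x - y) * weight s y := by
  have base (u v : E) : 1 + ‖u‖ ^ 2 ≤ 2 * (1 + ‖u - v‖ ^ 2) * (1 + ‖v‖ ^ 2) := by
    have h1 : ‖u‖ ≤ ‖u - v‖ + ‖v‖ := by simpa using norm_add_le (u - v) v
    have h2 : ‖u‖ ^ 2 ≤ (‖u - v‖ + ‖v‖) ^ 2 := pow_le_pow_left₀ (norm_nonneg _) h1 2
    nlinarith [sq_nonneg (‖u - v‖ - ‖v‖), sq_nonneg (‖u - v‖ * ‖v‖), sq_nonneg ‖u - v‖, sq_nonneg ‖v‖]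
  have pos (u v : E) {t : ℝ} (ht : 0 ≤ t) :
      weight t u ≤ 2 ^ (t / 2) * weight t (u - v) * weight t v := by
    unfold weight
    rw [← Real.mul_rpow (by positivity) (by positivity), ← Real.mul_rpow (by positivity) (by positivity)]
    exact Real.rpow_le_rpow (by positivity) (base u v) (by positivity)
  rcases le_total 0 s with hs | hs
  · rw [abs_of_nonneg hs]; exact pos x y hs
  · rw [abs_of_nonpos hs]
    -- For s ≤ 0, take the inequality of exponent -s with x and y exchanged, and multiply it by both
    -- weights of exponent s.
    have h := pos y x (neg_nonneg.2 hs)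
    have e : weight (-s) (y - x) = weight (-s) (x - y) := by simp [weight, norm_sub_rev]
    rw [e] at h
    have h1 := weight_mul_weight_neg s x
    have h2 := weight_mul_weight_neg s y
    have hx := weight_nonneg s x
    have hy := weight_nonneg s y
    calc weight s x = weight s x * weight s y * weight (-s) y := by rw [mul_assoc, h2, mul_one]
      _ ≤ weight s x * weight s y * (2 ^ (-s / 2) * weight (-s) (x - y) * weight (-s) x) :=
        mul_le_mul_of_nonneg_left h (mul_nonneg hx hy)
      _ = (weight s x * weight (-s) x) * (2 ^ (-s / 2) * weight (-s) (x - y) * weight s y) := by ring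
      _ = _ := by rw [h1, one_mul]

/-- Young's inequality `‖k ∗ f‖₂ ≤ ‖k‖₁ ‖f‖₂` for non-negative functions. -/
lemma lintegral_conv_sq_le {k f : E → ℝ≥0∞} (hk : Measurable k) (hf : Measurable f) :
    ∫⁻ x, (∫⁻ t, k t * f (x - t)) ^ 2 ≤ (∫⁻ t, k t) ^ 2 * ∫⁻ x, f x ^ 2 := by
  -- Cauchy–Schwarz for k f = k^(1/2) (k f²)^(1/2). Tonelli's theorem and translation invariance do
  -- the rest.
  have hcs (x : E) : (∫⁻ t, k t * f (x - t)) ^ 2 ≤ (∫⁻ t, k t) * ∫⁻ t, k t * f (x - t) ^ 2 := by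
    have hfx : Measurable fun t ↦ f (x - t) := hf.comp (measurable_const.sub measurable_id)
    have h := ENNReal.lintegral_mul_norm_pow_le (μ := volume) hk.aemeasurable
      (hk.mul (hfx.pow_const 2)).aemeasurable (p := 1 / 2) (q := 1 / 2) (by norm_num) (by norm_num)
      (by norm_num)
    have e (t : E) : k t ^ (1 / 2 : ℝ) * (k t * f (x - t) ^ 2) ^ (1 / 2 : ℝ) = k t * f (x - t) := by
      rw [ENNReal.mul_rpow_of_nonneg _ _ (by norm_num), ← mul_assoc,
        ← ENNReal.rpow_add_of_nonneg _ _ (by norm_num) (by norm_num), ← ENNReal.rpow_natCast,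
        ← ENNReal.rpow_mul]
      norm_num
    simp only [Pi.mul_apply, e] at h
    have h2 := pow_le_pow_left₀ (zero_le) h 2
    refine h2.trans_eq ?_
    rw [mul_pow, ← ENNReal.rpow_natCast, ← ENNReal.rpow_natCast, ← ENNReal.rpow_mul,
      ← ENNReal.rpow_mul]
    norm_num
  have hm : Measurable (Function.uncurry fun (x t : E) ↦ k t * f (x - t) ^ 2) :=
    (hk.comp measurable_snd).mul ((hf.comp (measurable_fst.sub measurable_snd)).pow_const 2)
  calc ∫⁻ x, (∫⁻ t, k t * f (x - t)) ^ 2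
      ≤ ∫⁻ x, (∫⁻ t, k t) * ∫⁻ t, k t * f (x - t) ^ 2 := lintegral_mono hcs
    _ = (∫⁻ t, k t) * ∫⁻ x, ∫⁻ t, k t * f (x - t) ^ 2 :=
        lintegral_const_mul _ hm.lintegral_prod_right
    _ = (∫⁻ t, k t) * ∫⁻ t, ∫⁻ x, k t * f (x - t) ^ 2 := by
        rw [lintegral_lintegral_swap hm.aemeasurable]
    _ = (∫⁻ t, k t) * ∫⁻ t, k t * ∫⁻ x, f x ^ 2 := by
        congr 1
        refine lintegral_congr fun t ↦ ?_
        have hft : Measurable fun x ↦ f (x - t) ^ 2 :=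
          (hf.comp (measurable_id.sub measurable_const)).pow_const 2
        rw [lintegral_const_mul _ hft]
        congr 1
        exact lintegral_sub_right_eq_self (fun x ↦ f x ^ 2) t
    _ = _ := by rw [lintegral_mul_const _ hk, sq, mul_assoc]

lemma norm_toLp_two_sq (f : 𝓢(E, ℂ)) :
    ENNReal.ofReal (‖f.toLp 2‖ ^ 2) = ∫⁻ x, ‖f x‖ₑ ^ 2 := by
  rw [SchwartzMap.norm_toLp, ← ENNReal.toReal_pow, ENNReal.ofReal_toReal
    (ENNReal.pow_ne_top (f.eLpNorm_lt_top 2 volume).ne),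
    eLpNorm_eq_lintegral_rpow_enorm_toReal (by norm_num) (by norm_num), ← ENNReal.rpow_natCast,
    ← ENNReal.rpow_mul]
  simp

/-- Convolution with a Schwartz function is bounded on weighted `L²` spaces. -/
lemma exists_norm_weight_convolution_le (s : ℝ) (a : 𝓢(E, ℂ)) : ∃ C : ℝ, 0 ≤ C ∧ ∀ b : 𝓢(E, ℂ),
    ‖(SchwartzMap.smulLeftCLM ℂ (fun x ↦ ((weight s x : ℝ) : ℂ))
      (SchwartzMap.convolution (ContinuousLinearMap.mul ℂ ℂ) a b)).toLp 2‖ ≤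
      C * ‖(SchwartzMap.smulLeftCLM ℂ (fun x ↦ ((weight s x : ℝ) : ℂ)) b).toLp 2‖ := by
  -- The function a' collects Peetre's constant and his weight of exponent |s|. It is again
  -- Schwartz, hence integrable, and its L¹ norm is the constant C.
  set a' : 𝓢(E, ℂ) := (((2 : ℝ) ^ (|s| / 2) : ℝ) : ℂ) •
    SchwartzMap.smulLeftCLM ℂ (fun x ↦ ((weight |s| x : ℝ) : ℂ)) a with ha'
  have hfin : ∫⁻ x, ‖a' x‖ₑ ≠ ⊤ := a'.integrable.hasFiniteIntegral.ne
  have ha'x (x : E) : ‖a' x‖ₑ = ENNReal.ofReal (2 ^ (|s| / 2) * weight |s| x * ‖a x‖) := by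
    rw [← ofReal_norm]
    congr 1
    rw [ha']
    simp only [smul_apply, SchwartzMap.smulLeftCLM_apply_apply (weight_temperate' |s|), smul_eq_mul,
      norm_mul, Complex.norm_real, Real.norm_eq_abs, abs_of_nonneg (weight_nonneg _ _)]
    rw [abs_of_nonneg (by positivity : (0 : ℝ) ≤ 2 ^ (|s| / 2))]
    ring
  refine ⟨(∫⁻ x, ‖a' x‖ₑ).toReal, ENNReal.toReal_nonneg, fun b ↦ ?_⟩
  set g := SchwartzMap.smulLeftCLM ℂ (fun x ↦ ((weight s x : ℝ) : ℂ)) b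
  have hg (x : E) : ‖g x‖ₑ = ENNReal.ofReal (weight s x * ‖b x‖) := by
    rw [← ofReal_norm]
    congr 1
    simp [g, SchwartzMap.smulLeftCLM_apply_apply (weight_temperate' s), abs_of_nonneg (weight_nonneg _ _)]
  -- Peetre's inequality for x and x - t distributes the weight over the two factors of the
  -- convolution.
  have key (x : E) : ‖(SchwartzMap.smulLeftCLM ℂ (fun x ↦ ((weight s x : ℝ) : ℂ))
      (SchwartzMap.convolution (ContinuousLinearMap.mul ℂ ℂ) a b)) x‖ₑ ≤
      ∫⁻ t, ‖a' t‖ₑ * ‖g (x - t)‖ₑ := by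
    rw [SchwartzMap.smulLeftCLM_apply_apply (weight_temperate' s), SchwartzMap.convolution_apply,
      convolution_def, smul_eq_mul, enorm_mul]
    refine (mul_le_mul_right (enorm_integral_le_lintegral_enorm _) _).trans ?_
    rw [← lintegral_const_mul' _ _ (by simp)]
    refine lintegral_mono fun t ↦ ?_
    rw [ha'x, hg, ← ENNReal.ofReal_mul (by have := weight_nonneg |s| t; positivity),
      ← ofReal_norm, ← ofReal_norm, ← ENNReal.ofReal_mul (norm_nonneg _)]
    refine ENNReal.ofReal_le_ofReal ?_
    simp only [Complex.norm_real, Real.norm_eq_abs, abs_of_nonneg (weight_nonneg _ _),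
      ContinuousLinearMap.mul_apply', norm_mul]
    have h := weight_le_mul s x (x - t)
    rw [_root_.sub_sub_cancel] at h
    nlinarith [mul_le_mul_of_nonneg_right h (mul_nonneg (norm_nonneg (a t)) (norm_nonneg (b (x - t))))]
  rw [← abs_of_nonneg (norm_nonneg (SchwartzMap.toLp _ 2 _)), ← abs_of_nonneg (mul_nonneg ENNReal.toReal_nonneg (norm_nonneg (SchwartzMap.toLp _ 2 _))), ← sq_le_sq,
    ← ENNReal.ofReal_le_ofReal_iff (by positivity), norm_toLp_two_sq, mul_pow,
    ENNReal.ofReal_mul (by positivity), norm_toLp_two_sq, ENNReal.ofReal_pow ENNReal.toReal_nonneg,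
    ENNReal.ofReal_toReal hfin]
  exact (lintegral_mono fun x ↦ pow_le_pow_left₀ zero_le (key x) 2).trans
    (lintegral_conv_sq_le a'.continuous.measurable.enorm g.continuous.measurable.enorm)

/-- The operator `φ ↦ Λ^{-s} (h · Λ^s φ)` is bounded for the norm of `L²`. -/
lemma exists_norm_bessel_mul_bessel_le (s : ℝ) (h : 𝓢(E, ℂ)) : ∃ C : ℝ, 0 ≤ C ∧ ∀ φ : 𝓢(E, ℂ),
    ‖(𝓕 (SchwartzMap.smulLeftCLM ℂ (fun x ↦ ((weight (-s) x : ℝ) : ℂ)) (𝓕⁻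
      (SchwartzMap.smulLeftCLM ℂ h (𝓕 (SchwartzMap.smulLeftCLM ℂ (fun x ↦ ((weight s x : ℝ) : ℂ))
        (𝓕⁻ φ))))))).toLp 2‖ ≤ C * ‖φ.toLp 2‖ := by
  -- In the frequency variable, multiplication by h is convolution with 𝓕⁻ h, so the claim is the
  -- weighted estimate of exponent -s for b = weight s · 𝓕⁻ φ. The two weights of b cancel, and
  -- Plancherel's theorem returns the norm of φ.
  obtain ⟨C, hC0, hC⟩ := exists_norm_weight_convolution_le (-s) (𝓕⁻ h)
  refine ⟨C, hC0, fun φ ↦ ?_⟩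
  set b := SchwartzMap.smulLeftCLM ℂ (fun x ↦ ((weight s x : ℝ) : ℂ)) (𝓕⁻ φ) with hb
  have h1 : 𝓕⁻ (SchwartzMap.smulLeftCLM ℂ h (𝓕 b)) =
      SchwartzMap.convolution (ContinuousLinearMap.mul ℂ ℂ) (𝓕⁻ h) b := by
    have h0 : 𝓕⁻ (𝓕 (SchwartzMap.convolution (ContinuousLinearMap.mul ℂ ℂ) (𝓕⁻ h) b) : 𝓢(E, ℂ)) =
        SchwartzMap.convolution (ContinuousLinearMap.mul ℂ ℂ) (𝓕⁻ h) b := fourierInv_fourier_eq _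
    rw [← h0, SchwartzMap.fourier_convolution, fourier_fourierInv_eq]
    congr 1
    ext x
    simp [SchwartzMap.smulLeftCLM_apply_apply h.hasTemperateGrowth]
  have h2 : SchwartzMap.smulLeftCLM ℂ (fun x ↦ ((weight (-s) x : ℝ) : ℂ)) b = 𝓕⁻ φ := by
    ext x
    rw [hb, SchwartzMap.smulLeftCLM_apply_apply (weight_temperate' (-s)),
      SchwartzMap.smulLeftCLM_apply_apply (weight_temperate' s), smul_smul, ← Complex.ofReal_mul,
      mul_comm, weight_mul_weight_neg, Complex.ofReal_one, one_smul]
  rw [h1, SchwartzMap.norm_fourier_toL2_eq]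
  refine (hC b).trans_eq ?_
  rw [h2, ← SchwartzMap.norm_fourier_toL2_eq, fourier_fourierInv_eq]

lemma norm_star_Lp (f : Lp ℂ 2 (volume : Measure E)) : ‖star f‖ = ‖f‖ := by
  rw [Lp.norm_def, Lp.norm_def]
  congr 1
  refine eLpNorm_congr_norm_ae ?_
  filter_upwards [Lp.coeFn_star f] with x hx
  simp [hx]

/-- The pairing of distributions with test functions is bilinear, while the inner product is
conjugate-linear in its first argument; `star` makes up for the difference. -/
lemma Lp_apply_eq_inner (f : Lp ℂ 2 (volume : Measure E)) (φ : 𝓢(E, ℂ)) :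
    (f : 𝓢'(E, ℂ)) φ = inner ℂ (star f) (φ.toLp 2) := by
  rw [L2.inner_def, Lp.toTemperedDistribution_apply]
  refine integral_congr_ae ?_
  filter_upwards [φ.coeFn_toLp 2 volume, Lp.coeFn_star f] with x h1 h2
  rw [h1, h2]
  simp

lemma norm_Lp_apply_le (f : Lp ℂ 2 (volume : Measure E)) (φ : 𝓢(E, ℂ)) :
    ‖(f : 𝓢'(E, ℂ)) φ‖ ≤ ‖f‖ * ‖φ.toLp 2‖ := by
  rw [Lp_apply_eq_inner, ← norm_star_Lp f]
  exact norm_inner_le_norm _ _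

/-- A functional on the Schwartz space that is bounded for the norm of `L²` is in `L²`. -/
lemma exists_Lp_eq_of_bound (T : 𝓢'(E, ℂ)) {C : ℝ} (hC0 : 0 ≤ C)
    (hC : ∀ φ : 𝓢(E, ℂ), ‖T φ‖ ≤ C * ‖φ.toLp 2‖) :
    ∃ f : Lp ℂ 2 (volume : Measure E), ‖f‖ ≤ C ∧ T = (f : 𝓢'(E, ℂ)) := by
  set e : 𝓢(E, ℂ) →ₗ[ℂ] Lp ℂ 2 (volume : Measure E) :=
    (SchwartzMap.toLpCLM ℂ ℂ 2 volume).toLinearMap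
  have hd : DenseRange e := SchwartzMap.denseRange_toLpCLM (by norm_num)
  let T' : 𝓢(E, ℂ) →ₗ[ℂ] ℂ :=
    { toFun := fun φ ↦ T φ, map_add' := map_add T, map_smul' := map_smul T }
  set ℓ := T'.extendOfNorm e
  -- By density of the Schwartz functions, T extends to a functional on L², which the Riesz theorem
  -- represents.
  have hℓ (φ : 𝓢(E, ℂ)) : ℓ (φ.toLp 2) = T φ := LinearMap.extendOfNorm_eq hd ⟨C, hC⟩ φ
  set g := (InnerProductSpace.toDual ℂ (Lp ℂ 2 (volume : Measure E))).symm ℓ with hg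
  refine ⟨star g, ?_, ?_⟩
  · rw [norm_star_Lp, hg, LinearIsometryEquiv.norm_map]
    exact LinearMap.opNorm_extendOfNorm_le hd hC0 hC
  · ext φ
    rw [← hℓ, ← InnerProductSpace.toDual_symm_apply, ← hg, Lp_apply_eq_inner, star_star]

lemma weight_eq (s : ℝ) : (fun x : E ↦ (((1 + ‖x‖ ^ 2) ^ (s / 2) : ℝ) : ℂ)) =
  fun x ↦ ((weight s x : ℝ) : ℂ) := rfl

lemma Lp_toTemperedDistribution_injective :
    Function.Injective (fun f : Lp ℂ 2 (volume : Measure E) ↦ (f : 𝓢'(E, ℂ))) :=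
  LinearMap.ker_eq_bot.1 (Lp.ker_toTemperedDistributionCLM_eq_bot (F := ℂ) (μ := (volume : Measure E)) (p := 2))

variable {n : ℕ}

lemma EuclSobolev.toL2_spec {s : ℝ} (T : EuclSobolev n s) :
    TemperedDistribution.besselPotential (Eucl n) ℂ s T.1 = (T.toL2 : 𝓢'(Eucl n, ℂ)) :=
  T.2.choose_spec

/-- L² embeds in the tempered distributions, so the function chosen in `toL2` is the only possible
one. -/
lemma EuclSobolev.toL2_eq {s : ℝ} {T : EuclSobolev n s} {f : Lp ℂ 2 (volume : Measure (Eucl n))}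
    (h : TemperedDistribution.besselPotential (Eucl n) ℂ s T.1 = (f : 𝓢'(Eucl n, ℂ))) :
    T.toL2 = f :=
  Lp_toTemperedDistribution_injective (T.toL2_spec.symm.trans h)

/-- The preimage is the Bessel potential of order -s of f. This surjectivity passes the completeness
of L² on to H^s(ℝⁿ). -/
lemma EuclSobolev.exists_toL2_eq (s : ℝ) (f : Lp ℂ 2 (volume : Measure (Eucl n))) :
    ∃ T : EuclSobolev n s, T.toL2 = f := by
  have h : TemperedDistribution.besselPotential (Eucl n) ℂ s
      (TemperedDistribution.besselPotential (Eucl n) ℂ (-s) (f : 𝓢'(Eucl n, ℂ))) = f := by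
    rw [TemperedDistribution.besselPotential_besselPotential_apply]
    simp
  exact ⟨⟨_, f, h⟩, EuclSobolev.toL2_eq h⟩

lemma EuclSobolev.eq_bessel {s : ℝ} (T : EuclSobolev n s) :
    T.1 = TemperedDistribution.besselPotential (Eucl n) ℂ (-s) (T.toL2 : 𝓢'(Eucl n, ℂ)) := by
  rw [← T.toL2_spec, TemperedDistribution.besselPotential_besselPotential_apply]
  simp

/-- The elements of `H^s(ℝⁿ)` are linear combinations when their images in `L²(ℝⁿ)` are. -/
lemma EuclSobolev.toL2_add_smul {s : ℝ} {T T₁ T₂ : EuclSobolev n s} {a b : ℂ}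
    (h : T.1 = a • T₁.1 + b • T₂.1) : T.toL2 = a • T₁.toL2 + b • T₂.toL2 := by
  refine EuclSobolev.toL2_eq ?_
  rw [h, map_add, map_smul, map_smul, T₁.toL2_spec, T₂.toL2_spec]
  simp only [← Lp.toTemperedDistributionCLM_apply, map_add, map_smul]

/-- Convergence in `H^s(ℝⁿ)` implies weak convergence. -/
lemma EuclSobolev.tendsto_apply {s : ℝ} {α : Type*} {l : Filter α} {T : α → EuclSobolev n s}
    {T₀ : EuclSobolev n s} (h : Filter.Tendsto (fun k ↦ (T k).toL2) l (𝓝 T₀.toL2))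
    (g : 𝓢(Eucl n, ℂ)) : Filter.Tendsto (fun k ↦ (T k).1 g) l (𝓝 (T₀.1 g)) := by
  simp only [EuclSobolev.eq_bessel, TemperedDistribution.besselPotential,
    TemperedDistribution.fourierMultiplierCLM_apply_apply]
  -- The Bessel potential of order -s is moved to the test function; what remains is the evaluation
  -- of L² functions at the fixed Schwartz function g'.
  set g' := 𝓕 (SchwartzMap.smulLeftCLM ℂ (fun x : Eucl n ↦ (((1 + ‖x‖ ^ 2) ^ (-s / 2) : ℝ) : ℂ)) (𝓕⁻ g))
  have h1 : Continuous fun f : Lp ℂ 2 (volume : Measure (Eucl n)) ↦ (f : 𝓢'(Eucl n, ℂ)) g' :=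
    (PointwiseConvergenceCLM.evalCLM (RingHom.id ℂ) ℂ g').continuous.comp
      (Lp.toTemperedDistributionCLM ℂ (volume : Measure (Eucl n)) 2).continuous
  exact (h1.tendsto _).comp h

/-- Writing T as a Bessel potential of its L² function and transposing moves every operator to φ,
where `exists_norm_bessel_mul_bessel_le` applies. -/
lemma EuclSobolev.bessel_smulLeft_apply {s : ℝ} (T : EuclSobolev n s) (h φ : 𝓢(Eucl n, ℂ)) :
    TemperedDistribution.besselPotential (Eucl n) ℂ s (TemperedDistribution.smulLeftCLM ℂ h T.1) φ =
      (T.toL2 : 𝓢'(Eucl n, ℂ)) (𝓕 (SchwartzMap.smulLeftCLM ℂ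
        (fun x ↦ ((weight (-s) x : ℝ) : ℂ)) (𝓕⁻ (SchwartzMap.smulLeftCLM ℂ h
          (𝓕 (SchwartzMap.smulLeftCLM ℂ (fun x ↦ ((weight s x : ℝ) : ℂ)) (𝓕⁻ φ))))))) := by
  rw [TemperedDistribution.besselPotential, weight_eq,
    TemperedDistribution.fourierMultiplierCLM_apply_apply,
    TemperedDistribution.smulLeftCLM_apply_apply]
  -- Only the left side is rewritten, because T also occurs in `T.toL2` on the right.
  conv_lhs => rw [T.eq_bessel]
  rw [TemperedDistribution.besselPotential, weight_eq,
    TemperedDistribution.fourierMultiplierCLM_apply_apply]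

/-- Multiplication by Schwartz functions is bounded on `H^s(ℝⁿ)`. -/
theorem EuclSobolev.exists_smulLeft (s : ℝ) (h : 𝓢(Eucl n, ℂ)) : ∃ C : ℝ, 0 ≤ C ∧
    ∀ T : EuclSobolev n s, ∃ T' : EuclSobolev n s,
      T'.1 = TemperedDistribution.smulLeftCLM ℂ h T.1 ∧ ‖T'.toL2‖ ≤ C * ‖T.toL2‖ := by
  obtain ⟨C, hC0, hC⟩ := exists_norm_bessel_mul_bessel_le s h
  refine ⟨C, hC0, fun T ↦ ?_⟩
  -- Boundedness follows by duality: the potential of the product is bounded on test functions for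
  -- the L² norm, so it is an L² function of controlled norm.
  obtain ⟨f, hf, hfe⟩ := exists_Lp_eq_of_bound (TemperedDistribution.besselPotential (Eucl n) ℂ s
    (TemperedDistribution.smulLeftCLM ℂ h T.1)) (C := C * ‖T.toL2‖)
    (mul_nonneg hC0 (norm_nonneg _)) fun φ ↦ by
      rw [T.bessel_smulLeft_apply h φ]
      refine (norm_Lp_apply_le _ _).trans ?_
      rw [mul_comm C, mul_assoc]
      exact mul_le_mul_of_nonneg_left (hC φ) (norm_nonneg _)
  obtain ⟨T', hT'⟩ : ∃ T' : EuclSobolev n s, T'.1 = TemperedDistribution.smulLeftCLM ℂ h T.1 :=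
    ⟨⟨TemperedDistribution.smulLeftCLM ℂ h T.1, f, hfe⟩, rfl⟩
  rw [← hT'] at hfe
  exact ⟨T', hT', (congrArg norm (EuclSobolev.toL2_eq hfe)).trans_le hf⟩

end EuclideanSobolev

section LocalParts

variable {𝕜 : Type*} [RCLike 𝕜] {n : ℕ} {M : Type*} [TopologicalSpace M]
  [ChartedSpace (Eucl n) M] [IsManifold (𝓡 n) ∞ M] [CompactSpace M] [T2Space M]

/-! ### Localization in charts -/

variable (n) in
-- To place the closed support inside U, the function must vanish on a neighborhood of the
-- complement of U, not merely on the complement.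
lemma exists_smooth_cutoff {A U : Set M} (hA : IsClosed A) (hU : IsOpen U) (h : A ⊆ U) :
    ∃ χ : SmoothFun ℝ n M, tsupport χ ⊆ U ∧ ∀ p ∈ A, χ p = 1 := by
  obtain ⟨χ, h0, h1, -⟩ := exists_contMDiffMap_zero_one_nhds_of_isClosed (n := (⊤ : ℕ∞)) (𝓡 n)
    hU.isClosed_compl hA (Set.disjoint_left.2 fun p hp hpA ↦ hp (h hpA))
  refine ⟨χ, fun p hp ↦ ?_, fun p hp ↦ h1.self_of_nhdsSet p hp⟩
  by_contra hpU
  have h2 : ∀ᶠ q in 𝓝 p, χ q = 0 := eventually_nhdsSet_iff_forall.1 h0 p hpU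
  exact (notMem_tsupport_iff_eventuallyEq.2 h2) hp

variable {F : Type*} [NormedAddCommGroup F] [NormedSpace ℝ F]
  {φ : OpenPartialHomeomorph M (Eucl n)} {χ : SmoothFun ℝ n M}

/-- The product of a function on the target of a chart and a cut-off function on the manifold,
extended by zero. -/
def cutoff (φ : OpenPartialHomeomorph M (Eucl n)) (χ : SmoothFun ℝ n M) (a : Eucl n → F) :
    Eucl n → F :=
  φ.target.indicator fun y ↦ χ (φ.symm y) • a y

lemma cutoff_apply (a : Eucl n → F) {y : Eucl n} (hy : y ∈ φ.target) :
    cutoff φ χ a y = χ (φ.symm y) • a y := Set.indicator_of_mem hy _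

lemma cutoff_apply_chart (a : Eucl n → F) {p : M} (hp : p ∈ φ.source) :
    cutoff φ χ a (φ p) = χ p • a (φ p) := by
  rw [cutoff_apply a (φ.map_source hp), φ.left_inv hp]

lemma isCompact_image_tsupport (hχ : tsupport χ ⊆ φ.source) : IsCompact (φ '' tsupport χ) :=
  (isClosed_tsupport χ).isCompact.image_of_continuousOn (φ.continuousOn.mono hχ)

lemma image_tsupport_subset (hχ : tsupport χ ⊆ φ.source) : φ '' tsupport χ ⊆ φ.target := by
  rintro _ ⟨p, hp, rfl⟩
  exact φ.map_source (hχ hp)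

lemma cutoff_eq_zero (a : Eucl n → F) {y : Eucl n} (hy : y ∉ φ '' tsupport χ) :
    cutoff φ χ a y = 0 := by
  by_cases h : y ∈ φ.target
  · have h0 : χ (φ.symm y) = 0 :=
      image_eq_zero_of_notMem_tsupport fun hp ↦ hy ⟨_, hp, φ.right_inv h⟩
    rw [cutoff_apply a h, h0, zero_smul]
  · exact Set.indicator_of_notMem h _

lemma hasCompactSupport_cutoff (hχ : tsupport χ ⊆ φ.source) (a : Eucl n → F) :
    HasCompactSupport (cutoff φ χ a) :=
  HasCompactSupport.intro (isCompact_image_tsupport hχ) fun _ hy ↦ cutoff_eq_zero a hy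

/-- The image of the support of χ is compact, hence closed in ℝⁿ, so the extension by zero vanishes
near every point outside the target. -/
lemma contDiff_cutoff (hφ : φ ∈ Charts n M) (hχ : tsupport χ ⊆ φ.source) {a : Eucl n → F}
    (ha : ContDiffOn ℝ ∞ a φ.target) : ContDiff ℝ ∞ (cutoff φ χ a) := by
  refine contDiff_iff_contDiffAt.2 fun y ↦ ?_
  by_cases hy : y ∈ φ.target
  · have h1 : ContDiffAt ℝ ∞ (fun z ↦ (χ ∘ φ.symm) z • a z) y :=
      ((contDiffOn_comp_symm hφ χ).smul ha).contDiffAt (φ.open_target.mem_nhds hy)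
    refine h1.congr_of_eventuallyEq ?_
    filter_upwards [φ.open_target.mem_nhds hy] with z hz using cutoff_apply a hz
  · refine (contDiffAt_const (c := (0 : F))).congr_of_eventuallyEq ?_
    filter_upwards [(isCompact_image_tsupport hχ).isClosed.isOpen_compl.mem_nhds
      fun h ↦ hy (image_tsupport_subset hχ h)] with z hz using cutoff_eq_zero a hz

/-- The coefficient in a chart of a smooth density, cut off, as a Schwartz function. -/
def localDensLin (hφ : φ ∈ Charts n M) (hχ : tsupport χ ⊆ φ.source) :
    Density 𝕜 n M →ₗ[𝕜] 𝓢(Eucl n, 𝕜) where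
  toFun μ := (hasCompactSupport_cutoff hχ (coeff φ μ.1)).toSchwartzMap
    (contDiff_cutoff hφ hχ (μ.2 φ hφ))
  map_add' μ ν := by
    ext y
    by_cases hy : y ∈ φ.target
    · simp [cutoff_apply _ hy, coeff_add]
    · simp [cutoff, hy]
  map_smul' c μ := by
    ext y
    by_cases hy : y ∈ φ.target
    · simp only [HasCompactSupport.toSchwartzMap_toFun, cutoff_apply _ hy, coeff_smul,
        Pi.smul_apply, smul_apply, RingHom.id_apply]
      rw [smul_comm]
    · simp [cutoff, hy]

/-- The coefficient in a chart of a smooth density, cut off, depends continuously on the density. -/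
def localDens (hφ : φ ∈ Charts n M) (hχ : tsupport χ ⊆ φ.source) :
    Density 𝕜 n M →L[𝕜] 𝓢(Eucl n, 𝕜) where
  toLinearMap := localDensLin hφ hχ
  cont := by
    refine (schwartz_withSeminorms 𝕜 (Eucl n) 𝕜).continuous_of_continuous_comp _ fun ⟨k, j⟩ ↦ ?_
    have hK := isCompact_image_tsupport hχ
    have hKt := image_tsupport_subset hχ
    obtain ⟨C, hC0, hC⟩ := iteratedFDeriv_smul_bound (𝕜 := 𝕜) φ.open_target hK hKt
      (contDiffOn_comp_symm hφ χ) j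
    obtain ⟨R, hR⟩ := hK.isBounded.exists_norm_le
    let Q (i : ℕ) : SeminormIndex n M := ⟨φ, hφ, _, hK, hKt, i⟩
    -- On the compact image of the support of χ, the powers of the norm are bounded by those of R,
    -- and Leibniz' rule handles the derivatives; elsewhere the function is locally zero.
    have hb (μ : Density 𝕜 n M) : SchwartzMap.seminorm 𝕜 k j (localDensLin hφ hχ μ) ≤
        |R| ^ k * (C * ∑ i ∈ Finset.range (j + 1), densSeminorm (𝕜 := 𝕜) (Q i) μ) := by
      have h0 : 0 ≤ C * ∑ i ∈ Finset.range (j + 1), densSeminorm (𝕜 := 𝕜) (Q i) μ :=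
        mul_nonneg hC0 (Finset.sum_nonneg fun _ _ ↦ apply_nonneg _ _)
      refine SchwartzMap.seminorm_le_bound _ _ _ _ (mul_nonneg (by positivity) h0) fun y ↦ ?_
      by_cases hy : y ∈ φ '' tsupport χ
      · have h1 : localDensLin hφ hχ μ =ᶠ[𝓝 y] fun z ↦ (χ ∘ φ.symm) z • coeff φ μ.1 z := by
          filter_upwards [φ.open_target.mem_nhds (hKt hy)] with z hz using cutoff_apply _ hz
        rw [(h1.iteratedFDeriv ℝ j).self_of_nhds]
        refine mul_le_mul (pow_le_pow_left₀ (norm_nonneg _) ((hR y hy).trans (le_abs_self R)) k)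
          ((hC _ (μ.2 φ hφ) y hy).trans ?_) (norm_nonneg _) (by positivity)
        refine mul_le_mul_of_nonneg_left (Finset.sum_le_sum fun i _ ↦ ?_) hC0
        exact le_ciSup (μ.bddAbove (Q i)) ⟨y, hy⟩
      · have h1 : localDensLin hφ hχ μ =ᶠ[𝓝 y] fun _ ↦ 0 := by
          filter_upwards [hK.isClosed.isOpen_compl.mem_nhds hy] with z hz
            using cutoff_eq_zero _ hz
        rw [(h1.iteratedFDeriv ℝ j).self_of_nhds]
        have h2 : iteratedFDeriv ℝ j (fun _ : Eucl n ↦ (0 : 𝕜)) y = 0 := by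
          simp
        rw [h2, norm_zero, mul_zero]
        exact mul_nonneg (by positivity) h0
    refine Seminorm.continuous_of_le
      (q := (|R| ^ k * C).toNNReal • ∑ i ∈ Finset.range (j + 1), densSeminorm (𝕜 := 𝕜) (Q i)) ?_ ?_
    · have h1 : Continuous (fun μ ↦ (|R| ^ k * C).toNNReal *
          ∑ i ∈ Finset.range (j + 1), densSeminorm (𝕜 := 𝕜) (Q i) μ) :=
        continuous_const.mul
          (continuous_finsetSum _ fun i _ ↦ withSeminorms_density.continuous_seminorm (Q i))
      refine h1.congr fun μ ↦ ?_
      simp [NNReal.smul_def]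
    · intro μ
      refine (hb μ).trans_eq ?_
      rw [← mul_assoc]
      simp [NNReal.smul_def, Real.coe_toNNReal _ (show 0 ≤ |R| ^ k * C by positivity)]

variable (𝕜) in
/-- A real smooth function, as a `𝕜`-valued function. -/
def realFun (f : SmoothFun ℝ n M) : SmoothFun 𝕜 n M :=
  ⟨fun p ↦ (f p : 𝕜), (RCLike.ofRealCLM (K := 𝕜)).contDiff.comp_contMDiff f.contMDiff⟩

variable {ι : Type*} (𝒜 : PartitionedAtlas n M ι)

/-- A locally finite family on a compact space has finitely many non-zero members. The index type ι
is arbitrary, so this is what makes sums over the atlas finite. -/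
lemma PartitionedAtlas.finite_nonzero : {i | (Function.support (𝒜.ρ i)).Nonempty}.Finite :=
  𝒜.ρ.locallyFinite.finite_nonempty_of_compact

/-- The indices of the functions of the partition of unity that do not vanish. -/
def PartitionedAtlas.indices : Finset ι := 𝒜.finite_nonzero.toFinset

lemma PartitionedAtlas.eq_zero {i : ι} (hi : i ∉ 𝒜.indices) (p : M) : 𝒜.ρ i p = 0 := by
  by_contra h
  exact hi (𝒜.finite_nonzero.mem_toFinset.2 ⟨p, h⟩)

lemma PartitionedAtlas.sum_indices (p : M) : ∑ i ∈ 𝒜.indices, 𝒜.ρ i p = 1 := by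
  rw [← 𝒜.ρ.sum_eq_one (Set.mem_univ p)]
  refine (finsum_eq_sum_of_support_subset _ fun i hi ↦ ?_).symm
  by_contra h
  exact hi (𝒜.eq_zero h p)

lemma PartitionedAtlas.exists_cutoff (i : ι) : ∃ χ : SmoothFun ℝ n M,
    tsupport χ ⊆ (𝒜.chart i).source ∧ ∀ p ∈ tsupport (𝒜.ρ i), χ p = 1 :=
  exists_smooth_cutoff n (isClosed_tsupport _) (𝒜.chart i).open_source (𝒜.subordinate i)

/-- A cut-off function supported in a chart that is equal to `1` on the support of the function of
the partition of unity. -/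
def PartitionedAtlas.cutoffFun (i : ι) : SmoothFun ℝ n M := (𝒜.exists_cutoff i).choose

lemma PartitionedAtlas.tsupport_cutoffFun (i : ι) :
    tsupport (𝒜.cutoffFun i) ⊆ (𝒜.chart i).source := (𝒜.exists_cutoff i).choose_spec.1

lemma PartitionedAtlas.cutoffFun_eq_one {i : ι} {p : M} (h : 𝒜.ρ i p ≠ 0) :
    𝒜.cutoffFun i p = 1 := (𝒜.exists_cutoff i).choose_spec.2 p (subset_tsupport _ h)

lemma PartitionedAtlas.mem_source {i : ι} {p : M} (h : 𝒜.ρ i p ≠ 0) :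
    p ∈ (𝒜.chart i).source := 𝒜.subordinate i (subset_tsupport _ h)

/-- The cut-off is 1 on the support of ρᵢ, so it is invisible after multiplication by ρᵢ. -/
lemma PartitionedAtlas.cutoff_chart {i : ι} {p : M} (h : 𝒜.ρ i p ≠ 0) (a : Eucl n → F) :
    cutoff (𝒜.chart i) (𝒜.cutoffFun i) a (𝒜.chart i p) = a (𝒜.chart i p) := by
  rw [cutoff_apply_chart a (𝒜.mem_source h), 𝒜.cutoffFun_eq_one h, one_smul]

variable (𝕜) in
/-- The coefficient of a density in the `i`-th chart, cut off, as a complex Schwartz function. -/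
def PartitionedAtlas.localDens (i : ι) (μ : Density 𝕜 n M) : 𝓢(Eucl n, ℂ) :=
  SchwartzMap.postcompCLM (RCLike.map 𝕜 ℂ)
    (ConormalDist.localDens (𝕜 := 𝕜) (𝒜.chart_mem i) (𝒜.tsupport_cutoffFun i) μ)

lemma PartitionedAtlas.continuous_localDens (i : ι) : Continuous (𝒜.localDens 𝕜 i) :=
  (SchwartzMap.postcompCLM (RCLike.map 𝕜 ℂ)).continuous.comp
    (ConormalDist.localDens (𝕜 := 𝕜) (𝒜.chart_mem i) (𝒜.tsupport_cutoffFun i)).continuous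

lemma PartitionedAtlas.localDens_apply (i : ι) (μ : Density 𝕜 n M) (y : Eucl n) :
    𝒜.localDens 𝕜 i μ y = RCLike.map 𝕜 ℂ
      (cutoff (𝒜.chart i) (𝒜.cutoffFun i) (coeff (𝒜.chart i) μ.1) y) := rfl

/-- In the real case `RCLike.I` is 0 while `Complex.I` is not, so the identity then requires z = 0.
-/
lemma map_I_mul (z : 𝕜) (h : (RCLike.I : 𝕜) = 0 → z = 0) :
    RCLike.map 𝕜 ℂ (RCLike.I * z) = Complex.I * RCLike.map 𝕜 ℂ z := by
  rcases RCLike.I_eq_zero_or_im_I_eq_one (K := 𝕜) with h0 | h1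
  · simp [h h0]
  · rw [map_mul_complex]
    congr 1
    apply Complex.ext <;> simp [RCLike.map, h1]

lemma map_map_self (z : 𝕜) : RCLike.map ℂ 𝕜 (RCLike.map 𝕜 ℂ z) = z := by
  simp [RCLike.map, RCLike.re_add_im]

lemma norm_map_complex (z : 𝕜) : ‖RCLike.map 𝕜 ℂ z‖ = ‖z‖ := by
  rw [← sq_eq_sq₀ (norm_nonneg _) (norm_nonneg _), RCLike.norm_sq_eq_def,
    RCLike.norm_sq_eq_def]
  simp [RCLike.map]

/-- `IsLocalPart` involves only densities with real coefficients, so ρᵢ μ is split into the test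
densities of the real and imaginary parts of its coefficient. The Jacobians of the chart and of its
inverse cancel. -/
lemma PartitionedAtlas.mulDens_rho (i : ι) (μ : Density 𝕜 n M) :
    mulDens (realFun 𝕜 (𝒜.ρ i)) μ =
      𝒜.testDensity 𝕜 i (fun x ↦ (𝒜.localDens 𝕜 i μ x).re)
        (Complex.reCLM.contDiff.comp ((𝒜.localDens 𝕜 i μ).smooth (⊤ : ℕ∞))) +
      (RCLike.I : 𝕜) • 𝒜.testDensity 𝕜 i (fun x ↦ (𝒜.localDens 𝕜 i μ x).im)
        (Complex.imCLM.contDiff.comp ((𝒜.localDens 𝕜 i μ).smooth (⊤ : ℕ∞))) := by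
  refine Subtype.ext (funext fun p ↦ ?_)
  change ((𝒜.ρ i p : ℝ) : 𝕜) * μ.1 p =
    ((jac (𝒜.chart i) p * (𝒜.ρ i p * (𝒜.localDens 𝕜 i μ (𝒜.chart i p)).re) : ℝ) : 𝕜) +
    RCLike.I * ((jac (𝒜.chart i) p * (𝒜.ρ i p * (𝒜.localDens 𝕜 i μ (𝒜.chart i p)).im) : ℝ) : 𝕜)
  by_cases h : 𝒜.ρ i p = 0
  · simp [h]
  · rw [𝒜.localDens_apply, 𝒜.cutoff_chart h, coeff, (𝒜.chart i).left_inv (𝒜.mem_source h)]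
    have hj := jac_mul_jacSymm (𝒜.chart_mem i) ((𝒜.chart i).map_source (𝒜.mem_source h))
    rw [(𝒜.chart i).left_inv (𝒜.mem_source h)] at hj
    have hj' : ((jac (𝒜.chart i) p : ℝ) : 𝕜) * ((jacSymm (𝒜.chart i) (𝒜.chart i p) : ℝ) : 𝕜) = 1 := by
      rw [← RCLike.ofReal_mul, hj, RCLike.ofReal_one]
    have e := RCLike.re_add_im (μ.1 p)
    simp only [RCLike.map_apply, RCLike.real_smul_eq_coe_mul, RCLike.re_ofReal_mul,
      RCLike.im_ofReal_mul, Complex.add_re, Complex.add_im]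
    simp only [RCLike.I_to_complex, Complex.coe_algebraMap, Complex.mul_re, Complex.mul_im,
      Complex.I_re, Complex.I_im, Complex.ofReal_re, Complex.ofReal_im, RCLike.ofReal_mul]
    simp only [RCLike.ofReal_add, RCLike.ofReal_mul]
    simp
    linear_combination (-(((𝒜.ρ i p : ℝ) : 𝕜) * (((RCLike.re (μ.1 p) : ℝ) : 𝕜) +
      ((RCLike.im (μ.1 p) : ℝ) : 𝕜) * RCLike.I))) * hj' -
      ((𝒜.ρ i p : ℝ) : 𝕜) * e

/-! ### Sobolev spaces of the manifold -/

variable {𝒜}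

lemma PartitionedAtlas.map_apply_mulDens_rho {i : ι} {u : Distr 𝕜 n M} {T : 𝓢'(Eucl n, ℂ)}
    (hT : 𝒜.IsLocalPart i u T) (μ : Density 𝕜 n M) :
    RCLike.map 𝕜 ℂ (u (mulDens (realFun 𝕜 (𝒜.ρ i)) μ)) = T (𝒜.localDens 𝕜 i μ) := by
  rw [𝒜.mulDens_rho, map_add, map_smul, map_add, hT, smul_eq_mul, map_I_mul]
  -- In the real case the imaginary part of the coefficient is zero, and so is its test density.
  intro hI
  have h0 (z : 𝕜) : RCLike.im z = 0 := by
    have := RCLike.I_im z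
    rw [hI] at this
    simpa using this.symm
  have h1 : 𝒜.testDensity 𝕜 i (fun x ↦ (𝒜.localDens 𝕜 i μ x).im)
      (Complex.imCLM.contDiff.comp ((𝒜.localDens 𝕜 i μ).smooth (⊤ : ℕ∞))) = 0 := by
    refine Subtype.ext (funext fun p ↦ ?_)
    change ((jac (𝒜.chart i) p * (𝒜.ρ i p * (𝒜.localDens 𝕜 i μ (𝒜.chart i p)).im) : ℝ) : 𝕜) = 0
    rw [𝒜.localDens_apply]
    simp [RCLike.map, h0]
  rw [h1, map_zero]

lemma PartitionedAtlas.sum_mulDens_rho (𝒜 : PartitionedAtlas n M ι) (μ : Density 𝕜 n M) :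
    μ = ∑ i ∈ 𝒜.indices, mulDens (realFun 𝕜 (𝒜.ρ i)) μ := by
  refine Subtype.ext (funext fun p ↦ ?_)
  have h1 : (∑ i ∈ 𝒜.indices, mulDens (realFun 𝕜 (𝒜.ρ i)) μ).1 p =
      ∑ i ∈ 𝒜.indices, ((𝒜.ρ i p : ℝ) : 𝕜) * μ.1 p := by
    have h2 := map_sum ((LinearMap.proj (R := 𝕜) (φ := fun _ : M ↦ 𝕜) p).comp
      (smoothDensity 𝕜 n M).subtype) (fun i ↦ mulDens (realFun 𝕜 (𝒜.ρ i)) μ) 𝒜.indices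
    exact h2
  rw [h1, ← Finset.sum_mul, ← RCLike.ofReal_sum, 𝒜.sum_indices, RCLike.ofReal_one, one_mul]

/-- A distribution is determined by its local parts. -/
lemma PartitionedAtlas.apply_eq_sum {u : Distr 𝕜 n M} {T : ι → 𝓢'(Eucl n, ℂ)}
    (hT : ∀ i, 𝒜.IsLocalPart i u (T i)) (μ : Density 𝕜 n M) :
    u μ = ∑ i ∈ 𝒜.indices, RCLike.map ℂ 𝕜 (T i (𝒜.localDens 𝕜 i μ)) := by
  conv_lhs => rw [𝒜.sum_mulDens_rho μ, map_sum]
  refine Finset.sum_congr rfl fun i _ ↦ ?_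
  rw [← PartitionedAtlas.map_apply_mulDens_rho (hT i), map_map_self]

variable {s : ℝ}

lemma Sobolev.isLocalPart (i : ι) (u : Sobolev 𝕜 𝒜 s) :
    𝒜.IsLocalPart i u.1 (Sobolev.localPart i u).1 := (u.2 i).choose_spec

/-- The defining relation prescribes every value of T, so the chosen `localPart` agrees with any
local part at hand. -/
lemma PartitionedAtlas.IsLocalPart.ext {i : ι} {u : Distr 𝕜 n M} {T T' : 𝓢'(Eucl n, ℂ)}
    (h : 𝒜.IsLocalPart i u T) (h' : 𝒜.IsLocalPart i u T') : T = T' := by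
  ext g
  rw [h g, h' g]

lemma PartitionedAtlas.IsLocalPart.add_smul {i : ι} {u v : Distr 𝕜 n M} {T T' : 𝓢'(Eucl n, ℂ)}
    (h : 𝒜.IsLocalPart i u T) (h' : 𝒜.IsLocalPart i v T') (a b : 𝕜) :
    𝒜.IsLocalPart i (a • u + b • v) (RCLike.map 𝕜 ℂ a • T + RCLike.map 𝕜 ℂ b • T') := by
  intro g
  change RCLike.map 𝕜 ℂ a * T g + RCLike.map 𝕜 ℂ b * T' g = _
  rw [h g, h' g]
  simp only [add_apply, smul_apply, smul_eq_mul, map_add, map_mul_complex]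
  ring

lemma PartitionedAtlas.isLocalPart_zero {i : ι} (hi : i ∉ 𝒜.indices) (u : Distr 𝕜 n M) :
    𝒜.IsLocalPart i u 0 := by
  intro g
  have h (g : Eucl n → ℝ) (hg : ContDiff ℝ ∞ g) : 𝒜.testDensity 𝕜 i g hg = 0 := by
    refine Subtype.ext (funext fun p ↦ ?_)
    change ((jac (𝒜.chart i) p * (𝒜.ρ i p * g (𝒜.chart i p)) : ℝ) : 𝕜) = 0
    simp [𝒜.eq_zero hi]
  change (0 : ℂ) = RCLike.map 𝕜 ℂ (u (𝒜.testDensity 𝕜 i (Complex.reCLM ∘ g) _)) +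
    Complex.I * RCLike.map 𝕜 ℂ (u (𝒜.testDensity 𝕜 i (Complex.imCLM ∘ g) _))
  rw [h, h]
  simp

lemma Sobolev.toL2_localPart_add_smul (i : ι) {w u v : Sobolev 𝕜 𝒜 s} {a b : 𝕜}
    (h : w.1 = a • u.1 + b • v.1) : (localPart i w).toL2 =
      RCLike.map 𝕜 ℂ a • (localPart i u).toL2 + RCLike.map 𝕜 ℂ b • (localPart i v).toL2 := by
  refine EuclSobolev.toL2_add_smul ?_
  refine (Sobolev.isLocalPart i w).ext ?_
  rw [h]
  exact (Sobolev.isLocalPart i u).add_smul (Sobolev.isLocalPart i v) a b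

lemma Sobolev.toL2_localPart_zero {i : ι} (hi : i ∉ 𝒜.indices) (u : Sobolev 𝕜 𝒜 s) :
    (localPart i u).toL2 = 0 := by
  have h := (Sobolev.isLocalPart i u).ext (𝒜.isLocalPart_zero hi u.1)
  -- Zero is written as 0 · T + 0 · T, so that linearity makes `toL2` vanish.
  have := EuclSobolev.toL2_add_smul (T := localPart i u) (T₁ := localPart i u)
    (T₂ := localPart i u) (a := 0) (b := 0)
    (h.trans (by module : (0 : 𝓢'(Eucl n, ℂ)) = (0 : ℂ) • 0 + (0 : ℂ) • 0) |>.trans (by rw [h]))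
  simpa using this

lemma smul_eq_smul_add_zero_smul {V : Type*} [AddCommGroup V] [Module 𝕜 V] (c : 𝕜) (x : V) :
    c • x = c • x + (0 : 𝕜) • x := by module

variable (𝕜) in
lemma sub_eq_one_smul_add {V : Type*} [AddCommGroup V] [Module 𝕜 V] (x y : V) :
    x - y = (1 : 𝕜) • x + (-1 : 𝕜) • y := by module

/-- The semi-norms of the Sobolev space. -/
def sobolevSeminorm (𝒜 : PartitionedAtlas n M ι) (s : ℝ) (i : ι) :
    Seminorm 𝕜 ↥(sobolevSubmodule 𝕜 𝒜 s) :=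
  Seminorm.of (fun u ↦ ‖(Sobolev.localPart (𝕜 := 𝕜) (𝒜 := 𝒜) (s := s) i u).toL2‖)
    (fun u v ↦ by
      have h := Sobolev.toL2_localPart_add_smul (𝒜 := 𝒜) (s := s) i (w := u + v) (u := u) (v := v)
        (a := (1 : 𝕜)) (b := 1) (by simp)
      have h1 : RCLike.map 𝕜 ℂ 1 = 1 := by simp [RCLike.map]
      rw [h, h1, one_smul, one_smul]
      exact norm_add_le _ _)
    (fun c u ↦ by
      have h := Sobolev.toL2_localPart_add_smul (𝒜 := 𝒜) (s := s) i (w := c • u) (u := u) (v := u)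
        (a := c) (b := 0) (smul_eq_smul_add_zero_smul c u.1)
      rw [h, map_zero, zero_smul, add_zero, norm_smul, norm_map_complex])

lemma sobolevSeminorm_apply (i : ι) (u : ↥(sobolevSubmodule 𝕜 𝒜 s)) :
    sobolevSeminorm 𝒜 s i u = ‖(Sobolev.localPart (𝕜 := 𝕜) (𝒜 := 𝒜) (s := s) i u).toL2‖ := rfl

lemma sobolevSeminorm_sub (i : ι) (u v : ↥(sobolevSubmodule 𝕜 𝒜 s)) :
    sobolevSeminorm 𝒜 s i (u - v) = ‖(Sobolev.localPart (𝕜 := 𝕜) (𝒜 := 𝒜) (s := s) i u).toL2 -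
      (Sobolev.localPart (𝕜 := 𝕜) (𝒜 := 𝒜) (s := s) i v).toL2‖ := by
  have h := Sobolev.toL2_localPart_add_smul (𝒜 := 𝒜) (s := s) i (w := u - v) (u := u) (v := v)
    (a := (1 : 𝕜)) (b := -1)
    (sub_eq_one_smul_add 𝕜 u.1 v.1)
  have h1 : RCLike.map 𝕜 ℂ 1 = 1 := by simp [RCLike.map]
  rw [sobolevSeminorm_apply, h, map_neg, h1, one_smul, neg_one_smul, sub_eq_add_neg]

/-- Convergence in the Sobolev space implies weak convergence. -/
lemma tendsto_apply_of_sobolevSeminorm {α : Type*} {l : Filter α}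
    {u : α → ↥(sobolevSubmodule 𝕜 𝒜 s)} {v : ↥(sobolevSubmodule 𝕜 𝒜 s)}
    (h : ∀ i, Filter.Tendsto (fun k ↦ sobolevSeminorm 𝒜 s i (u k - v)) l (𝓝 0))
    (μ : Density 𝕜 n M) : Filter.Tendsto (fun k ↦ (u k).1 μ) l (𝓝 (v.1 μ)) := by
  have e (w : ↥(sobolevSubmodule 𝕜 𝒜 s)) := PartitionedAtlas.apply_eq_sum
    (fun i ↦ Sobolev.isLocalPart (𝕜 := 𝕜) (𝒜 := 𝒜) (s := s) i w) μ
  simp only [e]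
  refine tendsto_finsetSum _ fun i _ ↦ ((RCLike.map ℂ 𝕜).continuous.tendsto _).comp
    (EuclSobolev.tendsto_apply ?_ _)
  rw [tendsto_iff_norm_sub_tendsto_zero]
  simpa only [sobolevSeminorm_sub] using h i

/-- The Sobolev space is complete. -/
theorem exists_sobolevSeminorm_tendsto (u : ℕ → ↥(sobolevSubmodule 𝕜 𝒜 s))
    (hu : ∀ i, ∀ ε > 0, ∃ N, ∀ k ≥ N, ∀ l ≥ N, sobolevSeminorm 𝒜 s i (u k - u l) < ε) :
    ∃ v : ↥(sobolevSubmodule 𝕜 𝒜 s),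
      ∀ i, Filter.Tendsto (fun k ↦ sobolevSeminorm 𝒜 s i (u k - v)) Filter.atTop (𝓝 0) := by
  set L : ι → ℕ → MeasureTheory.Lp ℂ 2 (MeasureTheory.volume : MeasureTheory.Measure (Eucl n)) :=
    fun i k ↦ (Sobolev.localPart (𝕜 := 𝕜) (𝒜 := 𝒜) (s := s) i (u k)).toL2
  have hL (i : ι) : ∃ T : EuclSobolev n s, Filter.Tendsto (L i) Filter.atTop (𝓝 T.toL2) := by
    have hc : CauchySeq (L i) := Metric.cauchySeq_iff.2 fun ε hε ↦ by
      obtain ⟨N, hN⟩ := hu i ε hε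
      refine ⟨N, fun k hk l hl ↦ ?_⟩
      rw [dist_eq_norm, ← sobolevSeminorm_sub]
      exact hN k hk l hl
    obtain ⟨f, hf⟩ := cauchySeq_tendsto_of_complete hc
    obtain ⟨T, rfl⟩ := EuclSobolev.exists_toL2_eq s f
    exact ⟨T, hf⟩
  choose T hT using hL
  -- The candidate limit is glued from the limits T i of the local parts. Linearity holds because it
  -- is a pointwise limit of the u k, and continuity because it is a finite sum of continuous terms.
  let v₀ (μ : Density 𝕜 n M) : 𝕜 :=
    ∑ i ∈ 𝒜.indices, RCLike.map ℂ 𝕜 ((T i).1 (𝒜.localDens 𝕜 i μ))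
  have hv (μ : Density 𝕜 n M) : Filter.Tendsto (fun k ↦ (u k).1 μ) Filter.atTop (𝓝 (v₀ μ)) := by
    have e (w : ↥(sobolevSubmodule 𝕜 𝒜 s)) := PartitionedAtlas.apply_eq_sum
      (fun i ↦ Sobolev.isLocalPart (𝕜 := 𝕜) (𝒜 := 𝒜) (s := s) i w) μ
    simp only [e]
    exact tendsto_finsetSum _ fun i _ ↦ ((RCLike.map ℂ 𝕜).continuous.tendsto _).comp
      (EuclSobolev.tendsto_apply (hT i) _)
  let v : Distr 𝕜 n M :=
    { toFun := v₀
      map_add' := fun μ ν ↦ tendsto_nhds_unique (hv (μ + ν))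
        (((hv μ).add (hv ν)).congr fun k ↦ (map_add _ _ _).symm)
      map_smul' := fun c μ ↦ tendsto_nhds_unique (hv (c • μ))
        (((hv μ).const_smul c).congr fun k ↦ (map_smul _ _ _).symm)
      cont := continuous_finsetSum _ fun i _ ↦ (RCLike.map ℂ 𝕜).continuous.comp
        ((map_continuous (T i).1).comp (𝒜.continuous_localDens i)) }
  -- That T i is the local part of the glued distribution is not automatic: it follows by passing to
  -- the limit in the defining relation of the local parts of u k.
  have hloc (i : ι) : 𝒜.IsLocalPart i v (T i).1 := by
    intro g
    refine tendsto_nhds_unique (EuclSobolev.tendsto_apply (hT i) g) ?_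
    refine Filter.Tendsto.congr
      (fun k ↦ (Sobolev.isLocalPart (𝕜 := 𝕜) (𝒜 := 𝒜) (s := s) i (u k) g).symm) ?_
    exact (((RCLike.map 𝕜 ℂ).continuous.tendsto _).comp (hv _)).add
      ((((RCLike.map 𝕜 ℂ).continuous.tendsto _).comp (hv _)).const_mul _)
  have hvs : v ∈ sobolevSubmodule 𝕜 𝒜 s := fun i ↦ ⟨T i, hloc i⟩
  refine ⟨⟨v, hvs⟩, fun i ↦ ?_⟩
  simp only [sobolevSeminorm_sub]
  rw [← tendsto_iff_norm_sub_tendsto_zero]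
  have : Sobolev.localPart (𝕜 := 𝕜) (𝒜 := 𝒜) (s := s) i ⟨v, hvs⟩ = T i :=
    Subtype.ext ((Sobolev.isLocalPart (𝕜 := 𝕜) (𝒜 := 𝒜) (s := s) i ⟨v, hvs⟩).ext (hloc i))
  rw [this]
  exact hT i

end LocalParts

section Multipliers

variable {𝕜 : Type*} [RCLike 𝕜] {n : ℕ} {M : Type*} [TopologicalSpace M]
  [ChartedSpace (Eucl n) M] [IsManifold (𝓡 n) ∞ M] [CompactSpace M] [T2Space M]
  {ι : Type*} {𝒜 : PartitionedAtlas n M ι} {s : ℝ}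

/-! ### Multiplication by smooth functions on Sobolev spaces -/

/-- Multiplying the density by f multiplies g by the coordinate expression of f. Its cut-off
extension to ℝⁿ may be used, because ρᵢ vanishes wherever the two differ. -/
lemma PartitionedAtlas.mulDens_testDensity (f : SmoothFun ℝ n M) (i : ι) {g g' : Eucl n → ℝ}
    (hg : ContDiff ℝ ∞ g) (hg' : ContDiff ℝ ∞ g')
    (h : ∀ y, g' y = cutoff (𝒜.chart i) (𝒜.cutoffFun i) (f ∘ (𝒜.chart i).symm) y * g y) :
    mulDens (realFun 𝕜 f) (𝒜.testDensity 𝕜 i g hg) = 𝒜.testDensity 𝕜 i g' hg' := by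
  refine Subtype.ext (funext fun p ↦ ?_)
  change ((f p : ℝ) : 𝕜) * ((jac (𝒜.chart i) p * (𝒜.ρ i p * g (𝒜.chart i p)) : ℝ) : 𝕜) =
    ((jac (𝒜.chart i) p * (𝒜.ρ i p * g' (𝒜.chart i p)) : ℝ) : 𝕜)
  rw [← RCLike.ofReal_mul]
  congr 1
  by_cases hp : 𝒜.ρ i p = 0
  · simp [hp]
  · rw [h, 𝒜.cutoff_chart hp, Function.comp, (𝒜.chart i).left_inv (𝒜.mem_source hp)]
    ring

/-- The local part of f u is that of u times a fixed Schwartz function, so the bounds hold chart by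
chart. Taking f real makes multiplication respect the splitting of test functions into real and
imaginary parts. -/
lemma exists_realFun_mul_bound (f : SmoothFun ℝ n M) (s : ℝ) : ∃ C : ι → ℝ, (∀ i, 0 ≤ C i) ∧
    ∀ u : ↥(sobolevSubmodule 𝕜 𝒜 s), ∃ w : ↥(sobolevSubmodule 𝕜 𝒜 s),
      w.1 = mulDistr (realFun 𝕜 f) u.1 ∧
        ∀ i, sobolevSeminorm 𝒜 s i w ≤ C i * sobolevSeminorm 𝒜 s i u := by
  let h₀ (i : ι) : Eucl n → ℝ :=
    cutoff (𝒜.chart i) (𝒜.cutoffFun i) (f ∘ (𝒜.chart i).symm)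
  have h₀d (i : ι) : ContDiff ℝ ∞ (h₀ i) := contDiff_cutoff (𝒜.chart_mem i)
    (𝒜.tsupport_cutoffFun i) (contDiffOn_comp_symm (𝒜.chart_mem i) f)
  have h₀c (i : ι) : HasCompactSupport (h₀ i) := hasCompactSupport_cutoff (𝒜.tsupport_cutoffFun i) _
  let h (i : ι) : 𝓢(Eucl n, ℂ) := SchwartzMap.postcompCLM Complex.ofRealCLM
    ((h₀c i).toSchwartzMap (h₀d i))
  have hh (i : ι) (y : Eucl n) : h i y = ((h₀ i y : ℝ) : ℂ) := rfl
  choose C hC0 hC using fun i ↦ EuclSobolev.exists_smulLeft s (h i)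
  have key (i : ι) (u : ↥(sobolevSubmodule 𝕜 𝒜 s)) (T : EuclSobolev n s)
      (hT : T.1 = TemperedDistribution.smulLeftCLM ℂ (h i)
        (Sobolev.localPart (𝕜 := 𝕜) (𝒜 := 𝒜) (s := s) i u).1) :
      𝒜.IsLocalPart i (mulDistr (realFun 𝕜 f) u.1) T.1 := by
    intro g
    rw [hT, TemperedDistribution.smulLeftCLM_apply_apply,
      Sobolev.isLocalPart (𝕜 := 𝕜) (𝒜 := 𝒜) (s := s) i u]
    have hg (y : Eucl n) : SchwartzMap.smulLeftCLM ℂ (h i) g y = ((h₀ i y : ℝ) : ℂ) * g y := by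
      rw [SchwartzMap.smulLeftCLM_apply_apply (h i).hasTemperateGrowth, hh, smul_eq_mul]
    refine congrArg₂ (fun a b ↦ RCLike.map 𝕜 ℂ a + Complex.I * RCLike.map 𝕜 ℂ b)
      (congrArg u.1 (Eq.symm ?_)) (congrArg u.1 (Eq.symm ?_))
    · refine 𝒜.mulDens_testDensity f i _ _ fun y ↦ ?_
      rw [hg]
      simp [h₀]
    · refine 𝒜.mulDens_testDensity f i _ _ fun y ↦ ?_
      rw [hg]
      simp [h₀]
  refine ⟨C, hC0, fun u ↦ ?_⟩
  choose T hT hTb using fun i ↦ hC i (Sobolev.localPart (𝕜 := 𝕜) (𝒜 := 𝒜) (s := s) i u)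
  refine ⟨⟨mulDistr (realFun 𝕜 f) u.1, fun i ↦ ⟨T i, key i u (T i) (hT i)⟩⟩, rfl, fun i ↦ ?_⟩
  have e : Sobolev.localPart (𝕜 := 𝕜) (𝒜 := 𝒜) (s := s) i
      ⟨mulDistr (realFun 𝕜 f) u.1, fun i ↦ ⟨T i, key i u (T i) (hT i)⟩⟩ = T i :=
    Subtype.ext ((Sobolev.isLocalPart (𝕜 := 𝕜) (𝒜 := 𝒜) (s := s) i
      ⟨mulDistr (realFun 𝕜 f) u.1, fun i ↦ ⟨T i, key i u (T i) (hT i)⟩⟩).ext (key i u (T i) (hT i)))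
  rw [sobolevSeminorm_apply, e]
  exact hTb i

/-- The real part of a smooth function. -/
def reFun (f : SmoothFun 𝕜 n M) : SmoothFun ℝ n M :=
  ⟨fun p ↦ RCLike.re (f p), (RCLike.reCLM (K := 𝕜)).contDiff.comp_contMDiff f.contMDiff⟩

/-- The imaginary part of a smooth function. -/
def imFun (f : SmoothFun 𝕜 n M) : SmoothFun ℝ n M :=
  ⟨fun p ↦ RCLike.im (f p), (RCLike.imCLM (K := 𝕜)).contDiff.comp_contMDiff f.contMDiff⟩

lemma mulDistr_eq_re_add_im (f : SmoothFun 𝕜 n M) (u : Distr 𝕜 n M) :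
    mulDistr f u = (1 : 𝕜) • mulDistr (realFun 𝕜 (reFun f)) u +
      (RCLike.I : 𝕜) • mulDistr (realFun 𝕜 (imFun f)) u := by
  ext μ
  have h : mulDens f μ = mulDens (realFun 𝕜 (reFun f)) μ +
      (RCLike.I : 𝕜) • mulDens (realFun 𝕜 (imFun f)) μ := by
    refine Subtype.ext (funext fun p ↦ ?_)
    change f p * μ.1 p = ((RCLike.re (f p) : ℝ) : 𝕜) * μ.1 p +
      RCLike.I * (((RCLike.im (f p) : ℝ) : 𝕜) * μ.1 p)
    conv_lhs => rw [← RCLike.re_add_im (f p)]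
    ring
  have h2 := congrArg u h
  rw [map_add, map_smul] at h2
  refine h2.trans ?_
  change _ = (1 : 𝕜) * u (mulDens (realFun 𝕜 (reFun f)) μ) +
    (RCLike.I : 𝕜) * u (mulDens (realFun 𝕜 (imFun f)) μ)
  rw [one_mul, smul_eq_mul]

/-- Multiplication by a smooth function is continuous on Sobolev spaces. -/
theorem exists_mul_bound (f : SmoothFun 𝕜 n M) (s : ℝ) : ∃ C : ι → ℝ, (∀ i, 0 ≤ C i) ∧
    ∀ u : ↥(sobolevSubmodule 𝕜 𝒜 s), ∃ w : ↥(sobolevSubmodule 𝕜 𝒜 s), w.1 = mulDistr f u.1 ∧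
      ∀ i, sobolevSeminorm 𝒜 s i w ≤ C i * sobolevSeminorm 𝒜 s i u := by
  obtain ⟨C, hC0, hC⟩ := exists_realFun_mul_bound (𝕜 := 𝕜) (𝒜 := 𝒜) (reFun f) s
  obtain ⟨C', hC'0, hC'⟩ := exists_realFun_mul_bound (𝕜 := 𝕜) (𝒜 := 𝒜) (imFun f) s
  refine ⟨fun i ↦ C i + ‖(RCLike.I : 𝕜)‖ * C' i, fun i ↦ add_nonneg (hC0 i)
    (mul_nonneg (norm_nonneg _) (hC'0 i)), fun u ↦ ?_⟩
  obtain ⟨w, hw, hwb⟩ := hC u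
  obtain ⟨w', hw', hwb'⟩ := hC' u
  refine ⟨(1 : 𝕜) • w + (RCLike.I : 𝕜) • w', ?_, fun i ↦ ?_⟩
  · rw [mulDistr_eq_re_add_im, ← hw, ← hw']
    rfl
  · refine (map_add_le_add _ _ _).trans ?_
    rw [map_smul_eq_mul, map_smul_eq_mul, norm_one, one_mul, add_mul, mul_assoc]
    exact add_le_add (hwb i) (mul_le_mul_of_nonneg_left (hwb' i) (norm_nonneg _))

end Multipliers

section Operators

variable {𝕜 : Type*} [RCLike 𝕜] {n : ℕ} {M : Type*} [TopologicalSpace M]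
  [ChartedSpace (Eucl n) M] [IsManifold (𝓡 n) ∞ M]

/-! ### Relations between multiplications and vector fields -/

lemma divg_smul {Y : Eucl n → Eucl n} {g a : Eucl n → 𝕜} {x : Eucl n}
    (hY : DifferentiableAt ℝ Y x) (hg : DifferentiableAt ℝ g x) (ha : DifferentiableAt ℝ a x) :
    divg Y (fun z ↦ g z • a z) x = g x * divg Y a x + fderiv ℝ g x (Y x) * a x := by
  have h : fderiv ℝ (fun z ↦ g z • a z) x = g x • fderiv ℝ a x + (fderiv ℝ g x).smulRight (a x) :=
    fderiv_smul hg ha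
  rw [divg_eq (a := fun z ↦ g z • a z) hY (hg.smul ha), divg_eq hY ha, h]
  simp only [add_apply, smul_apply, ContinuousLinearMap.smulRight_apply, smul_eq_mul, mul_add,
    RCLike.real_smul_eq_coe_mul]
  ring

/-- The divergence depends only on the product of field and coefficient, so the functions f k may be
moved from the fields to the density. -/
lemma divg_sum {κ : Type*} [Fintype κ] {Y : Eucl n → Eucl n} {Z : κ → Eucl n → Eucl n}
    {f : κ → Eucl n → ℝ} {a : Eucl n → 𝕜} {x : Eucl n} (hY : ∀ y, Y y = ∑ k, f k y • Z k y)
    (hZ : ∀ k, DifferentiableAt ℝ (Z k) x) (hf : ∀ k, DifferentiableAt ℝ (f k) x)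
    (ha : DifferentiableAt ℝ a x) :
    divg Y a x = ∑ k, divg (Z k) (fun z ↦ (f k z : 𝕜) • a z) x := by
  simp only [divg]
  rw [Finset.sum_comm]
  refine Finset.sum_congr rfl fun i _ ↦ ?_
  have h1 (k : κ) : DifferentiableAt ℝ (fun z ↦ Z k z i • ((f k z : 𝕜) • a z)) x := by
    have h2 : DifferentiableAt ℝ (fun z ↦ Z k z i) x :=
      (EuclideanSpace.proj (𝕜 := ℝ) i).differentiableAt.comp x (hZ k)
    have h3 : DifferentiableAt ℝ (fun z ↦ (f k z : 𝕜)) x :=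
      (RCLike.ofRealCLM (K := 𝕜)).differentiableAt.comp x (hf k)
    exact h2.smul (h3.smul ha)
  have h0 : (fun z ↦ Y z i • a z) = fun z ↦ ∑ k, Z k z i • ((f k z : 𝕜) • a z) := by
    funext z
    rw [hY, WithLp.ofLp_sum, Finset.sum_apply, Finset.sum_smul]
    refine Finset.sum_congr rfl fun k _ ↦ ?_
    simp only [PiLp.smul_apply, smul_eq_mul, RCLike.real_smul_eq_coe_mul, RCLike.ofReal_mul]
    ring
  rw [h0, fderiv_fun_sum fun k _ ↦ h1 k, sum_apply]

lemma differentiableAt_vfCoord (X : VField n M) {φ : OpenPartialHomeomorph M (Eucl n)}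
    (hφ : φ ∈ Charts n M) {y : Eucl n} (hy : y ∈ φ.target) : DifferentiableAt ℝ (vfCoord φ X) y :=
  ((contDiffOn_vfCoord hφ X).contDiffAt (φ.open_target.mem_nhds hy)).differentiableAt (by simp)

lemma differentiableAt_comp_symm (f : SmoothFun 𝕜 n M) {φ : OpenPartialHomeomorph M (Eucl n)}
    (hφ : φ ∈ Charts n M) {y : Eucl n} (hy : y ∈ φ.target) : DifferentiableAt ℝ (f ∘ φ.symm) y :=
  ((contDiffOn_comp_symm hφ f).contDiffAt (φ.open_target.mem_nhds hy)).differentiableAt (by simp)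

/-- The derivative of a function along a vector field. -/
def vfDeriv (X : VField n M) (f : SmoothFun 𝕜 n M) : SmoothFun 𝕜 n M :=
  ⟨fun p ↦ mfderiv (𝓡 n) 𝓘(ℝ, 𝕜) f p (X p), by
    have h := contMDiff_snd_tangentBundle_modelSpace (I := 𝓘(ℝ, 𝕜)) (H := 𝕜) (n := ∞)
    have h1 := (f.contMDiff.contMDiff_tangentMap (m := ∞) (by simp)).comp X.contMDiff
    exact h.comp h1⟩

lemma vfDeriv_apply (X : VField n M) (f : SmoothFun 𝕜 n M)
    {φ : OpenPartialHomeomorph M (Eucl n)} (hφ : φ ∈ Charts n M) {p : M} (hp : p ∈ φ.source) :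
    vfDeriv X f p = fderiv ℝ (f ∘ φ.symm) (φ p) (vfCoord φ X (φ p)) := by
  let D : Eucl n →L[ℝ] 𝕜 := mfderiv (𝓡 n) 𝓘(ℝ, 𝕜) f (φ.symm (φ p))
  have h1 : HasFDerivAt (f ∘ φ.symm) (D.comp (dSymm φ (φ p))) (φ p) :=
    hasMFDerivAt_iff_hasFDerivAt.1
      ((f.contMDiff.mdifferentiableAt (by simp)).hasMFDerivAt.comp (φ p)
        ((mdiff hφ).mdifferentiableAt_symm (φ.map_source hp)).hasMFDerivAt)
  have h3 : vfDeriv X f (φ.symm (φ p)) = D (dSymm φ (φ p) (vfCoord φ X (φ p))) :=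
    congrArg D (dSymm_dChart hφ (φ.map_source hp) _).symm
  rw [h1.fderiv, ContinuousLinearMap.comp_apply, ← h3, φ.left_inv hp]

lemma lieFun_mul (X : VField n M) (f : SmoothFun 𝕜 n M) (μ : Density 𝕜 n M) (p : M) :
    lieFun X (fun q ↦ f q * μ.1 q) p = f p * lieFun X μ.1 p + vfDeriv X f p * μ.1 p := by
  set ψ := chartAt (Eucl n) p with hψ
  have hψ' : ψ ∈ Charts n M := IsManifold.chart_mem_maximalAtlas p
  have hp : p ∈ ψ.source := mem_chart_source (Eucl n) p
  have hy : ψ p ∈ ψ.target := mem_chart_target (Eucl n) p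
  have h := divg_smul (differentiableAt_vfCoord X hψ' hy) (differentiableAt_comp_symm f hψ' hy)
    ((μ.contDiffAt hψ' hy).differentiableAt (by simp))
  have h2 : jac ψ p • coeff ψ μ.1 (ψ p) = μ.1 p := by
    have := jac_mul_jacSymm hψ' hy
    rw [ψ.left_inv hp] at this
    rw [coeff, ψ.left_inv hp, smul_smul, this, one_smul]
  rw [lieFun, ← hψ, coeff_mul, h, vfDeriv_apply X f hψ' hp, lieFun, ← hψ, smul_add,
    ← mul_smul_comm, ← mul_smul_comm, h2, Function.comp, ψ.left_inv hp]

/-- The product of two smooth functions. -/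
def mulFun (f g : SmoothFun 𝕜 n M) : SmoothFun 𝕜 n M :=
  ⟨fun p ↦ f p * g p, contDiff_mul.comp_contMDiff (f.contMDiff.prodMk_space g.contMDiff)⟩

lemma mulDistr_mul (f g : SmoothFun 𝕜 n M) :
    mulDistr f * mulDistr g = mulDistr (mulFun f g) := by
  refine LinearMap.ext fun u ↦ ContinuousLinearMap.ext fun μ ↦ congrArg u ?_
  exact Subtype.ext (funext fun p ↦ (mul_left_comm _ _ _).trans (mul_assoc _ _ _).symm)

lemma mulDistr_one : mulDistr (ContMDiffMap.const 1 : SmoothFun 𝕜 n M) = 1 := by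
  refine LinearMap.ext fun u ↦ ContinuousLinearMap.ext fun μ ↦ congrArg u ?_
  exact Subtype.ext (funext fun p ↦ one_mul _)

/-- The commutation relation `X f = f X + X(f)`. -/
lemma vfDistr_mul_mulDistr (X : VField n M) (f : SmoothFun 𝕜 n M) :
    vfDistr X * mulDistr f = mulDistr f * vfDistr X + mulDistr (vfDeriv X f) := by
  refine LinearMap.ext fun u ↦ ContinuousLinearMap.ext fun μ ↦ ?_
  have h : lieDens X (mulDens f μ) = mulDens f (lieDens X μ) + mulDens (vfDeriv X f) μ :=
    Subtype.ext (funext fun p ↦ lieFun_mul X f μ p)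
  -- Operators on distributions are transposes, so the order is reversed on densities.
  change -u (mulDens f (lieDens X μ)) =
    -u (lieDens X (mulDens f μ)) + u (mulDens (vfDeriv X f) μ)
  rw [h, map_add]
  ring

/-- The transpose of f Y is μ ↦ -𝓛_Y (f μ), with f inside the divergence; hence no derivatives of
the coefficients appear. -/
lemma vfDistr_eq_sum [CompactSpace M] [T2Space M] {κ : Type*} [Fintype κ] {X : VField n M}
    {Y : κ → VField n M} {f : κ → SmoothFun ℝ n M} (h : ∀ p, X p = ∑ k, f k p • Y k p) :
    (vfDistr X : Module.End 𝕜 (Distr 𝕜 n M)) = ∑ k, mulDistr (realFun 𝕜 (f k)) * vfDistr (Y k) := by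
  have h1 (μ : Density 𝕜 n M) : lieDens X μ = ∑ k, lieDens (Y k) (mulDens (realFun 𝕜 (f k)) μ) := by
    refine Subtype.ext (funext fun p ↦ ?_)
    set ψ := chartAt (Eucl n) p with hψ
    have hψ' : ψ ∈ Charts n M := IsManifold.chart_mem_maximalAtlas p
    have hy : ψ p ∈ ψ.target := mem_chart_target (Eucl n) p
    have h2 := divg_sum (Y := vfCoord ψ X) (Z := fun k ↦ vfCoord ψ (Y k))
      (f := fun k ↦ f k ∘ ψ.symm) (a := coeff ψ μ.1) (x := ψ p) (fun y ↦ by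
        simp only [vfCoord]
        rw [h]
        exact (map_sum (dChart ψ (ψ.symm y)) _ _).trans
          (Finset.sum_congr rfl fun k _ ↦ map_smul (dChart ψ (ψ.symm y)) _ _))
      (fun k ↦ differentiableAt_vfCoord (Y k) hψ' hy)
      (fun k ↦ differentiableAt_comp_symm (f k) hψ' hy)
      ((μ.contDiffAt hψ' hy).differentiableAt (by simp))
    have h3 : (∑ k, lieDens (Y k) (mulDens (realFun 𝕜 (f k)) μ)).1 p =
        ∑ k, lieFun (Y k) (fun q ↦ realFun 𝕜 (f k) q * μ.1 q) p := by
      have := map_sum ((LinearMap.proj p).comp (smoothDensity 𝕜 n M).subtype)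
        (fun k ↦ lieDens (Y k) (mulDens (realFun 𝕜 (f k)) μ)) Finset.univ
      exact this
    rw [h3]
    change lieFun X μ.1 p = _
    simp only [lieFun, ← hψ, coeff_mul]
    rw [h2, Finset.smul_sum]
    rfl
  refine LinearMap.ext fun u ↦ ContinuousLinearMap.ext fun μ ↦ ?_
  rw [LinearMap.sum_apply, sum_apply]
  change -u (lieDens X μ) = ∑ k, -u (lieDens (Y k) (mulDens (realFun 𝕜 (f k)) μ))
  rw [h1, map_sum, Finset.sum_neg_distrib]

end Operators

section Hadamard

/-! ### Hadamard's lemma -/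

/-- Differentiation under the integral; compactness of the unit ball times [0, 1] supplies a
constant dominating function. -/
lemma hasFDerivAt_parametric_integral {E F : Type*} [NormedAddCommGroup E] [NormedSpace ℝ E]
    [ProperSpace E] [NormedAddCommGroup F] [NormedSpace ℝ F] [CompleteSpace F] {f : E × ℝ → F}
    (hf : ContDiff ℝ ∞ f) (x₀ : E) :
    HasFDerivAt (fun x ↦ ∫ t in (0 : ℝ)..1, f (x, t))
      (∫ t in (0 : ℝ)..1, (fderiv ℝ f (x₀, t)).comp (ContinuousLinearMap.inl ℝ E ℝ)) x₀ := by
  set G : E × ℝ → E →L[ℝ] F := fun z ↦ (fderiv ℝ f z).comp (ContinuousLinearMap.inl ℝ E ℝ) with hG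
  have hGc : Continuous G := (hf.continuous_fderiv (by simp)).clm_comp continuous_const
  obtain ⟨C, hC⟩ := ((isCompact_closedBall x₀ 1).prod (isCompact_Icc (a := (0 : ℝ)) (b := 1)))
    |>.exists_bound_of_continuousOn hGc.continuousOn
  have hc (x : E) : Continuous fun t ↦ f (x, t) := hf.continuous.comp (by fun_prop)
  have hc' (x : E) : Continuous fun t ↦ G (x, t) := hGc.comp (by fun_prop)
  refine intervalIntegral.hasFDerivAt_integral_of_dominated_of_fderiv_le (F := fun x t ↦ f (x, t))
    (F' := fun x t ↦ G (x, t)) (bound := fun _ ↦ C) (Metric.closedBall_mem_nhds x₀ one_pos)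
    (.of_forall fun x ↦ (hc x).aestronglyMeasurable) ((hc x₀).intervalIntegrable _ _)
    (hc' x₀).aestronglyMeasurable (.of_forall fun t ht x hx ↦ hC (x, t) ⟨hx, ?_⟩)
    intervalIntegrable_const (.of_forall fun t _ x _ ↦ ?_)
  · rw [Set.uIoc_of_le zero_le_one] at ht
    exact Set.Ioc_subset_Icc_self ht
  · exact (hf.differentiable (by simp) (x, t)).hasFDerivAt.comp x (hasFDerivAt_prodMk_left x t)

/-- Induction on the order, for all targets F at once: the derivative is again a parametric
integral, with values in E →L[ℝ] F. Keeping E and F in one universe lets the induction hypothesis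
apply to that space. -/
lemma contDiff_parametric_integral {E : Type} [NormedAddCommGroup E] [NormedSpace ℝ E]
    [ProperSpace E] {F : Type} [NormedAddCommGroup F] [NormedSpace ℝ F] [CompleteSpace F]
    {f : E × ℝ → F} (hf : ContDiff ℝ ∞ f) : ContDiff ℝ ∞ fun x ↦ ∫ t in (0 : ℝ)..1, f (x, t) := by
  refine contDiff_infty.2 fun m ↦ ?_
  induction m generalizing F with
  | zero =>
    refine contDiff_zero.2 ?_
    exact intervalIntegral.continuous_parametric_intervalIntegral_of_continuous'
      (f := fun x t ↦ f (x, t)) hf.continuous 0 1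
  | succ m ih =>
    exact contDiff_succ_iff_hasFDerivAt.2 ⟨_, ih (f := fun z ↦ (fderiv ℝ f z).comp
      (ContinuousLinearMap.inl ℝ E ℝ)) ((hf.fderiv_right (by simp)).clm_comp contDiff_const),
      hasFDerivAt_parametric_integral hf⟩

/-- Hadamard's lemma: the functions vanishing where the first `m` coordinates vanish are in the
ideal generated by these coordinates. -/
lemma exists_eq_sum_mul_coord {n : ℕ} (m : ℕ) {a : Eucl n → ℝ} (ha : ContDiff ℝ ∞ a)
    (h0 : ∀ x : Eucl n, (∀ i : Fin n, (i : ℕ) < m → x i = 0) → a x = 0) :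
    ∃ h : Fin n → Eucl n → ℝ, (∀ i, ContDiff ℝ ∞ (h i)) ∧
      ∀ x, a x = ∑ i : Fin n, h i x * if (i : ℕ) < m then x i else 0 := by
  let e (i : Fin n) : Eucl n := EuclideanSpace.single i 1
  -- The projection onto the first m coordinates.
  let R : Eucl n →L[ℝ] Eucl n := ∑ i : Fin n,
    if (i : ℕ) < m then (EuclideanSpace.proj (𝕜 := ℝ) i).smulRight (e i) else 0
  have hR (x : Eucl n) : R x = ∑ i : Fin n, (if (i : ℕ) < m then x i else 0) • e i := by
    simp only [R, sum_apply]
    refine Finset.sum_congr rfl fun i _ ↦ ?_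
    split_ifs <;> simp
  have hRi (x : Eucl n) (i : Fin n) : R x i = if (i : ℕ) < m then x i else 0 := by
    rw [hR, WithLp.ofLp_sum, Finset.sum_apply]
    simp only [e, PiLp.smul_apply, PiLp.single_apply, smul_eq_mul, mul_ite, mul_one,
      mul_zero]
    simp
  -- For fixed x, this segment runs from x with its first m coordinates erased, where a vanishes, to
  -- x. The coefficients are the integrals of the partial derivatives of a along it.
  let γ : Eucl n × ℝ → Eucl n := fun z ↦ z.1 - R z.1 + z.2 • R z.1
  have hγ : ContDiff ℝ ∞ γ := by
    have h1 : ContDiff ℝ ∞ fun z : Eucl n × ℝ ↦ R z.1 := R.contDiff.comp contDiff_fst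
    exact (contDiff_fst.sub h1).add (contDiff_snd.smul h1)
  have hf (v : Eucl n) : ContDiff ℝ ∞ fun z ↦ fderiv ℝ a (γ z) v :=
    ((ha.fderiv_right (by simp)).comp hγ).clm_apply contDiff_const
  refine ⟨fun i x ↦ ∫ t in (0 : ℝ)..1, fderiv ℝ a (γ (x, t)) (e i),
    fun i ↦ contDiff_parametric_integral (hf (e i)), fun x ↦ ?_⟩
  have hd (t : ℝ) : HasDerivAt (fun t ↦ a (γ (x, t))) (fderiv ℝ a (γ (x, t)) (R x)) t := by
    have h1 : HasDerivAt (fun t ↦ γ (x, t)) (R x) t := by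
      simpa [γ] using ((hasDerivAt_id t).smul_const (R x)).const_add (x - R x)
    exact (ha.differentiable (by simp) _).hasFDerivAt.comp_hasDerivAt t h1
  have hint (v : Eucl n) : IntervalIntegrable (fun t ↦ fderiv ℝ a (γ (x, t)) v)
      MeasureTheory.volume 0 1 :=
    ((hf v).continuous.comp (by fun_prop : Continuous fun t : ℝ ↦ (x, t))).intervalIntegrable _ _
  have h1 := intervalIntegral.integral_eq_sub_of_hasDerivAt (fun t _ ↦ hd t) (hint (R x))
  have h2 : a (γ (x, 0)) = 0 := h0 _ fun i hi ↦ by simp [γ, hRi, hi]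
  have h3 : γ (x, 1) = x := by simp [γ]
  rw [h2, h3, sub_zero] at h1
  rw [← h1]
  simp only [hR x, map_sum, map_smul, smul_eq_mul]
  rw [intervalIntegral.integral_finsetSum fun i _ ↦ (hint (e i)).const_mul _]
  refine Finset.sum_congr rfl fun i _ ↦ ?_
  rw [intervalIntegral.integral_const_mul, mul_comm]

end Hadamard

section ChartFields

variable {n : ℕ} {M : Type*} [TopologicalSpace M]
  [ChartedSpace (Eucl n) M] [IsManifold (𝓡 n) ∞ M] [CompactSpace M] [T2Space M]
  {φ ψ : OpenPartialHomeomorph M (Eucl n)} {χ : SmoothFun ℝ n M} {n' : ℕ} {L : Set M}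

/-! ### Functions and vector fields supported in a chart -/

lemma smooth_of_chart {F : Type*} [NormedAddCommGroup F] [NormedSpace ℝ F] (hφ : φ ∈ Charts n M)
    (hχ : tsupport χ ⊆ φ.source) {h : Eucl n → F} (hh : ContDiff ℝ ∞ h) :
    ContMDiff (𝓡 n) 𝓘(ℝ, F) ∞ fun p ↦ χ p • h (φ p) := by
  intro p
  by_cases hp : p ∈ φ.source
  · exact (χ.contMDiff p).smul
      (hh.contDiffAt.comp_contMDiffAt (contMDiffAt_of_mem_maximalAtlas hφ hp))
  · refine (contMDiffAt_const (c := (0 : F))).congr_of_eventuallyEq ?_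
    filter_upwards [(isClosed_tsupport χ).isOpen_compl.mem_nhds fun h ↦ hp (hχ h)] with q hq
    rw [image_eq_zero_of_notMem_tsupport hq, zero_smul]

/-- The product of a cut-off function and a function of the coordinates. -/
def chartFun (hφ : φ ∈ Charts n M) (hχ : tsupport χ ⊆ φ.source) {h : Eucl n → ℝ}
    (hh : ContDiff ℝ ∞ h) : SmoothFun ℝ n M :=
  ⟨fun p ↦ χ p • h (φ p), smooth_of_chart hφ hχ hh⟩

/-- The product of a cut-off function and a vector field given in coordinates. -/
def chartField (hφ : φ ∈ Charts n M) (hχ : tsupport χ ⊆ φ.source) {g : Eucl n → Eucl n}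
    (hg : ContDiff ℝ ∞ g) : VField n M :=
  ⟨fun p ↦ χ p • dSymm φ (φ p) (g (φ p)), by
    intro p
    by_cases hp : p ∈ φ.source
    · have hinv (q : M) (hq : q ∈ φ.source) : ∃ A : Eucl n ≃L[ℝ] Eucl n,
          (A : Eucl n →L[ℝ] Eucl n) = dChart φ q ∧
          (A.symm : Eucl n →L[ℝ] Eucl n) = dSymm φ (φ q) :=
        ⟨ContinuousLinearEquiv.equivOfInverse _ _
          (fun v ↦ by
            have := dSymm_dChart hφ (φ.map_source hq) v
            rwa [φ.left_inv hq] at this)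
          (fun v ↦ by
            have := dChart_dSymm hφ (φ.map_source hq) v
            rwa [φ.left_inv hq] at this), rfl, rfl⟩
      have h0 : ContMDiffAt (𝓡 n) (𝓡 n).tangent ∞
          (fun y ↦ (⟨y, g y⟩ : TangentBundle (𝓡 n) (Eucl n))) (φ p) :=
        contMDiffAt_vectorSpace_iff_contDiffAt.2 hg.contDiffAt
      -- In the chart domain, the field is χ times the pull-back of g by φ.
      have h1 : ContMDiffAt (𝓡 n) (𝓡 n).tangent ∞ (fun q ↦ (⟨q,
          VectorField.mpullback (𝓡 n) (𝓡 n) φ g q⟩ : TangentBundle (𝓡 n) M)) p := by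
        refine ContMDiffAt.mpullback_vectorField_preimage (n := ∞) h0
          (contMDiffAt_of_mem_maximalAtlas hφ hp) ?_ (by simp)
        obtain ⟨A, hA, -⟩ := hinv p hp
        exact ⟨A, hA⟩
      refine ((χ.contMDiff p).smul_section h1).congr_of_eventuallyEq ?_
      filter_upwards [φ.open_source.mem_nhds hp] with q hq
      obtain ⟨A, hA, hA'⟩ := hinv q hq
      have h5 : (dChart φ q).inverse = dSymm φ (φ q) := by
        rw [← hA, ContinuousLinearMap.inverse_equiv, hA']
      have h6 : VectorField.mpullback (𝓡 n) (𝓡 n) φ g q = dSymm φ (φ q) (g (φ q)) :=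
        DFunLike.congr_fun h5 (g (φ q))
      simp only [Pi.smul_apply', h6]
      rfl
    · refine (Bundle.contMDiff_zeroSection ℝ (TangentSpace (𝓡 n) : M → Type _) p).congr_of_eventuallyEq ?_
      filter_upwards [(isClosed_tsupport χ).isOpen_compl.mem_nhds fun h ↦ hp (hχ h)] with q hq
      rw [image_eq_zero_of_notMem_tsupport hq, zero_smul]
      rfl⟩

lemma chartField_apply (hφ : φ ∈ Charts n M) (hχ : tsupport χ ⊆ φ.source) {g : Eucl n → Eucl n}
    (hg : ContDiff ℝ ∞ g) (p : M) :
    chartField hφ hχ hg p = (χ p • dSymm φ (φ p) (g (φ p)) : Eucl n) := rfl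

lemma chartField_eq_zero (hφ : φ ∈ Charts n M) (hχ : tsupport χ ⊆ φ.source) {g : Eucl n → Eucl n}
    (hg : ContDiff ℝ ∞ g) {p : M} (hp : p ∉ φ.source) : chartField hφ hχ hg p = (0 : Eucl n) := by
  rw [chartField_apply, image_eq_zero_of_notMem_tsupport fun h ↦ hp (hχ h), zero_smul]

/-- The tangent space of `L` is given by the vanishing of the first components in any adapted
chart. -/
lemma IsAdapted.transition_eq_zero (hφ : IsAdapted n' L φ) (hψ : IsAdapted n' L ψ) {p : M}
    (hp : p ∈ φ.source) (hpψ : p ∈ ψ.source) (hpL : p ∈ L) {v : Eucl n}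
    (hv : ∀ i : Fin n, (i : ℕ) < n' → v i = 0) {i : Fin n} (hi : (i : ℕ) < n') :
    dChart ψ p (dSymm φ (φ p) v) i = 0 := by
  have hpψ' : φ.symm (φ p) ∈ ψ.source := by rwa [φ.left_inv hp]
  have h1 := hasFDerivAt_transition hφ.1 hψ.1 (φ.map_source hp) hpψ'
  rw [φ.left_inv hp] at h1
  -- The line φ p + t v stays in L as long as it stays in the chart, so the first coordinates in ψ
  -- vanish along it, and so do their derivatives.
  have h2 : HasDerivAt (fun t : ℝ ↦ φ p + t • v) v 0 := by
    simpa using ((hasDerivAt_id (0 : ℝ)).smul_const v).const_add (φ p)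
  have h0 : φ p + (0 : ℝ) • v = φ p := by simp
  have h3 : HasDerivAt (fun t : ℝ ↦ ψ (φ.symm (φ p + t • v)) i)
      (dChart ψ p (dSymm φ (φ p) v) i) 0 := by
    have h4 : HasDerivAt ((ψ ∘ φ.symm) ∘ fun t : ℝ ↦ φ p + t • v)
        (dChart ψ p (dSymm φ (φ p) v)) 0 :=
      h1.comp_hasDerivAt_of_eq (0 : ℝ) h2 h0.symm
    exact (EuclideanSpace.proj (𝕜 := ℝ) i).hasFDerivAt.comp_hasDerivAt (0 : ℝ) h4
  refine h3.unique ((hasDerivAt_const (0 : ℝ) (0 : ℝ)).congr_of_eventuallyEq ?_)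
  have h5 : ∀ᶠ t : ℝ in 𝓝 0, φ p + t • v ∈ φ.target ∧ φ.symm (φ p + t • v) ∈ ψ.source := by
    have h6 : Filter.Tendsto (fun t : ℝ ↦ φ p + t • v) (𝓝 0) (𝓝 (φ p)) := by
      simpa only [h0] using h2.continuousAt.tendsto
    exact h6.eventually (eventually_transition (φ.map_source hp) hpψ')
  filter_upwards [h5] with t ht
  have hL : φ.symm (φ p + t • v) ∈ L := by
    refine (hφ.2 _ (φ.map_target ht.1)).2 fun j hj ↦ ?_
    rw [φ.right_inv ht.1]
    simp [(hφ.2 p hp).1 hpL j hj, hv j hj]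
  exact (hψ.2 _ ht.2).1 hL i hi

/-- In the chart `φ`, the vector fields tangent to `L` are those that are tangent to the subspace
where the first `m` coordinates vanish. -/
structure DetectsTangency (n' : ℕ) (L : Set M) (φ : OpenPartialHomeomorph M (Eucl n)) (m : ℕ) :
    Prop where
  mem : φ ∈ Charts n M
  eq_zero : ∀ X : VField n M, IsTangentTo n' L X → ∀ p ∈ φ.source,
    (∀ i : Fin n, (i : ℕ) < m → φ p i = 0) → ∀ i : Fin n, (i : ℕ) < m → dChart φ p (X p) i = 0
  tangent : ∀ (χ : SmoothFun ℝ n M) (hχ : tsupport χ ⊆ φ.source) (g : Eucl n → Eucl n)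
    (hg : ContDiff ℝ ∞ g), (∀ y : Eucl n, (∀ i : Fin n, (i : ℕ) < m → y i = 0) →
      ∀ i : Fin n, (i : ℕ) < m → g y i = 0) → IsTangentTo n' L (chartField mem hχ hg)

/-- Tangency is required in every adapted chart ψ, while g is given in φ alone;
`IsAdapted.transition_eq_zero` connects the two. -/
lemma IsAdapted.detectsTangency (hφ : IsAdapted n' L φ) : DetectsTangency n' L φ n' where
  mem := hφ.1
  eq_zero X hX p hp h i hi := hX φ hφ p hp ((hφ.2 p hp).2 h) i hi
  tangent χ hχ g hg h ψ hψ p hp hpL i hi := by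
    by_cases hpφ : p ∈ φ.source
    · have h0 : dChart ψ p (dSymm φ (φ p) (g (φ p))) i = 0 :=
        hφ.transition_eq_zero hψ hpφ hp hpL (h _ ((hφ.2 p hpφ).1 hpL)) hi
      have h1 : dChart ψ p (chartField hφ.1 hχ hg p) =
          χ p • dChart ψ p (dSymm φ (φ p) (g (φ p))) := map_smul (dChart ψ p) _ _
      rw [h1, PiLp.smul_apply, h0, smul_zero]
    · have h1 : dChart ψ p (chartField hφ.1 hχ hg p) = 0 :=
        (congrArg (dChart ψ p) (chartField_eq_zero hφ.1 hχ hg hpφ)).trans (map_zero _)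
      rw [h1]; rfl

/-- Fields supported away from L are tangent to it, so there is no condition and m = 0. -/
lemma detectsTangency_of_disjoint (hφ : φ ∈ Charts n M) (h : ∀ p ∈ φ.source, p ∉ L) :
    DetectsTangency n' L φ 0 where
  mem := hφ
  eq_zero _ _ _ _ _ _ hi := absurd hi (Nat.not_lt_zero _)
  tangent χ hχ g hg _ ψ _ p _ hpL i _ := by
    have h1 : dChart ψ p (chartField hφ hχ hg p) = 0 :=
      (congrArg (dChart ψ p) (chartField_eq_zero hφ hχ hg fun hp ↦ h p hp hpL)).trans (map_zero _)
    rw [h1]; rfl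

/-- Adapted charts are available only at points of L. Elsewhere a chart is restricted to the
complement of L, which is open. -/
lemma exists_detectsTangency (hL : IsRegularSubmanifold n n' L) (hLc : IsClosed L) (p : M) :
    ∃ (φ : OpenPartialHomeomorph M (Eucl n)) (m : ℕ), DetectsTangency n' L φ m ∧ p ∈ φ.source := by
  by_cases hp : p ∈ L
  · obtain ⟨φ, hφ, hpφ⟩ := hL.2 p hp
    exact ⟨φ, n', hφ.detectsTangency, hpφ⟩
  · refine ⟨(chartAt (Eucl n) p).restr Lᶜ, 0,
      detectsTangency_of_disjoint ?_ ?_, ?_⟩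
    · exact restr_mem_maximalAtlas _ (IsManifold.chart_mem_maximalAtlas p) hLc.isOpen_compl
    · intro q hq
      rw [OpenPartialHomeomorph.restr_source' _ _ hLc.isOpen_compl] at hq
      exact hq.2
    · rw [OpenPartialHomeomorph.restr_source' _ _ hLc.isOpen_compl]
      exact ⟨mem_chart_source _ p, hp⟩

end ChartFields

section Generators

universe u

variable {n : ℕ} {M : Type u} [TopologicalSpace M]
  [ChartedSpace (Eucl n) M] [IsManifold (𝓡 n) ∞ M] [CompactSpace M] [T2Space M]
  {φ : OpenPartialHomeomorph M (Eucl n)} {χ η : SmoothFun ℝ n M} {n' m : ℕ} {L : Set M}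

/-! ### The tangent vector fields are finitely generated -/

/-- The coefficients of the generators `∂ⱼ`, for `j ≥ m`, and `xᵢ ∂ⱼ`, for `i, j < m`, of the vector
fields tangent to the subspace where the first `m` coordinates vanish. -/
def genCoeff (m : ℕ) : Option (Fin n) → Fin n → Eucl n → ℝ
  | none, j, _ => if (j : ℕ) < m then 0 else 1
  | some i, j, x => if (j : ℕ) < m then if (i : ℕ) < m then x i else 0 else 0

lemma contDiff_genCoeff (o : Option (Fin n)) (j : Fin n) : ContDiff ℝ ∞ (genCoeff m o j) := by
  cases o with
  | none => exact contDiff_const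
  | some i =>
    change ContDiff ℝ ∞ fun x : Eucl n ↦
      if (j : ℕ) < m then if (i : ℕ) < m then x i else 0 else 0
    split_ifs
    · exact (EuclideanSpace.proj (𝕜 := ℝ) i).contDiff
    · exact contDiff_const
    · exact contDiff_const

lemma genCoeff_eq_zero (o : Option (Fin n)) {j : Fin n} (hj : (j : ℕ) < m) {x : Eucl n}
    (hx : ∀ i : Fin n, (i : ℕ) < m → x i = 0) : genCoeff m o j x = 0 := by
  cases o with
  | none => simp [genCoeff, hj]
  | some i =>
    simp only [genCoeff, hj, if_true]
    split_ifs with hi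
    · exact hx i hi
    · rfl

/-- The generators of the vector fields tangent to the subspace where the first `m` coordinates
vanish. -/
def genField (m : ℕ) (k : Option (Fin n) × Fin n) (x : Eucl n) : Eucl n :=
  genCoeff m k.1 k.2 x • EuclideanSpace.single k.2 1

lemma contDiff_genField (k : Option (Fin n) × Fin n) : ContDiff ℝ ∞ (genField m k) :=
  (contDiff_genCoeff k.1 k.2).smul contDiff_const

lemma genField_eq_zero (k : Option (Fin n) × Fin n) {x : Eucl n}
    (hx : ∀ i : Fin n, (i : ℕ) < m → x i = 0) {i : Fin n} (hi : (i : ℕ) < m) :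
    genField m k x i = 0 := by
  rw [genField, PiLp.smul_apply, PiLp.single_apply]
  split_ifs with h
  · rw [genCoeff_eq_zero k.1 (h ▸ hi) hx, zero_smul]
  · rw [smul_zero]

/-- Component by component: for j < m, Hadamard's lemma yields the coefficients of xᵢ ∂ⱼ; for j ≥ m,
the component itself is the coefficient of ∂ⱼ. -/
lemma exists_eq_sum_genField {a : Eucl n → Eucl n} (ha : ContDiff ℝ ∞ a)
    (h0 : ∀ x : Eucl n, (∀ i : Fin n, (i : ℕ) < m → x i = 0) → ∀ i : Fin n, (i : ℕ) < m →
      a x i = 0) :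
    ∃ h : Option (Fin n) × Fin n → Eucl n → ℝ, (∀ k, ContDiff ℝ ∞ (h k)) ∧
      ∀ x, a x = ∑ k, h k x • genField m k x := by
  have haj (j : Fin n) : ContDiff ℝ ∞ fun x ↦ a x j :=
    (EuclideanSpace.proj (𝕜 := ℝ) j).contDiff.comp ha
  have h1 (j : Fin n) : ∃ h : Option (Fin n) → Eucl n → ℝ, (∀ o, ContDiff ℝ ∞ (h o)) ∧
      ∀ x, a x j = ∑ o, h o x * genCoeff m o j x := by
    by_cases hj : (j : ℕ) < m
    · obtain ⟨h, hh, hs⟩ := exists_eq_sum_mul_coord m (haj j) fun x hx ↦ h0 x hx j hj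
      refine ⟨fun o ↦ o.elim (fun _ ↦ 0) h, fun o ↦ ?_, fun x ↦ ?_⟩
      · cases o with
        | none => exact contDiff_const
        | some i => exact hh i
      · simp [hs, genCoeff, hj]
    · refine ⟨fun o ↦ o.elim (fun x ↦ a x j) fun _ _ ↦ 0, fun o ↦ ?_, fun x ↦ ?_⟩
      · cases o with
        | none => exact haj j
        | some i => exact contDiff_const
      · simp [genCoeff, hj]
  choose h hh hs using h1
  refine ⟨fun k ↦ h k.2 k.1, fun k ↦ hh k.2 k.1, fun x ↦ ?_⟩
  rw [Fintype.sum_prod_type_right]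
  ext j
  simp only [genField, smul_smul, ← Finset.sum_smul, ← hs]
  rw [WithLp.ofLp_sum, Finset.sum_apply]
  simp only [PiLp.smul_apply, PiLp.single_apply, smul_eq_mul, mul_ite, mul_one, mul_zero]
  simp

/-- The function η turns X into a field on all of ℝⁿ, to which the decomposition applies. The
generators are cut off by χ instead, so that they do not depend on X. Coefficients and generators
each carry a factor χ, which is 1 where η does not vanish. -/
lemma DetectsTangency.exists_eq_sum (hφ : DetectsTangency n' L φ m) (hχ : tsupport χ ⊆ φ.source)
    (hη : tsupport η ⊆ φ.source) (hχη : ∀ p, η p ≠ 0 → χ p = 1) {X : VField n M}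
    (hX : IsTangentTo n' L X) :
    ∃ c : Option (Fin n) × Fin n → SmoothFun ℝ n M, ∀ p,
      η p • X p = ∑ k, c k p • chartField hφ.mem hχ (contDiff_genField (m := m) k) p := by
  obtain ⟨h, hh, hs⟩ := exists_eq_sum_genField (m := m)
    (contDiff_cutoff hφ.mem hη (contDiffOn_vfCoord hφ.mem X)) (fun x hx i hi ↦ by
      by_cases hxt : x ∈ φ.target
      · rw [cutoff_apply _ hxt, PiLp.smul_apply, vfCoord]
        rw [hφ.eq_zero X hX _ (φ.map_target hxt) (by rwa [φ.right_inv hxt]) i hi, smul_zero]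
      · rw [cutoff_eq_zero _ fun hx ↦ hxt (image_tsupport_subset hη hx)]
        rfl)
  refine ⟨fun k ↦ chartFun hφ.mem hχ (hh k), fun p ↦ ?_⟩
  let Xp : Eucl n := X p
  change η p • Xp = ∑ k, (χ p • h k (φ p)) • (χ p • dSymm φ (φ p) (genField m k (φ p)))
  have h1 : ∑ k, (χ p • h k (φ p)) • (χ p • dSymm φ (φ p) (genField m k (φ p))) =
      χ p • χ p • dSymm φ (φ p) (∑ k, h k (φ p) • genField m k (φ p)) := by
    rw [map_sum, Finset.smul_sum, Finset.smul_sum]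
    refine Finset.sum_congr rfl fun k _ ↦ ?_
    rw [map_smul]
    module
  rw [h1, ← hs]
  by_cases hp : η p = 0
  · rw [hp, zero_smul]
    by_cases hps : p ∈ φ.source
    · rw [cutoff_apply_chart _ hps, hp, zero_smul, map_zero, smul_zero, smul_zero]
    · rw [image_eq_zero_of_notMem_tsupport fun h ↦ hps (hχ h), zero_smul]
  · have hps : p ∈ φ.source := hη (subset_tsupport _ hp)
    have h2 : dSymm φ (φ p) (vfCoord φ X (φ p)) = Xp := by
      have := dSymm_dChart hφ.mem (φ.map_source hps) (X (φ.symm (φ p)))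
      rw [vfCoord, this, φ.left_inv hps]
    rw [cutoff_apply_chart _ hps, hχη p hp, map_smul, h2, one_smul, one_smul]

/-- The vector fields tangent to a closed regular submanifold of a compact manifold are a finitely
generated module over the smooth functions. -/
theorem exists_finite_generators (hL : IsRegularSubmanifold n n' L) (hLc : IsClosed L) :
    ∃ (κ : Type u) (_ : Fintype κ) (Y : κ → VField n M), (∀ k, IsTangentTo n' L (Y k)) ∧
      ∀ X : VField n M, IsTangentTo n' L X → ∃ f : κ → SmoothFun ℝ n M,
        ∀ p, X p = ∑ k, f k p • Y k p := by
  choose φ m hφ hmem using exists_detectsTangency hL hLc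
  obtain ⟨ρ, hρ⟩ := SmoothPartitionOfUnity.exists_isSubordinate (𝓡 n) isClosed_univ
    (fun p ↦ (φ p).source) (fun p ↦ (φ p).open_source)
    (fun p _ ↦ Set.mem_iUnion.2 ⟨p, hmem p⟩)
  -- An auxiliary atlas indexed by the points of M. Only its finitely many `indices` contribute
  -- generators.
  let 𝒜 : PartitionedAtlas n M M := ⟨φ, fun p ↦ (hφ p).mem, ρ, hρ⟩
  refine ⟨𝒜.indices × (Option (Fin n) × Fin n), inferInstance, fun k ↦
    chartField (hφ k.1).mem (𝒜.tsupport_cutoffFun k.1) (contDiff_genField (m := m k.1) k.2),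
    fun k ↦ (hφ k.1).tangent _ _ _ _ fun y hy i hi ↦ genField_eq_zero k.2 hy hi, fun X hX ↦ ?_⟩
  choose c hc using fun q : M ↦ (hφ q).exists_eq_sum (𝒜.tsupport_cutoffFun q) (η := ρ q) (hρ q)
    (fun p hp ↦ 𝒜.cutoffFun_eq_one hp) hX
  refine ⟨fun k ↦ c k.1 k.2, fun p ↦ ?_⟩
  rw [Fintype.sum_prod_type]
  simp only [← hc]
  have h1 : ∑ q : 𝒜.indices, ρ q p • X p = (∑ q ∈ 𝒜.indices, ρ q p) • X p := by
    rw [Finset.sum_coe_sort 𝒜.indices (fun q ↦ ρ q p • X p), Finset.sum_smul]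
  rw [h1, 𝒜.sum_indices p, one_smul]

end Generators

section Words

variable {𝕜 : Type*} [RCLike 𝕜] {n : ℕ} {M : Type*} [TopologicalSpace M]
  [ChartedSpace (Eucl n) M] [IsManifold (𝓡 n) ∞ M]
  {n' : ℕ} {L : Set M} {κ : Type*} {Y : κ → VField n M}

/-! ### Differential operators as combinations of words in the generators -/

variable (𝕜) in
/-- The composition of a list of vector fields of a family. -/
def word (Y : κ → VField n M) (l : List κ) : Module.End 𝕜 (Distr 𝕜 n M) :=
  (l.map fun k ↦ vfDistr (Y k)).prod

lemma word_cons (k : κ) (l : List κ) : word 𝕜 Y (k :: l) = vfDistr (Y k) * word 𝕜 Y l := by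
  simp [word]

variable (𝕜) in
/-- The module of operators spanned by the words in a family of vector fields. -/
def wordSpan (Y : κ → VField n M) : Submodule 𝕜 (Module.End 𝕜 (Distr 𝕜 n M)) :=
  Submodule.span 𝕜 {P | ∃ (f : SmoothFun 𝕜 n M) (l : List κ), P = mulDistr f * word 𝕜 Y l}

lemma mulDistr_mul_word_mem (f : SmoothFun 𝕜 n M) (l : List κ) :
    mulDistr f * word 𝕜 Y l ∈ wordSpan 𝕜 Y := Submodule.subset_span ⟨f, l, rfl⟩

lemma wordSpan_le_diff (hY : ∀ k, IsTangentTo n' L (Y k)) : wordSpan 𝕜 Y ≤ Diff 𝕜 n' L := by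
  refine Submodule.span_le.2 ?_
  rintro _ ⟨f, l, rfl⟩
  refine Submodule.subset_span ⟨f, l.map Y, fun X hX ↦ ?_, ?_⟩
  · obtain ⟨k, -, rfl⟩ := List.mem_map.1 hX
    exact hY k
  · rw [List.map_map]; rfl

lemma word_mem_wordSpan (l : List κ) : word 𝕜 Y l ∈ wordSpan 𝕜 Y := by
  have h := mulDistr_mul_word_mem (𝕜 := 𝕜) (Y := Y) (ContMDiffMap.const 1) l
  rwa [mulDistr_one, one_mul] at h

lemma mulDistr_mul_mem (f : SmoothFun 𝕜 n M) {P : Module.End 𝕜 (Distr 𝕜 n M)}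
    (hP : P ∈ wordSpan 𝕜 Y) : mulDistr f * P ∈ wordSpan 𝕜 Y := by
  refine (Submodule.span_le (p := (wordSpan 𝕜 Y).comap (LinearMap.mulLeft 𝕜 (mulDistr f)))).2 ?_ hP
  rintro _ ⟨g, l, rfl⟩
  change mulDistr f * (mulDistr g * word 𝕜 Y l) ∈ wordSpan 𝕜 Y
  rw [← mul_assoc, mulDistr_mul]
  exact mulDistr_mul_word_mem _ l

/-- The commutation relation moves the field past the function to lengthen the word, at the cost of
one term in which the function is differentiated. -/
lemma vfDistr_mul_mem (k : κ) {P : Module.End 𝕜 (Distr 𝕜 n M)}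
    (hP : P ∈ wordSpan 𝕜 Y) : vfDistr (Y k) * P ∈ wordSpan 𝕜 Y := by
  refine (Submodule.span_le
    (p := (wordSpan 𝕜 Y).comap (LinearMap.mulLeft 𝕜 (vfDistr (Y k))))).2 ?_ hP
  rintro _ ⟨g, l, rfl⟩
  change vfDistr (Y k) * (mulDistr g * word 𝕜 Y l) ∈ wordSpan 𝕜 Y
  rw [← mul_assoc, vfDistr_mul_mulDistr, add_mul, mul_assoc, ← word_cons]
  exact Submodule.add_mem _ (mulDistr_mul_word_mem _ _) (mulDistr_mul_word_mem _ _)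

/-- If the vector fields tangent to `L` are combinations of the vector fields of a finite family,
then the operators in `Diff(M, L)` are combinations of words in this family. -/
lemma diff_le_wordSpan [CompactSpace M] [T2Space M] [Fintype κ]
    (hgen : ∀ X : VField n M, IsTangentTo n' L X → ∃ f : κ → SmoothFun ℝ n M,
      ∀ p, X p = ∑ k, f k p • Y k p) : Diff 𝕜 n' L ≤ wordSpan 𝕜 Y := by
  refine Submodule.span_le.2 ?_
  rintro _ ⟨f, l, hl, rfl⟩
  refine mulDistr_mul_mem f ?_
  induction l with
  | nil => exact word_mem_wordSpan []
  | cons X l ih =>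
    -- The leading field is expanded in the generators, and the induction hypothesis treats the rest
    -- of the list.
    obtain ⟨c, hc⟩ := hgen X (hl X (by simp))
    rw [List.map_cons, List.prod_cons, vfDistr_eq_sum hc, Finset.sum_mul]
    refine Submodule.sum_mem _ fun k _ ↦ ?_
    rw [mul_assoc]
    exact mulDistr_mul_mem _ (vfDistr_mul_mem k (ih fun Z hZ ↦ hl Z (by simp [hZ])))

/-- The words are transposes of operators on densities. -/
lemma exists_transpose_word (l : List κ) : ∃ A : Density 𝕜 n M → Density 𝕜 n M,
    ∀ (u : Distr 𝕜 n M) (μ : Density 𝕜 n M), word 𝕜 Y l u μ = u (A μ) := by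
  induction l with
  | nil => exact ⟨id, fun _ _ ↦ rfl⟩
  | cons k l ih =>
    obtain ⟨A, hA⟩ := ih
    refine ⟨fun μ ↦ A (-lieDens (Y k) μ), fun u μ ↦ ?_⟩
    rw [word_cons]
    change -(word 𝕜 Y l u (lieDens (Y k) μ)) = _
    rw [← hA, map_neg]

end Words

section ConormalOrderTopology

universe u

variable {𝕜 : Type*} [RCLike 𝕜] {n : ℕ} {M : Type u} [TopologicalSpace M]
  [ChartedSpace (Eucl n) M] [IsManifold (𝓡 n) ∞ M] [CompactSpace M] [T2Space M]
  {n' : ℕ} {L : Set M} {ι : Type*} {𝒜 : PartitionedAtlas n M ι} {s : ℝ}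

/-! ### The semi-norms of the conormal distributions of bounded order -/

/-- The linear map `P : I^{(s)}(M, L) → H^s(M)`, for `P ∈ Diff(M, L)`. -/
def applyDiffLin (P : ↥(Diff (n := n) 𝕜 n' L)) :
    ConormalOrder 𝕜 𝒜 n' L s →ₗ[𝕜] ↥(sobolevSubmodule 𝕜 𝒜 s) where
  toFun u := ⟨P.1 u.1, u.2 P.1 P.2⟩
  map_add' u v := Subtype.ext (map_add P.1 u.1 v.1)
  map_smul' c u := Subtype.ext (map_smul P.1 c u.1)

/-- The semi-norms of `I^{(s)}(M, L)`. -/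
def conormalSeminorm (P : ↥(Diff (n := n) 𝕜 n' L)) (i : ι) :
    Seminorm 𝕜 (ConormalOrder 𝕜 𝒜 n' L s) :=
  Seminorm.of (fun u ↦ sobolevSeminorm 𝒜 s i (applyDiffLin P u))
    (fun u v ↦ by rw [map_add]; exact map_add_le_add _ _ _)
    (fun c u ↦ by rw [map_smul]; exact map_smul_eq_mul _ _ _)

lemma conormalSeminorm_apply (P : ↥(Diff (n := n) 𝕜 n' L)) (i : ι)
    (u : ConormalOrder 𝕜 𝒜 n' L s) :
    conormalSeminorm P i u = sobolevSeminorm 𝒜 s i (applyDiffLin P u) := rfl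

/-- The map assigning to `u` the function `(1 + |D|²)^{s/2} v` in `L²(ℝⁿ)`, where `v` is a local
part of `P u`. -/
def conormalToL2 (P : ↥(Diff (n := n) 𝕜 n' L)) (i : ι) :
    ConormalOrder 𝕜 𝒜 n' L s →+
      MeasureTheory.Lp ℂ 2 (MeasureTheory.volume : MeasureTheory.Measure (Eucl n)) :=
  AddMonoidHom.mk' (fun u ↦ (Sobolev.localPart (𝕜 := 𝕜) (𝒜 := 𝒜) (s := s) i
    (ConormalOrder.applyDiff P u)).toL2) fun u v ↦ by
      have h := Sobolev.toL2_localPart_add_smul (𝒜 := 𝒜) (s := s) i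
        (w := ConormalOrder.applyDiff P (u + v)) (u := ConormalOrder.applyDiff P u)
        (v := ConormalOrder.applyDiff P v) (a := (1 : 𝕜)) (b := 1)
        (by rw [one_smul, one_smul]; exact map_add P.1 u.1 v.1)
      have h1 : RCLike.map 𝕜 ℂ 1 = 1 := by simp [RCLike.map]
      rw [h, h1, one_smul, one_smul]

/-- The intermediate types carry no group structure. The composite maps into L² are additive, so the
topology is seen to be a group topology, determined by its neighborhoods of zero. -/
lemma conormalOrder_topology_eq :
    (inferInstance : TopologicalSpace (ConormalOrder 𝕜 𝒜 n' L s)) =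
      ⨅ (P : ↥(Diff (n := n) 𝕜 n' L)) (i : ι),
        TopologicalSpace.induced (conormalToL2 P i) inferInstance := by
  change ⨅ P, TopologicalSpace.induced (ConormalOrder.applyDiff P)
    (⨅ i, TopologicalSpace.induced (Sobolev.localPart i)
      (TopologicalSpace.induced EuclSobolev.toL2 inferInstance)) = _
  simp only [induced_iInf, induced_compose]
  rfl

instance : IsTopologicalAddGroup (ConormalOrder 𝕜 𝒜 n' L s) := by
  have h : @IsTopologicalAddGroup (ConormalOrder 𝕜 𝒜 n' L s)
      (⨅ (P : ↥(Diff (n := n) 𝕜 n' L)) (i : ι),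
        TopologicalSpace.induced (conormalToL2 P i) inferInstance) _ :=
    topologicalAddGroup_iInf fun P ↦ topologicalAddGroup_iInf fun i ↦
      topologicalAddGroup_induced (conormalToL2 P i)
  rwa [← conormalOrder_topology_eq] at h

lemma nhds_zero_conormalOrder : 𝓝 (0 : ConormalOrder 𝕜 𝒜 n' L s) =
    ⨅ (P : ↥(Diff (n := n) 𝕜 n' L)) (i : ι),
      (𝓝 (0 : ℝ)).comap (conormalSeminorm (𝒜 := 𝒜) (s := s) P i) := by
  have h : 𝓝 (0 : ConormalOrder 𝕜 𝒜 n' L s) = @nhds _ (⨅ (P : ↥(Diff (n := n) 𝕜 n' L)) (i : ι),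
        TopologicalSpace.induced (conormalToL2 (𝒜 := 𝒜) (s := s) P i) inferInstance) 0 :=
    congrArg (fun t ↦ @nhds _ t 0) conormalOrder_topology_eq
  rw [h]
  simp only [nhds_iInf, nhds_induced, map_zero]
  refine iInf_congr fun P ↦ iInf_congr fun i ↦ ?_
  rw [← comap_norm_nhds_zero, Filter.comap_comap]
  rfl

variable {κ : Type u} {Y : κ → VField n M}

lemma word_mem_diff (hY : ∀ k, IsTangentTo n' L (Y k)) (l : List κ) :
    word 𝕜 Y l ∈ Diff 𝕜 n' L := wordSpan_le_diff hY (word_mem_wordSpan l)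

/-- The semi-norms of `I^{(s)}(M, L)` given by the words in a countable family of vector fields. -/
def wordSeminorm [Countable κ] (hY : ∀ k, IsTangentTo n' L (Y k)) (𝒜 : PartitionedAtlas n M ι)
    (s : ℝ) : SeminormFamily 𝕜 (ConormalOrder 𝕜 𝒜 n' L s) ℕ :=
  letI := Encodable.ofCountable (List κ × 𝒜.indices)
  -- Integers that encode nothing get the zero semi-norm. Only the finite set `𝒜.indices` is used,
  -- since ι need not be countable.
  fun k ↦ (Encodable.decode (α := List κ × 𝒜.indices) k).elim 0
    fun a ↦ conormalSeminorm ⟨word 𝕜 Y a.1, word_mem_diff hY a.1⟩ a.2.1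

variable [Countable κ] (hY : ∀ k, IsTangentTo n' L (Y k))

lemma exists_wordSeminorm_eq (l : List κ) (i : 𝒜.indices) : ∃ k,
    wordSeminorm (𝕜 := 𝕜) hY 𝒜 s k = conormalSeminorm ⟨word 𝕜 Y l, word_mem_diff hY l⟩ i.1 := by
  let := Encodable.ofCountable (List κ × 𝒜.indices)
  refine ⟨Encodable.encode (l, i), ?_⟩
  simp only [wordSeminorm, Encodable.encodek]
  rfl

lemma wordSeminorm_eq (k : ℕ) : wordSeminorm (𝕜 := 𝕜) hY 𝒜 s k = 0 ∨ ∃ (l : List κ) (i : ι),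
    wordSeminorm (𝕜 := 𝕜) hY 𝒜 s k = conormalSeminorm ⟨word 𝕜 Y l, word_mem_diff hY l⟩ i := by
  let := Encodable.ofCountable (List κ × 𝒜.indices)
  rcases h : Encodable.decode (α := List κ × 𝒜.indices) k with _ | a
  · left
    simp only [wordSeminorm, h]
    rfl
  · right
    refine ⟨a.1, a.2.1, ?_⟩
    simp only [wordSeminorm, h]
    rfl

lemma conormalSeminorm_eq_zero {i : ι} (hi : i ∉ 𝒜.indices) (P : ↥(Diff (n := n) 𝕜 n' L))
    (u : ConormalOrder 𝕜 𝒜 n' L s) : conormalSeminorm P i u = 0 := by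
  have h := Sobolev.toL2_localPart_zero (𝕜 := 𝕜) (𝒜 := 𝒜) (s := s) hi (applyDiffLin P u)
  exact norm_eq_zero.2 h

/-- Every operator is a combination of terms f w, and multiplication by f is bounded on H^s(M). With
filters, span induction passes directly through sums and scalar multiples. -/
lemma tendsto_conormalSeminorm {α : Type*} {F : Filter α} {u : α → ConormalOrder 𝕜 𝒜 n' L s}
    (h : ∀ l i, Filter.Tendsto
      (fun a ↦ conormalSeminorm ⟨word 𝕜 Y l, word_mem_diff hY l⟩ i (u a)) F (𝓝 0))
    (hgen : Diff 𝕜 n' L ≤ wordSpan 𝕜 Y) (P : ↥(Diff (n := n) 𝕜 n' L)) (i : ι) :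
    Filter.Tendsto (fun a ↦ conormalSeminorm P i (u a)) F (𝓝 0) := by
  have key : ∀ (P : Module.End 𝕜 (Distr 𝕜 n M)) (hP : P ∈ wordSpan 𝕜 Y), Filter.Tendsto
      (fun a ↦ conormalSeminorm ⟨P, wordSpan_le_diff hY hP⟩ i (u a)) F (𝓝 0) := by
    intro P hP
    induction hP using Submodule.span_induction with
    | mem P hP =>
      obtain ⟨f, l, rfl⟩ := hP
      obtain ⟨C, -, hC⟩ := exists_mul_bound (𝕜 := 𝕜) (𝒜 := 𝒜) f s
      refine squeeze_zero (fun _ ↦ apply_nonneg _ _) (fun a ↦ ?_)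
        ((mul_zero (C i)) ▸ (h l i).const_mul (C i))
      obtain ⟨w, hw, hwC⟩ := hC (applyDiffLin ⟨word 𝕜 Y l, word_mem_diff hY l⟩ (u a))
      refine le_trans (le_of_eq ?_) (hwC i)
      rw [conormalSeminorm_apply]
      exact congrArg _ (Subtype.ext hw.symm)
    | zero =>
      refine tendsto_const_nhds.congr fun a ↦ ?_
      rw [conormalSeminorm_apply]
      exact (map_zero (sobolevSeminorm 𝒜 s i)).symm
    | add P Q hP hQ h1 h2 =>
      refine squeeze_zero (fun _ ↦ apply_nonneg _ _) (fun a ↦ ?_) ((add_zero (0 : ℝ)) ▸ h1.add h2)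
      exact map_add_le_add (sobolevSeminorm 𝒜 s i) (applyDiffLin ⟨P, _⟩ (u a))
        (applyDiffLin ⟨Q, _⟩ (u a))
    | smul c P hP h1 =>
      have h2 := h1.const_mul ‖c‖
      rw [mul_zero] at h2
      refine h2.congr fun a ↦ ?_
      exact (map_smul_eq_mul (sobolevSeminorm 𝒜 s i) c (applyDiffLin ⟨P, _⟩ (u a))).symm
  exact key P.1 (hgen P.2)

/-- The word semi-norms are among the defining ones, or zero. Conversely, applying
`tendsto_conormalSeminorm` to the filter they generate recovers all the others. -/
lemma withSeminorms_wordSeminorm (hgen : Diff 𝕜 n' L ≤ wordSpan 𝕜 Y) :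
    WithSeminorms (wordSeminorm (𝕜 := 𝕜) hY 𝒜 s) := by
  rw [SeminormFamily.withSeminorms_iff_nhds_eq_iInf, nhds_zero_conormalOrder]
  refine le_antisymm (le_iInf fun k ↦ ?_) (le_iInf₂ fun P i ↦ Filter.tendsto_iff_comap.1
    (tendsto_conormalSeminorm hY (u := id) (fun l i ↦ ?_) hgen P i))
  · obtain h | ⟨l, i, h⟩ := wordSeminorm_eq (𝕜 := 𝕜) (𝒜 := 𝒜) (s := s) hY k
    · rw [h]
      exact Filter.tendsto_iff_comap.1 tendsto_const_nhds
    · rw [h]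
      exact (iInf_le _ _).trans (iInf_le _ i)
  · by_cases hi : i ∈ 𝒜.indices
    · obtain ⟨k, hk⟩ := exists_wordSeminorm_eq (𝕜 := 𝕜) (s := s) hY l ⟨i, hi⟩
      exact Filter.tendsto_iff_comap.2 (hk ▸ iInf_le _ k)
    · simp only [conormalSeminorm_eq_zero hi]
      exact tendsto_const_nhds

/-- The empty word suffices: if the Sobolev semi-norms of u vanish, a constant sequence converges
weakly both to u and to 0. -/
lemma eq_zero_of_wordSeminorm {u : ConormalOrder 𝕜 𝒜 n' L s}
    (hu : ∀ k, wordSeminorm (𝕜 := 𝕜) hY 𝒜 s k u = 0) : u = 0 := by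
  set w : ↥(sobolevSubmodule 𝕜 𝒜 s) :=
    applyDiffLin ⟨word 𝕜 Y [], word_mem_diff hY []⟩ u with hw
  have h0 (i : ι) : sobolevSeminorm 𝒜 s i w = 0 := by
    by_cases hi : i ∈ 𝒜.indices
    · obtain ⟨k, hk⟩ := exists_wordSeminorm_eq (𝕜 := 𝕜) (s := s) hY [] ⟨i, hi⟩
      exact (DFunLike.congr_fun hk u).symm.trans (hu k)
    · exact conormalSeminorm_eq_zero hi _ u
  have h4 : w - 0 = w := Subtype.ext (sub_zero w.1)
  have h2 (μ : Density 𝕜 n M) : w.1 μ = 0 := by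
    have h1 : Filter.Tendsto (fun _ : ℕ ↦ w.1 μ) Filter.atTop
        (𝓝 ((0 : ↥(sobolevSubmodule 𝕜 𝒜 s)).1 μ)) :=
      tendsto_apply_of_sobolevSeminorm
        (fun i ↦ by simp only [h4, h0]; exact tendsto_const_nhds) μ
    exact tendsto_nhds_unique tendsto_const_nhds h1
  have h3 : w.1 = u.1 := rfl
  exact Subtype.ext (ContinuousLinearMap.ext fun μ ↦ by rw [← h3, h2 μ]; rfl)

lemma exists_tendsto_of_wordSeminorm (hgen : Diff 𝕜 n' L ≤ wordSpan 𝕜 Y)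
    (u : ℕ → ConormalOrder 𝕜 𝒜 n' L s)
    (hu : ∀ i, ∀ ε > 0, ∃ N, ∀ k ≥ N, ∀ l ≥ N, wordSeminorm (𝕜 := 𝕜) hY 𝒜 s i (u k - u l) < ε) :
    ∃ x, Filter.Tendsto u Filter.atTop (𝓝 x) := by
  let W (l : List κ) : ↥(Diff (n := n) 𝕜 n' L) := ⟨word 𝕜 Y l, word_mem_diff hY l⟩
  have h1 (l : List κ) : ∃ v : ↥(sobolevSubmodule 𝕜 𝒜 s), ∀ i, Filter.Tendsto
      (fun k ↦ sobolevSeminorm 𝒜 s i (applyDiffLin (W l) (u k) - v)) Filter.atTop (𝓝 0) := by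
    refine exists_sobolevSeminorm_tendsto _ fun i ε hε ↦ ?_
    by_cases hi : i ∈ 𝒜.indices
    · obtain ⟨j, hj⟩ := exists_wordSeminorm_eq (𝕜 := 𝕜) (s := s) hY l ⟨i, hi⟩
      have h2 := hu j ε hε
      rw [hj] at h2
      simpa only [conormalSeminorm_apply, map_sub] using h2
    · refine ⟨0, fun k _ m _ ↦ ?_⟩
      have h2 := conormalSeminorm_eq_zero hi (W l) (u k - u m)
      rw [conormalSeminorm_apply, map_sub] at h2
      rwa [h2]
  choose v hv using h1
  -- The limits for different words are compatible: words are transposes, hence weakly continuous,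
  -- and Sobolev convergence implies weak convergence.
  have hvw (l : List κ) : word 𝕜 Y l (v []).1 = (v l).1 := by
    obtain ⟨A, hA⟩ := exists_transpose_word (𝕜 := 𝕜) (Y := Y) l
    refine ContinuousLinearMap.ext fun μ ↦ ?_
    rw [hA]
    refine tendsto_nhds_unique (tendsto_apply_of_sobolevSeminorm (hv []) (A μ)) ?_
    exact (tendsto_apply_of_sobolevSeminorm (hv l) μ).congr fun k ↦ hA (u k).1 μ
  -- All words send the limit into H^s(M), and this space is stable under multiplication by smooth
  -- functions, so all of Diff(M, L) does.
  have hmem : (v []).1 ∈ conormalOrderSubmodule 𝕜 𝒜 n' L s := by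
    intro P hP
    refine (Submodule.span_le (p := (sobolevSubmodule 𝕜 𝒜 s).comap
      (LinearMap.applyₗ (R := 𝕜) (v []).1))).2 ?_ (hgen hP)
    rintro _ ⟨f, l, rfl⟩
    obtain ⟨C, -, hC⟩ := exists_mul_bound (𝕜 := 𝕜) (𝒜 := 𝒜) f s
    obtain ⟨w, hw, -⟩ := hC (v l)
    change mulDistr f (word 𝕜 Y l (v []).1) ∈ sobolevSubmodule 𝕜 𝒜 s
    rw [hvw, ← hw]
    exact w.2
  let x : ConormalOrder 𝕜 𝒜 n' L s := ⟨(v []).1, hmem⟩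
  have hx (l : List κ) : applyDiffLin (W l) x = v l := Subtype.ext (hvw l)
  refine ⟨x, ((withSeminorms_wordSeminorm hY hgen).tendsto_nhds u x).2 fun j ε hε ↦ ?_⟩
  obtain h | ⟨l, i, h⟩ := wordSeminorm_eq (𝕜 := 𝕜) (𝒜 := 𝒜) (s := s) hY j
  · rw [h]
    exact .of_forall fun _ ↦ hε
  · rw [h]
    simp only [conormalSeminorm_apply, map_sub]
    filter_upwards [(hv l i).eventually (gt_mem_nhds hε)] with k hk
    rw [show applyDiffLin _ x = v l from hx l]
    exact hk

theorem isCompleteFamily_wordSeminorm (hgen : Diff 𝕜 n' L ≤ wordSpan 𝕜 Y) :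
    IsCompleteFamily (wordSeminorm (𝕜 := 𝕜) hY 𝒜 s) where
  withSeminorms := withSeminorms_wordSeminorm hY hgen
  separating _ hu := eq_zero_of_wordSeminorm hY hu
  complete u hu := exists_tendsto_of_wordSeminorm hY hgen u hu

/-- The topology of `I^{(s)}(M, L)` is given by a sequence of semi-norms, for which it is
complete. -/
theorem exists_isCompleteFamily (hL : IsRegularSubmanifold n n' L) (hLc : IsClosed L)
    (𝒜 : PartitionedAtlas n M ι) (s : ℝ) :
    ∃ p : SeminormFamily 𝕜 (ConormalOrder 𝕜 𝒜 n' L s) ℕ, IsCompleteFamily p := by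
  obtain ⟨κ, _, Y, hY, hgen⟩ := exists_finite_generators hL hLc
  exact ⟨_, isCompleteFamily_wordSeminorm hY (diff_le_wordSpan hgen)⟩

end ConormalOrderTopology

section ConormalTopology

variable {𝕜 : Type*} [RCLike 𝕜] {n : ℕ} {M : Type*} [TopologicalSpace M]
  [ChartedSpace (Eucl n) M] [IsManifold (𝓡 n) ∞ M] [CompactSpace M] [T2Space M]
  {n' : ℕ} {L : Set M} {ι : Type*} {𝒜 : PartitionedAtlas n M ι}

/-! ### The inductive limit -/

variable (𝕜 𝒜 n' L) in
/-- The inclusion of `I^{(s)}(M, L)` in `I(M, L)`, as a continuous linear map. -/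
def inclCLM (s : ℝ) : ConormalOrder 𝕜 𝒜 n' L s →L[𝕜] Conormal 𝕜 𝒜 n' L where
  toFun := ConormalOrder.incl
  map_add' _ _ := rfl
  map_smul' _ _ := rfl
  cont := ConormalOrder.continuous_incl

lemma inclCLM_injective (s : ℝ) : Function.Injective (inclCLM 𝕜 n' L 𝒜 s) := fun _ _ h ↦
  Subtype.ext (congrArg (fun w : Conormal 𝕜 𝒜 n' L ↦ w.1) h)

/-- The spaces grow as s decreases, so the orders -k already exhaust the union; the web needs this
countability. -/
lemma exists_inclCLM_neg_nat_eq (x : Conormal 𝕜 𝒜 n' L) :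
    ∃ (k : ℕ) (y : _), inclCLM 𝕜 n' L 𝒜 (-k) y = x := by
  obtain ⟨s, hs⟩ := x.2
  obtain ⟨k, hk⟩ := exists_nat_ge (-s)
  exact ⟨k, ⟨x.1, conormalOrderSubmodule_mono (by linarith) hs⟩, rfl⟩

/-- The universal property of the inductive limit, for semi-norms. -/
lemma continuous_seminorm_conormal (q : Seminorm 𝕜 (Conormal 𝕜 𝒜 n' L))
    (hq : ∀ s, Continuous fun x ↦ q (inclCLM 𝕜 n' L 𝒜 s x)) : Continuous q := by
  let j (s : ℝ) := (inclCLM 𝕜 n' L 𝒜 s).toLinearMap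
  let p : SeminormFamily 𝕜 (Conormal 𝕜 𝒜 n' L) Unit := fun _ ↦ q
  -- The topology defined by q alone is one of those whose infimum is the limit topology, which is
  -- therefore finer.
  let t : TopologicalSpace (Conormal 𝕜 𝒜 n' L) := p.moduleFilterBasis.topology
  have hp : @WithSeminorms 𝕜 (Conormal 𝕜 𝒜 n' L) Unit _ _ _ p t :=
    @WithSeminorms.mk _ _ _ _ _ _ p t rfl
  have h1 : instTopologicalSpaceConormal ≤ t :=
    sInf_le (And.intro (fun s ↦ continuous_iff_coinduced_le.1
      (hp.continuous_of_continuous_comp (j s) fun _ ↦ hq s))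
      ⟨hp.topologicalAddGroup, hp.continuousSMul, hp.toPolynormableSpace⟩)
  exact continuous_le_dom h1 (hp.continuous_seminorm ())

variable (L) in
lemma one_mem_diff : (1 : Module.End 𝕜 (Distr 𝕜 n M)) ∈ Diff 𝕜 n' L :=
  Submodule.subset_span ⟨ContMDiffMap.const 1, [], by simp, by rw [mulDistr_one]; rfl⟩

/-- The semi-norm `u ↦ |⟨u, μ⟩|`. -/
def evalSeminorm (μ : Density 𝕜 n M) : Seminorm 𝕜 (Conormal 𝕜 𝒜 n' L) :=
  Seminorm.of (fun u ↦ ‖u.1 μ‖) (fun u v ↦ norm_add_le (u.1 μ) (v.1 μ))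
    (fun c u ↦ norm_smul c (u.1 μ))

/-- The identity belongs to Diff(M, L), so convergence in I^(s) implies convergence in H^s(M), and
thus weak convergence. -/
lemma continuous_evalSeminorm (μ : Density 𝕜 n M) :
    Continuous (evalSeminorm (𝒜 := 𝒜) (n' := n') (L := L) μ) := by
  refine continuous_seminorm_conormal _ fun s ↦ ?_
  refine Seminorm.continuous_of_continuousAt_zero
    (p := (evalSeminorm μ).comp (inclCLM 𝕜 n' L 𝒜 s).toLinearMap) ?_
  let P : ↥(Diff (n := n) 𝕜 n' L) := ⟨1, one_mem_diff L⟩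
  have h1 (i : ι) : Filter.Tendsto (fun u : ConormalOrder 𝕜 𝒜 n' L s ↦
      sobolevSeminorm 𝒜 s i (applyDiffLin P u - 0)) (𝓝 0) (𝓝 0) := by
    have h2 : Filter.Tendsto (conormalSeminorm (𝒜 := 𝒜) (s := s) P i) (𝓝 0) (𝓝 0) := by
      rw [Filter.tendsto_iff_comap, nhds_zero_conormalOrder]
      exact (iInf_le _ P).trans (iInf_le _ i)
    exact h2.congr fun u ↦ congrArg (sobolevSeminorm 𝒜 s i) (Subtype.ext (sub_zero _).symm)
  have h3 := (tendsto_apply_of_sobolevSeminorm h1 μ).norm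
  have h4 : (((evalSeminorm μ).comp (inclCLM 𝕜 n' L 𝒜 s).toLinearMap) 0 : ℝ) =
      ‖(0 : ↥(sobolevSubmodule 𝕜 𝒜 s)).1 μ‖ := rfl
  rw [ContinuousAt, h4]
  exact h3

/-- Distinct distributions differ on some density, and pairing with it is continuous. -/
instance : T2Space (Conormal 𝕜 𝒜 n' L) where
  t2 u v huv := by
    have h1 : ∃ μ, u.1 μ ≠ v.1 μ := by
      by_contra! h
      exact huv (Subtype.ext (ContinuousLinearMap.ext h))
    obtain ⟨μ, hμ⟩ := h1
    refine separated_by_continuous (f := fun w ↦ evalSeminorm μ (w - v))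
      ((continuous_evalSeminorm μ).comp (continuous_id.sub continuous_const)) fun h ↦ hμ ?_
    have h2 : evalSeminorm μ (v - v) = 0 := by rw [sub_self, map_zero]
    exact sub_eq_zero.1 (norm_eq_zero.1 (h.trans h2))

end ConormalTopology

end
end ConormalDist

/-! ### The main theorem. -/

theorem corollaryc {𝕜 : Type*} [RCLike 𝕜] {n : ℕ} {M : Type*} [TopologicalSpace M]
    [ChartedSpace (ConormalDist.Eucl n) M] [IsManifold (𝓡 n) ∞ M] [CompactSpace M] [T2Space M]
    {n' : ℕ} {L : Set M} (hL : ConormalDist.IsRegularSubmanifold n n' L) (hLc : IsClosed L)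
    {ι : Type*} (𝒜 : ConormalDist.PartitionedAtlas n M ι) :
    (∀ s : ℝ, ConormalDist.IsFrechetSpace 𝕜 (ConormalDist.ConormalOrder 𝕜 𝒜 n' L s)) ∧
    T2Space (ConormalDist.Conormal 𝕜 𝒜 n' L) ∧
    BarrelledSpace 𝕜 (ConormalDist.Conormal 𝕜 𝒜 n' L) ∧
    ConormalDist.IsUltrabornological 𝕜 (ConormalDist.Conormal 𝕜 𝒜 n' L) ∧
    ConormalDist.IsWebbed 𝕜 (ConormalDist.Conormal 𝕜 𝒜 n' L) := by
  have h := ConormalDist.exists_isCompleteFamily (𝕜 := 𝕜) hL hLc 𝒜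
  have hsmul (s : ℝ) : ContinuousSMul 𝕜 (ConormalDist.ConormalOrder 𝕜 𝒜 n' L s) :=
    (h s).choose_spec.withSeminorms.continuousSMul
  have hsurj := ConormalDist.exists_inclCLM_neg_nat_eq (𝕜 := 𝕜) (𝒜 := 𝒜) (n' := n') (L := L)
  refine ⟨fun s ↦ (h s).choose_spec.isFrechetSpace, inferInstance, ?_, ?_, ?_⟩
  · exact ConormalDist.barrelledSpace_of_inductiveLimit (ConormalDist.inclCLM 𝕜 n' L 𝒜)
      ConormalDist.continuous_seminorm_conormal fun s ↦ (h s).choose_spec.barrelledSpace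
  · exact ConormalDist.isUltrabornological_of_inductiveLimit (ConormalDist.inclCLM 𝕜 n' L 𝒜)
      ConormalDist.inclCLM_injective (fun x ↦ (hsurj x).imp' (fun k : ℕ ↦ -(k : ℝ)) fun _ ↦ id)
      ConormalDist.continuous_seminorm_conormal fun s ↦ (h s).choose_spec.isUltrabornological
  · exact ConormalDist.isWebbed_of_inductiveLimit (ConormalDist.inclCLM 𝕜 n' L 𝒜) h _ hsurj
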